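/- Let $n\ge 2$ and let $K\subset\mathbb R^n$ be a convex body with the origin in its interior, origin-symmetric ($K=-K$), with $C^\infty$-smooth boundary and strictly positive curvature (write $K\in\mathcal K^\infty_{+,e}$). Let $h_K(y)=\max_{x\in K}\langle y,x\rangle$ be its support function, and for a $1$-homogeneous function $h$ let $D^2h$ be the restriction of its Euclidean Hessian to the tangent spaces of the unit sphere $S^{n-1}$. On $S^{n-1}$ consider the metric $g_K=D^2h_K/h_K$, the measure $\nu_K=h_K\det(D^2h_K)\,\mathfrak m$ ($\mathfrak m$ the surface measure of $S^{n-1}$) and the Hilbert–Brunn–Minkowski operator $$\Delta_K z=((D^2h_K)^{-1})^{ij}D^2_{ij}(z\,h_K)-(n-1)z ,$$ where $z$ is extended $0$-homogeneously. The operator $-\Delta_K$ on $C^2(S^{n-1})$ extends uniquely to a self-adjoint operator on $L^2(\nu_K)$; let $\lambda_{1,e}(-\Delta_K)$ be the minimum of the spectrum of its restriction to even functions $f$ with $\int f\,d\nu_K=0$. For $p\in\mathbb R$, say that $K$ satisfies the local even $L^p$-Brunn–Minkowski inequality if for every even $f\in C^2(S^{n-1})$ $$\int f\,d\nu_K=0\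 \Longrightarrow\ \int|\mathrm{grad}_{g_K}f|^2\,d\nu_K=\int(-\Delta_Kf)f\,d\nu_K\ \ge\ (n-p)\int f^2\,d\nu_K ;$$ the case $p=0$ is the local even log-Brunn–Minkowski inequality. For $L\in\mathcal K^\infty_{+,e}$, let $\delta^{\partial L}$ be the Euclidean metric induced on $\partial L$, $\mathrm{II}^{\partial L}$ the second fundamental form with respect to the outer unit normal $\mathfrak n$, and $g_L^{\partial L}(u,v)=\langle \bar D_u x^*,v\rangle$, with $x^*=\bar D\|x\|_L$ the gradient of the gauge of $L$, the centro-affine metric (equivalently $g_L^{\partial L}=\mathrm{II}^{\partial L}/h_L(\mathfrak n)$). Let $B_2^n$ be the Euclidean unit ball. **Theorem.** 1. Suppose that some linear image $\tilde K=T(K)$, $T\in GL_n$, satisfies $$\tfrac1B\,\delta^{\partial\tilde K}\le g_{\tilde K}^{\partial\tilde K}\le\tfrac1A\,\delta^{\partial\tilde K},\qquad \tilde K\subset R\,B_2^n,$$ for some $A,B,R>0$. Then $\lambda_{1,e}(-\Delta_K)\ge n-p$, i.e. $K$ satisfies the local even $L^p$-Brunn–Minkowski inequality, with $$p=2-\frac{\frac{n-1}{2}A-R^2}{B}.$$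 2. In particular, if some linear image $\tilde K$ of $K$ satisfies $\frac1R\,\delta^{\partial\tilde K}\le \mathrm{II}^{\partial\tilde K}\le\frac1r\,\delta^{\partial\tilde K}$ for some $r,R>0$, then $\lambda_{1,e}(-\Delta_K)\ge n-p$ and $K$ satisfies the local even $L^p$-Brunn–Minkowski inequality with $$p=3-\frac{n-1}{2}\,\frac{r^2}{R^2}.$$ 3. In particular, if moreover $(R/r)^2\le\frac{n-1}{6}$ in 2., then $\lambda_{1,e}(-\Delta_K)\ge n$ and $K$ satisfies the local even log-Brunn–Minkowski inequality. -/

import Mathlib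

open Set MeasureTheory Metric
open scoped ContDiff RealInnerProductSpace

noncomputable section

namespace CentroAffine

/-- Euclidean space of dimension `n`, identified with its dual. -/
abbrev E (n : ℕ) := EuclideanSpace ℝ (Fin n)

/-- The Euclidean unit sphere. -/
abbrev Sph (n : ℕ) := sphere (0 : E n) 1

variable {n : ℕ}

/-! ### Geometry of the boundary of a convex body -/

/-- The support function `h_K`. -/
def supp (K : Set (E n)) (y : E n) : ℝ := sSup ((fun x => ⟪y, x⟫) '' K)

/-- The centro-affine conormal `x* = D‖x‖_K`: on the boundary of `K` it is orthogonal to the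
boundary and satisfies `⟪x*, x⟫ = 1`. -/
def conormal (K : Set (E n)) (x : E n) : E n := gradient (gauge K) x

/-- The outer unit normal at a boundary point `x` (extended as a `0`-homogeneous function). -/
def normal (K : Set (E n)) (x : E n) : E n := ‖conormal K x‖⁻¹ • conormal K x

/-- The tangent space of the boundary of `K` at `x`. -/
def tangent (K : Set (E n)) (x : E n) : Submodule ℝ (E n) := (Submodule.span ℝ {normal K x})ᗮ

/-- The second fundamental form of the boundary of `K` with respect to the outer unit normal
(used for `u, v` tangent at the boundary point `x`). -/
def secondForm (K : Set (E n)) (x u v : E n) : ℝ := ⟪fderiv ℝ (normal K) x u, v⟫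

/-- The centro-affine metric on the boundary of `K`, `g(u, v) = ⟪dx*(u), dx(v)⟫`
(used for `u, v` tangent at the boundary point `x`). -/
def boundaryMetric (K : Set (E n)) (x u v : E n) : ℝ := ⟪fderiv ℝ (conormal K) x u, v⟫

/-- Origin-symmetric convex bodies with the origin in the interior, having a `C^∞`-smooth boundary
and strictly positive curvature. As the origin is interior, the boundary is the radial graph
of `1 / ‖·‖_K` over the sphere, so that it is smooth when the gauge is smooth off the origin. -/
structure IsSmoothEvenBody (K : Set (E n)) : Prop where
  convex : Convex ℝ K
  compact : IsCompact K
  zero_mem : (0 : E n) ∈ interior K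
  symm : ∀ x ∈ K, -x ∈ K
  smooth : ContDiffOn ℝ ∞ (gauge K) {0}ᶜ
  curvature_pos : ∀ x ∈ frontier K, ∀ u ∈ tangent K x, u ≠ 0 → 0 < secondForm K x u u

/-- `a δ ≤ g ≤ b δ` for the centro-affine metric `g` and the induced Euclidean metric `δ` on the
boundary of `K`. -/
def MetricBetween (K : Set (E n)) (a b : ℝ) : Prop :=
  ∀ x ∈ frontier K, ∀ u ∈ tangent K x,
    a * ⟪u, u⟫ ≤ boundaryMetric K x u u ∧ boundaryMetric K x u u ≤ b * ⟪u, u⟫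

/-- `a δ ≤ II ≤ b δ` for the second fundamental form `II` and the induced Euclidean metric `δ` on
the boundary of `K`. -/
def SecondFormBetween (K : Set (E n)) (a b : ℝ) : Prop :=
  ∀ x ∈ frontier K, ∀ u ∈ tangent K x,
    a * ⟪u, u⟫ ≤ secondForm K x u u ∧ secondForm K x u u ≤ b * ⟪u, u⟫

/-! ### Calculus on the sphere -/

/-- The tangent space of the sphere at `θ`. -/
abbrev TS (θ : Sph n) : Submodule ℝ (E n) := (Submodule.span ℝ {(θ : E n)})ᗮ

/-- The `0`-homogeneous extension of a function on the sphere. -/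
def homExt (z : Sph n → ℝ) (y : E n) : ℝ :=
  if hy : y = 0 then 0 else z ⟨‖y‖⁻¹ • y, by simp [norm_smul, hy]⟩

/-- Even functions of class `C²` on the sphere. -/
def IsEvenC2 (z : Sph n → ℝ) : Prop :=
  ContDiffOn ℝ 2 (homExt z) {0}ᶜ ∧ ∀ θ, z (-θ) = z θ

/-- The tangential gradient of a function on the sphere. -/
def sphGrad (z : Sph n → ℝ) (θ : Sph n) : TS θ :=
  (TS θ).orthogonalProjectionOnto (gradient (homExt z) θ)

/-- The restriction `D² h` to the tangent space of the sphere of the Euclidean Hessian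
of a (`1`-homogeneous) function `h`, as an endomorphism of the tangent space. -/
def D2 (h : E n → ℝ) (θ : Sph n) : Module.End ℝ (TS θ) :=
  ((TS θ).orthogonalProjectionOnto ∘L fderiv ℝ (gradient h) (θ : E n) ∘L (TS θ).subtypeL).toLinearMap

/-- The metric `g_K = D² h_K / h_K` on the sphere, as an endomorphism of the tangent space. -/
def metricOp (K : Set (E n)) (θ : Sph n) : Module.End ℝ (TS θ) :=
  (supp K θ)⁻¹ • D2 (supp K) θ

/-- `|grad z|²` with respect to `g_K`, that is `g_K^{ij} z_i z_j`. -/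
def gradSq (K : Set (E n)) (z : Sph n → ℝ) (θ : Sph n) : ℝ :=
  ⟪Ring.inverse (metricOp K θ) (sphGrad z θ), sphGrad z θ⟫

/-- The measure `ν_K = h_K det(D² h_K) 𝔪 = n V_K` on the sphere, where `𝔪` is the surface measure
of the sphere and `V_K` the cone-volume measure. -/
def nu (K : Set (E n)) : Measure (Sph n) :=
  (volume : Measure (E n)).toSphere.withDensity
    fun θ => ENNReal.ofReal (supp K θ * LinearMap.det (D2 (supp K) θ))

/-- The Hilbert--Brunn--Minkowski operator
`Δ_K z = ((D² h_K)⁻¹)^{ij} D²_{ij}(z h_K) - (n - 1) z`. -/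
def laplace (K : Set (E n)) (z : Sph n → ℝ) (θ : Sph n) : ℝ :=
  LinearMap.trace ℝ (TS θ)
      (Ring.inverse (D2 (supp K) θ) * D2 (fun y => homExt z y * supp K y) θ)
    - ((n : ℝ) - 1) * z θ

/-! ### The first non-trivial even eigenvalue -/

/-- The even elements of `L²(ν_K)` of mean zero. -/
def evenL2 (K : Set (E n)) : Set (Lp ℝ 2 (nu K)) :=
  {u | (∀ᵐ θ ∂(nu K), u (-θ) = u θ) ∧ ∫ θ, u θ ∂(nu K) = 0}

/-- The graph of `-Δ_K` on the even `C²` functions of mean zero. -/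
def coreGraph (K : Set (E n)) : Set (Lp ℝ 2 (nu K) × Lp ℝ 2 (nu K)) :=
  {q | ∃ z : Sph n → ℝ, IsEvenC2 z ∧ ∫ θ, z θ ∂(nu K) = 0 ∧
    (∀ᵐ θ ∂(nu K), q.1 θ = z θ) ∧ ∀ᵐ θ ∂(nu K), q.2 θ = -laplace K z θ}

/-- The spectrum of the self-adjoint extension of `-Δ_K`, restricted to even functions of mean
zero. The graph of that (unique) extension is the closure of the graph on `C²` functions, and `μ`
is in the resolvent set when `(-Δ_K - μ) u = w` has exactly one solution `u` for all `w`. -/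
def evenSpectrum (K : Set (E n)) : Set ℝ :=
  {μ | ¬ ∀ w ∈ evenL2 K, ∃! u : Lp ℝ 2 (nu K), (u, w + μ • u) ∈ closure (coreGraph K)}

/-- `λ_{1,e}(-Δ_K)`, the bottom of the spectrum of `-Δ_K` on even functions of mean zero. -/
def lambdaOneEven (K : Set (E n)) : EReal :=
  sInf ((fun μ : ℝ => (μ : EReal)) '' evenSpectrum K)

/-- The local even `L^p`-Brunn--Minkowski inequality for `K`: for all even `f` of class `C²` with
`∫ f dν_K = 0`, one has `∫ |grad f|² dν_K = ∫ (-Δ_K f) f dν_K ≥ (n - p) ∫ f² dν_K`. -/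
def LocalEvenLpBM (K : Set (E n)) (p : ℝ) : Prop :=
  ∀ f : Sph n → ℝ, IsEvenC2 f → ∫ θ, f θ ∂(nu K) = 0 →
    ∫ θ, gradSq K f θ ∂(nu K) = ∫ θ, -laplace K f θ * f θ ∂(nu K) ∧
    ((n : ℝ) - p) * ∫ θ, f θ ^ 2 ∂(nu K) ≤ ∫ θ, -laplace K f θ * f θ ∂(nu K)

end CentroAffine

end

/-!
A smooth even body `K` is encoded by its support function `h`, and everything takes place off
the origin, for homogeneous functions, with respect to the Hessian `P = D²(h² / 2)`.
On `0`-homogeneous functions the Hilbert–Brunn–Minkowski operator is `Δz = h² tr(P⁻¹ D²z)`,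
its carré du champ is `h² ⟨P⁻¹ Dz, Dz⟩`, and the measure is `h⁻ⁿ det P` times the surface measure
(`IsPotential.trace_inverse_D2_mul`, `IsPotential.inner_inverse_sphGrad`,
`IsPotential.weight_eq`).

*Bochner formula.* The operators `P⁻¹ D` are the partial derivatives in the dual coordinates
`x = D(h² / 2)(y)`, hence commute, and the cofactors of `P` are divergence free. Integration by parts
gives `∫ (Δz)² = ∫ |D²(z h) - z D²h|² + (n - 2) ∫ |grad z|²` (`IsPotential.bochner`). Since `Δz`
is a trace, `∫ (Δz)² ≥ (n - 1) ∫ |grad z|²` when `n ≥ 3` (`IsPotential.lichnerowicz`).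

*From `∫ (Δz)²` to a spectral gap.* If `λ ∫ |grad v|² ≤ ∫ (Δv)²` for all smooth `v` in a class of
functions whose image under `-Δ` is dense, then expanding `0 ≤ ∫ |grad (u - λ v)|²` with `-Δv`
close to `u` shows `λ ∫ u² ≤ ∫ |grad u|²` (`IsPotential.gap_of_dense`). The density of the range
replaces elliptic regularity: it is clear for the round sphere, by polynomials, and is carried
over along `h_t² = (1 - t) |y|² + t h²` by the method of continuity, the Bochner formula being the
a priori estimate (`IsPotential.dense_round_measure`, `IsPotential.dense_of_gap`). In particular
odd functions satisfy the Poincaré inequality with constant `n - 1` (`IsPotential.odd_gap`).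

*Even functions.* For even smooth `z` the components of `h M ∇z`, where `M` is the matrix of the
linear map `T`, are odd. Their Dirichlet energy is at most `2 B |D²(z h) - z D²h|² + 2 R² |grad z|²`,
while the sum of their squares is at least `A |grad z|²`. The odd Poincaré inequality
therefore bounds the Hessian term in the Bochner formula from below by `((n - 1) A / 2 - R²) / B`
times the energy (`IsPotential.lap_sq_ge`), and the gap follows (`IsPotential.even_gap`). In the
plane the constant is negative, because `A ≤ R²` (`IsSmoothEvenBody.le_sq_of_metric_le`).

*Geometry and spectrum.* The Legendre transform identifies the inverse of `P` with the Hessian of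
half the squared gauge, that is, with the centro-affine metric of the boundary
(`IsSmoothEvenBody.isPotential_supp`, `IsSmoothEvenBody.hessInv_bounds`). Bounds on the second
fundamental form give `r |y| ≤ h(y) ≤ R |y|` (`IsSmoothEvenBody.supp_bounds`), so the second part
is the first one with `A = r²` and `B = R²`. Below the gap, `-Δ - μ` is bounded below on the
closure of its graph and has dense range, so `μ` is not in the spectrum
(`IsSmoothEvenBody.existsUnique_of_lt`).
-/

noncomputable section

namespace CentroAffine

variable {n : ℕ}

/-! ### Calculus of homogeneous functions off the origin -/

/-- The `i`-th partial derivative. -/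
def pd (i : Fin n) (f : E n → ℝ) (y : E n) : ℝ := fderiv ℝ f y (EuclideanSpace.single i 1)

/-- Functions of class `C^k` on the complement of the origin. -/
def SmoothOff (k : WithTop ℕ∞) (f : E n → ℝ) : Prop := ∀ y, y ≠ 0 → ContDiffAt ℝ k f y

/-- Positively `k`-homogeneous functions on the complement of the origin. -/
def Hom (k : ℤ) (f : E n → ℝ) : Prop := ∀ t : ℝ, 0 < t → ∀ y, y ≠ 0 → f (t • y) = t ^ k * f y

theorem eventuallyEq_of_eqOff {f g : E n → ℝ} (h : ∀ y, y ≠ 0 → f y = g y) {y : E n}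
    (hy : y ≠ 0) : f =ᶠ[nhds y] g := by
  filter_upwards [isOpen_compl_singleton.mem_nhds hy] with x hx using h x hx

theorem pd_congr {f g : E n → ℝ} (h : ∀ y, y ≠ 0 → f y = g y) (i : Fin n) {y : E n}
    (hy : y ≠ 0) : pd i f y = pd i g y := by
  unfold pd
  rw [(eventuallyEq_of_eqOff h hy).fderiv_eq]

namespace SmoothOff

variable {k l : WithTop ℕ∞} {f g : E n → ℝ}

theorem of_contDiffOn (h : ContDiffOn ℝ k f {0}ᶜ) : SmoothOff k f := fun _ hy =>
  h.contDiffAt (isOpen_compl_singleton.mem_nhds hy)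

theorem congr (hf : SmoothOff k f) (h : ∀ y, y ≠ 0 → g y = f y) : SmoothOff k g := fun y hy =>
  (hf y hy).congr_of_eventuallyEq (eventuallyEq_of_eqOff h hy)

theorem of_le (hf : SmoothOff k f) (h : l ≤ k) : SmoothOff l f := fun y hy => (hf y hy).of_le h

theorem differentiableAt (hf : SmoothOff k f) (hk : k ≠ 0) {y : E n} (hy : y ≠ 0) :
    DifferentiableAt ℝ f y := (hf y hy).differentiableAt hk

theorem continuousAt (hf : SmoothOff k f) {y : E n} (hy : y ≠ 0) :
    ContinuousAt f y := (hf y hy).continuousAt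

theorem const (c : ℝ) : SmoothOff k (fun _ : E n => c) := fun _ _ => contDiffAt_const

theorem coord (i : Fin n) : SmoothOff k (fun y : E n => y i) := fun _ _ =>
  (EuclideanSpace.proj (𝕜 := ℝ) i).contDiff.contDiffAt

theorem add (hf : SmoothOff k f) (hg : SmoothOff k g) : SmoothOff k (fun y => f y + g y) :=
  fun y hy => (hf y hy).add (hg y hy)

theorem sub (hf : SmoothOff k f) (hg : SmoothOff k g) : SmoothOff k (fun y => f y - g y) :=
  fun y hy => (hf y hy).sub (hg y hy)

theorem neg (hf : SmoothOff k f) : SmoothOff k (fun y => -f y) :=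
  fun y hy => (hf y hy).neg

theorem mul (hf : SmoothOff k f) (hg : SmoothOff k g) : SmoothOff k (fun y => f y * g y) :=
  fun y hy => (hf y hy).mul (hg y hy)

theorem div_const (hf : SmoothOff k f) (c : ℝ) : SmoothOff k (fun y => f y / c) :=
  fun y hy => (hf y hy).div_const c

theorem pow (hf : SmoothOff k f) (m : ℕ) : SmoothOff k (fun y => f y ^ m) :=
  fun y hy => (hf y hy).pow m

theorem inv (hf : SmoothOff k f) (h0 : ∀ y, y ≠ 0 → f y ≠ 0) : SmoothOff k (fun y => (f y)⁻¹) :=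
  fun y hy => (hf y hy).inv (h0 y hy)

theorem zpow (hf : SmoothOff k f) (h0 : ∀ y, y ≠ 0 → f y ≠ 0) (m : ℤ) :
    SmoothOff k (fun y => f y ^ m) := by
  cases m with
  | ofNat m => simpa using hf.pow m
  | negSucc m => simpa [zpow_negSucc] using (hf.pow (m + 1)).inv fun y hy => pow_ne_zero _ (h0 y hy)

theorem sum {ι : Type*} {s : Finset ι} {f : ι → E n → ℝ} (hf : ∀ i ∈ s, SmoothOff k (f i)) :
    SmoothOff k (fun y => ∑ i ∈ s, f i y) :=
  fun y hy => ContDiffAt.sum fun i hi => hf i hi y hy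

theorem prod {ι : Type*} {s : Finset ι} {f : ι → E n → ℝ} (hf : ∀ i ∈ s, SmoothOff k (f i)) :
    SmoothOff k (fun y => ∏ i ∈ s, f i y) :=
  fun y hy => contDiffAt_prod fun i hi => hf i hi y hy

theorem pd (hf : SmoothOff l f) (h : k + 1 ≤ l) (i : Fin n) : SmoothOff k (pd i f) := fun y hy =>
  ((hf y hy).fderiv_right h).clm_apply contDiffAt_const

theorem comp_neg (hf : SmoothOff k f) : SmoothOff k (fun y => f (-y)) := fun y hy =>
  (hf (-y) (neg_ne_zero.2 hy)).comp y contDiff_neg.contDiffAt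

theorem normSq : SmoothOff k (fun y : E n => ‖y‖ ^ 2) := fun _ _ => contDiffAt_id.norm_sq ℝ

theorem norm : SmoothOff k (fun y : E n => ‖y‖) := fun _ hy => contDiffAt_id.norm ℝ hy

theorem sqrt (hf : SmoothOff k f) (h0 : ∀ y, y ≠ 0 → f y ≠ 0) :
    SmoothOff k (fun y => Real.sqrt (f y)) :=
  fun y hy => (hf y hy).sqrt (h0 y hy)

end SmoothOff

section Rules

variable {f g : E n → ℝ} {y : E n} (i : Fin n)

theorem pd_const (c : ℝ) : pd i (fun _ : E n => c) y = 0 := by simp [pd]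

theorem pd_coord (j : Fin n) : pd i (fun y : E n => y j) y = if i = j then 1 else 0 := by
  have : fderiv ℝ (fun y : E n => y j) y = EuclideanSpace.proj (𝕜 := ℝ) j :=
    (EuclideanSpace.proj (𝕜 := ℝ) j).fderiv
  simp [pd, this, eq_comm]

theorem pd_add (hf : SmoothOff 1 f) (hg : SmoothOff 1 g) (hy : y ≠ 0) :
    pd i (fun y => f y + g y) y = pd i f y + pd i g y := by
  simp [pd, fderiv_fun_add (hf.differentiableAt one_ne_zero hy)
    (hg.differentiableAt one_ne_zero hy)]

theorem pd_sub (hf : SmoothOff 1 f) (hg : SmoothOff 1 g) (hy : y ≠ 0) :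
    pd i (fun y => f y - g y) y = pd i f y - pd i g y := by
  simp [pd, fderiv_fun_sub (hf.differentiableAt one_ne_zero hy)
    (hg.differentiableAt one_ne_zero hy)]

theorem pd_mul (hf : SmoothOff 1 f) (hg : SmoothOff 1 g) (hy : y ≠ 0) :
    pd i (fun y => f y * g y) y = pd i f y * g y + f y * pd i g y := by
  simp [pd, fderiv_fun_mul (hf.differentiableAt one_ne_zero hy)
    (hg.differentiableAt one_ne_zero hy)]
  ring

theorem pd_const_mul (c : ℝ) : pd i (fun y => c * f y) y = c * pd i f y := by
  have : fderiv ℝ (c • f) y = c • fderiv ℝ f y := by rw [fderiv_const_smul_field]; rfl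
  change fderiv ℝ (c • f) y _ = _
  rw [this]; rfl

theorem pd_neg : pd i (fun y => -f y) y = -pd i f y := by
  simpa using pd_const_mul (f := f) (y := y) i (-1)

theorem pd_sum {ι : Type*} {s : Finset ι} {f : ι → E n → ℝ} (hf : ∀ j ∈ s, SmoothOff 1 (f j))
    (hy : y ≠ 0) : pd i (fun y => ∑ j ∈ s, f j y) y = ∑ j ∈ s, pd i (f j) y := by
  simp [pd, fderiv_fun_sum fun j hj => (hf j hj).differentiableAt one_ne_zero hy]

theorem pd_zpow (hf : SmoothOff 1 f) (h0 : ∀ y, y ≠ 0 → f y ≠ 0) (m : ℤ) (hy : y ≠ 0) :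
    pd i (fun y => f y ^ m) y = m * f y ^ (m - 1) * pd i f y := by
  have h1 := (hasDerivAt_zpow m (f y) (Or.inl (h0 y hy))).comp_hasFDerivAt y
    (hf.differentiableAt one_ne_zero hy).hasFDerivAt
  have : fderiv ℝ (fun y => f y ^ m) y = _ := h1.fderiv
  simp [pd, this]

theorem pd_sq (hf : SmoothOff 1 f) (hy : y ≠ 0) :
    pd i (fun y => f y ^ 2) y = 2 * f y * pd i f y := by
  simp only [sq]; rw [pd_mul i hf hf hy]; ring

theorem pd_comm (hf : SmoothOff 2 f) (i j : Fin n) (hy : y ≠ 0) :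
    pd i (pd j f) y = pd j (pd i f) y := by
  have hd : DifferentiableAt ℝ (fderiv ℝ f) y :=
    ((hf y hy).fderiv_right (m := 1) (by norm_num)).differentiableAt one_ne_zero
  have key : ∀ i j : Fin n, pd i (pd j f) y =
      fderiv ℝ (fderiv ℝ f) y (EuclideanSpace.single i 1) (EuclideanSpace.single j 1) := by
    intro i j
    have : fderiv ℝ (fun x => fderiv ℝ f x (EuclideanSpace.single j 1)) y = _ :=
      (hd.hasFDerivAt.clm_apply (hasFDerivAt_const (EuclideanSpace.single j (1 : ℝ)) y)).fderiv
    change fderiv ℝ (fun x => fderiv ℝ f x (EuclideanSpace.single j 1)) y _ = _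
    rw [this]; simp
  rw [key, key]
  exact (hf y hy).isSymmSndFDerivAt (by simp) _ _

theorem euclidean_eq_sum (v : E n) : v = ∑ i, v i • EuclideanSpace.single i (1 : ℝ) := by
  ext j; simp [Finset.sum_apply, Pi.single_apply]

theorem fderiv_eq_sum_pd (v : E n) : fderiv ℝ f y v = ∑ i, v i * pd i f y := by
  conv_lhs => rw [euclidean_eq_sum v]
  simp [pd, map_sum]

theorem pd_comp_neg : pd i (fun y => f (-y)) y = -pd i f (-y) := by
  have := fderiv_comp_smul (𝕜 := ℝ) (f := f) (x := y) (-1)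
  simp only [neg_smul, one_smul] at this
  simp [pd, this]

theorem Hom.pd {k : ℤ} (hf : Hom k f) (i : Fin n) : Hom (k - 1) (pd i f) := by
  intro t ht y hy
  have h1 : CentroAffine.pd i (fun y => f (t • y)) y = CentroAffine.pd i (fun y => t ^ k * f y) y :=
    pd_congr (fun z hz => hf t ht z hz) i hy
  rw [pd_const_mul] at h1
  have h2 : CentroAffine.pd i (fun y => f (t • y)) y = t * CentroAffine.pd i f (t • y) := by
    simp [CentroAffine.pd, fderiv_comp_smul (𝕜 := ℝ) (f := f) (x := y) t]
  rw [h2] at h1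
  rw [zpow_sub_one₀ ht.ne']
  field_simp
  linarith

/-- Euler's identity for homogeneous functions. -/
theorem Hom.euler {k : ℤ} (hf : Hom k f) (hs : SmoothOff 1 f) (hy : y ≠ 0) :
    ∑ i, y i * CentroAffine.pd i f y = k * f y := by
  rw [← fderiv_eq_sum_pd]
  have h1 : HasDerivAt (fun t : ℝ => f (t • y)) (fderiv ℝ f y y) 1 := by
    have h := (hasDerivAt_id (1 : ℝ)).smul_const y
    have h2 : HasFDerivAt f (fderiv ℝ f y) ((id (1 : ℝ)) • y) := by
      simpa using (hs.differentiableAt one_ne_zero hy).hasFDerivAt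
    simpa [Function.comp_def] using h2.comp_hasDerivAt (1 : ℝ) h
  have h2 : HasDerivAt (fun t : ℝ => t ^ k * f y) (k * f y) 1 := by
    simpa using (hasDerivAt_zpow k (1 : ℝ) (by simp)).mul_const (f y)
  refine h1.unique (h2.congr_of_eventuallyEq ?_)
  filter_upwards [Ioi_mem_nhds (zero_lt_one' ℝ)] with t ht using hf t ht y hy

theorem Hom.mul {k l : ℤ} (hf : Hom k f) (hg : Hom l g) : Hom (k + l) (fun y => f y * g y) := by
  intro t ht y hy
  simp only [hf t ht y hy, hg t ht y hy, zpow_add₀ ht.ne']; ring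

theorem Hom.add {k : ℤ} (hf : Hom k f) (hg : Hom k g) : Hom k (fun y => f y + g y) := by
  intro t ht y hy
  simp only [hf t ht y hy, hg t ht y hy]; ring

theorem Hom.sub {k : ℤ} (hf : Hom k f) (hg : Hom k g) : Hom k (fun y => f y - g y) := by
  intro t ht y hy
  simp only [hf t ht y hy, hg t ht y hy]; ring

theorem Hom.const_mul {k : ℤ} (hf : Hom k f) (c : ℝ) : Hom k (fun y => c * f y) := by
  intro t ht y hy
  simp only [hf t ht y hy]; ring

theorem Hom.sum {ι : Type*} {s : Finset ι} {k : ℤ} {f : ι → E n → ℝ} (hf : ∀ i ∈ s, Hom k (f i)) :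
    Hom k (fun y => ∑ i ∈ s, f i y) := by
  intro t ht y hy
  simp only [Finset.mul_sum]
  exact Finset.sum_congr rfl fun i hi => hf i hi t ht y hy

theorem Hom.zpow {k : ℤ} (hf : Hom k f) (m : ℤ) : Hom (k * m) (fun y => f y ^ m) := by
  intro t ht y hy
  simp only [hf t ht y hy, mul_zpow, zpow_mul]

theorem Hom.const (c : ℝ) : Hom 0 (fun _ : E n => c) := by intro t ht y hy; simp

theorem Hom.coord (i : Fin n) : Hom 1 (fun y : E n => y i) := by intro t ht y hy; simp

theorem Hom.congr {k : ℤ} (hf : Hom k f) (h : ∀ y, y ≠ 0 → g y = f y) : Hom k g := by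
  intro t ht y hy
  rw [h _ hy, h _ (smul_ne_zero ht.ne' hy), hf t ht y hy]

end Rules

theorem sph_ne_zero (θ : Sph n) : (θ : E n) ≠ 0 := ne_zero_of_mem_unit_sphere θ

theorem SmoothOff.continuous_sph {k : WithTop ℕ∞} {f : E n → ℝ} (hf : SmoothOff k f) :
    Continuous fun θ : Sph n => f θ :=
  continuous_iff_continuousAt.2 fun θ =>
    (hf.continuousAt (sph_ne_zero θ)).comp continuous_subtype_val.continuousAt

/-! ### The divergence theorem on the sphere -/

/-- The surface measure of the unit sphere. -/
abbrev sph (n : ℕ) : Measure (Sph n) := (volume : Measure (E n)).toSphere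

/-- Integration in polar coordinates of a radial function times a homogeneous one. -/
theorem integral_radial_mul_hom [NeZero n] (χ : ℝ → ℝ) {u : E n → ℝ} {k : ℤ} (hu : Hom k u) :
    ∫ y, χ ‖y‖ * u y = (∫ θ : Sph n, u θ ∂sph n) *
      ∫ r in Ioi (0 : ℝ), r ^ (n - 1) * (χ r * r ^ k) := by
  have : Nonempty (Fin n) := ⟨0⟩
  have : Nontrivial (E n) := by infer_instance
  have hdim : Module.finrank ℝ (E n) = n := by simp
  calc
    ∫ y : E n, χ ‖y‖ * u y = ∫ x : ({(0 : E n)}ᶜ : Set (E n)), χ ‖x.1‖ * u x.1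
        ∂((volume : Measure (E n)).comap (↑)) := by
      rw [integral_subtype_comap (measurableSet_singleton _).compl
        fun x : E n => χ ‖x‖ * u x, restrict_compl_singleton]
    _ = ∫ p, u (p.1 : E n) * (χ p.2 * (p.2 : ℝ) ^ k) ∂(sph n).prod
          (Measure.volumeIoiPow (Module.finrank ℝ (E n) - 1)) := by
      rw [← (volume : Measure (E n)).measurePreserving_homeomorphUnitSphereProd.integral_comp
        (Homeomorph.measurableEmbedding _)]
      refine integral_congr_ae (.of_forall fun x => ?_)
      have hx : (x : E n) ≠ 0 := x.2
      have hn : 0 < ‖(x : E n)‖ := norm_pos_iff.2 hx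
      have := hu ‖(x : E n)‖⁻¹ (inv_pos.2 hn) x hx
      simp only [homeomorphUnitSphereProd_apply_fst_coe, homeomorphUnitSphereProd_apply_snd_coe,
        this, inv_zpow]
      have : (‖(x : E n)‖ ^ k) ≠ 0 := zpow_ne_zero _ hn.ne'
      field_simp
    _ = _ := by
      rw [integral_prod_mul (μ := sph n) (fun θ : Sph n => u θ)
        (fun r : Ioi (0 : ℝ) => χ r * (r : ℝ) ^ k)]
      congr 1
      simp only [Measure.volumeIoiPow, ENNReal.ofReal, hdim]
      rw [integral_withDensity_eq_integral_smul
        ((measurable_subtype_coe.pow_const _).real_toNNReal),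
        integral_subtype_comap measurableSet_Ioi
          fun a : ℝ => Real.toNNReal (a ^ (n - 1)) • (χ a * a ^ k)]
      refine setIntegral_congr_fun measurableSet_Ioi fun x hx => ?_
      simp only [NNReal.smul_def, Real.coe_toNNReal _ (pow_nonneg (le_of_lt hx) _), smul_eq_mul]

/-- A bump function supported in `[1, 2]`, used as a radial cut-off. -/
def radialBump : ContDiffBump (3 / 2 : ℝ) where
  rIn := 1 / 4
  rOut := 1 / 2
  rIn_pos := by norm_num
  rIn_lt_rOut := by norm_num

theorem radialBump_eq_zero {r : ℝ} (hr : r ≤ 1) : radialBump r = 0 := by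
  apply radialBump.zero_of_le_dist
  rw [Real.dist_eq, abs_sub_comm]
  refine le_trans ?_ (le_abs_self _)
  simp only [radialBump]; linarith

theorem radialBump_eq_zero_of_ge {r : ℝ} (hr : 2 ≤ r) : radialBump r = 0 := by
  apply radialBump.zero_of_le_dist
  rw [Real.dist_eq]
  refine le_trans ?_ (le_abs_self _)
  simp only [radialBump]; linarith

theorem integral_radialBump_div_pos : 0 < ∫ r in Ioi (0 : ℝ), radialBump r * r⁻¹ := by
  rw [setIntegral_eq_integral_of_forall_compl_eq_zero]
  · refine Continuous.integral_pos_of_hasCompactSupport_nonneg_nonzero (x := 3 / 2) ?_ ?_ ?_ ?_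
    · rw [continuous_iff_continuousAt]
      intro r
      rcases eq_or_ne r 0 with rfl | hr
      · have : (fun _ : ℝ => (0 : ℝ)) =ᶠ[nhds 0] fun r => radialBump r * r⁻¹ := by
          filter_upwards [Iio_mem_nhds (zero_lt_one' ℝ)] with r hr
          rw [radialBump_eq_zero (le_of_lt hr), zero_mul]
        exact continuousAt_const.congr this
      · exact radialBump.continuous.continuousAt.mul (continuousAt_inv₀ hr)
    · exact radialBump.hasCompactSupport.mul_right
    · intro r
      rcases le_total r 1 with hr | hr
      · simp [radialBump_eq_zero hr]
      · exact mul_nonneg radialBump.nonneg (inv_nonneg.2 (by linarith))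
    · have : radialBump (3 / 2 : ℝ) = 1 := radialBump.one_of_mem_closedBall (by
        simp only [radialBump, mem_closedBall, dist_self]; norm_num)
      rw [this]; norm_num
  · intro r hr
    rw [radialBump_eq_zero (by simp only [mem_Ioi, not_lt] at hr; linarith), zero_mul]

theorem integral_deriv_radialBump : ∫ r in Ioi (0 : ℝ), deriv radialBump r = 0 := by
  rw [radialBump.hasCompactSupport.integral_Ioi_deriv_eq radialBump.contDiff,
    radialBump_eq_zero zero_le_one, neg_zero]

theorem tsupport_radialBump_norm_subset :
    tsupport (fun y : E n => radialBump ‖y‖) ⊆ {y | 1 ≤ ‖y‖} ∩ closedBall 0 2 := by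
  refine closure_minimal (fun y hy => ?_)
    ((isClosed_le continuous_const continuous_norm).inter isClosed_closedBall)
  rw [Function.mem_support] at hy
  constructor
  · by_contra h
    exact hy (radialBump_eq_zero (le_of_not_ge h))
  · rw [mem_closedBall_zero_iff]
    by_contra h
    exact hy (radialBump_eq_zero_of_ge (le_of_not_ge h))

theorem contDiff_radialBump_norm : ContDiff ℝ ∞ (fun y : E n => radialBump ‖y‖) := by
  rw [contDiff_iff_contDiffAt]
  intro y
  rcases eq_or_ne y 0 with rfl | hy
  · have : (fun y : E n => radialBump ‖y‖) =ᶠ[nhds 0] fun _ => 0 := by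
      filter_upwards [ball_mem_nhds (0 : E n) one_pos] with y hy
      exact radialBump_eq_zero (le_of_lt (mem_ball_zero_iff.1 hy))
    exact contDiffAt_const.congr_of_eventuallyEq this
  · exact radialBump.contDiff.contDiffAt.comp y (contDiffAt_id.norm ℝ hy)

theorem hasCompactSupport_radialBump_norm :
    HasCompactSupport (fun y : E n => radialBump ‖y‖) :=
  HasCompactSupport.intro (isCompact_closedBall (0 : E n) 2) fun y hy =>
    radialBump_eq_zero_of_ge (le_of_lt (by simpa using hy))

/-- Off the origin continuous functions become integrable after multiplication with a continuous
function supported where the radial cut-off is. -/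
theorem integrable_mul_of_tsupport {u g : E n → ℝ} (hu : ∀ y, y ≠ 0 → ContinuousAt u y)
    (hg : Continuous g) (hgs : tsupport g ⊆ tsupport (fun y : E n => radialBump ‖y‖)) :
    Integrable (fun y => u y * g y) := by
  have hcs : HasCompactSupport g :=
    hasCompactSupport_radialBump_norm.of_isClosed_subset (isClosed_tsupport g) hgs
  refine Continuous.integrable_of_hasCompactSupport ?_ hcs.mul_left
  rw [continuous_iff_continuousAt]
  intro y
  rcases eq_or_ne y 0 with rfl | hy
  · have h0 : (0 : E n) ∉ tsupport g := fun h => by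
      have := (tsupport_radialBump_norm_subset (hgs h)).1
      simp only [mem_ofPred_eq, norm_zero] at this
      linarith
    have : (fun _ : E n => (0 : ℝ)) =ᶠ[nhds 0] fun y => u y * g y := by
      filter_upwards [(isClosed_tsupport g).isOpen_compl.mem_nhds h0] with y hy
      rw [image_eq_zero_of_notMem_tsupport hy, mul_zero]
    exact continuousAt_const.congr this
  · exact (hu y hy).mul hg.continuousAt

/-- A partial derivative of a `(1 - n)`-homogeneous function has mean zero on the sphere. -/
theorem integral_sph_pd_eq_zero (j : Fin n) {w : E n → ℝ} (hw : SmoothOff 1 w)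
    (hh : Hom (1 - n) w) : ∫ θ : Sph n, pd j w θ ∂sph n = 0 := by
  have : NeZero n := ⟨fun h => (h ▸ j).elim0⟩
  set g : E n → ℝ := fun y => radialBump ‖y‖ with hg
  have hgd : ContDiff ℝ ∞ g := contDiff_radialBump_norm
  have hgd1 : Differentiable ℝ g := hgd.differentiable (by simp)
  have hg' : Continuous fun y => fderiv ℝ g y (EuclideanSpace.single j 1) :=
    (hgd.continuous_fderiv (by simp)).clm_apply continuous_const
  have hpd : ∀ y, y ≠ 0 → ContinuousAt (pd j w) y := fun y hy =>
    (hw.pd (k := 0) (by simp) j).continuousAt hy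
  have hibp := integral_mul_fderiv_eq_neg_fderiv_mul_of_integrable (μ := (volume : Measure (E n)))
    (f := w) (g := g) (v := EuclideanSpace.single j 1)
    (integrable_mul_of_tsupport hpd hgd.continuous subset_rfl)
    (integrable_mul_of_tsupport (fun y hy => hw.continuousAt hy) hg'
      (tsupport_fderiv_apply_subset ℝ _))
    (integrable_mul_of_tsupport (fun y hy => hw.continuousAt hy) hgd.continuous subset_rfl)
    (fun y hy => hw.differentiableAt one_ne_zero fun h => by
      have := (tsupport_radialBump_norm_subset hy).1
      simp only [mem_ofPred_eq, h, norm_zero] at this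
      linarith)
    (fun y _ => hgd1 y)
  have hne : ∀ y : E n, y ≠ 0 → (fun y : E n => ‖y‖) y ≠ 0 := fun y hy => norm_ne_zero_iff.2 hy
  have hnhom : Hom 1 (fun y : E n => ‖y‖) := by
    intro t ht y hy
    simp [norm_smul, abs_of_pos ht]
  -- the gradient of the cut-off is radial
  have hdg : ∀ y : E n, w y * fderiv ℝ g y (EuclideanSpace.single j 1) =
      deriv radialBump ‖y‖ * (w y * (y j * ‖y‖ ^ (-1 : ℤ))) := by
    intro y
    rcases eq_or_ne y 0 with rfl | hy
    · have : fderiv ℝ g 0 = 0 := by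
        have : g =ᶠ[nhds 0] fun _ => 0 := by
          filter_upwards [ball_mem_nhds (0 : E n) one_pos] with y hy
          exact radialBump_eq_zero (le_of_lt (mem_ball_zero_iff.1 hy))
        rw [this.fderiv_eq]; simp
      simp [this]
    · have h1 : HasFDerivAt g (deriv radialBump ‖y‖ • fderiv ℝ (fun y : E n => ‖y‖) y) y := by
        have hb : HasDerivAt radialBump (deriv radialBump ‖y‖) ‖y‖ :=
          ((radialBump.contDiff (n := 1)).differentiable (by simp) _).hasDerivAt
        exact hb.comp_hasFDerivAt y
          ((SmoothOff.norm (k := 1)).differentiableAt one_ne_zero hy).hasFDerivAt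
      have h2 : pd j (fun y : E n => ‖y‖) y = y j * ‖y‖ ^ (-1 : ℤ) := by
        have h3 := pd_sq (f := fun y : E n => ‖y‖) j SmoothOff.norm hy
        have h4 : pd j (fun y : E n => ‖y‖ ^ 2) y = 2 * y j := by
          have h5 : HasFDerivAt (fun y : E n => ‖y‖ ^ 2) _ y := (hasFDerivAt_id y).norm_sq
          unfold pd
          rw [h5.fderiv]
          simp [EuclideanSpace.inner_single_right]
        have := norm_pos_iff.2 hy
        rw [zpow_neg_one]
        field_simp
        linarith
      rw [h1.fderiv]
      simp only [smul_apply, smul_eq_mul]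
      change w y * (_ * pd j (fun y : E n => ‖y‖) y) = _
      rw [h2]; ring
  have hL : ∫ y, w y * fderiv ℝ g y (EuclideanSpace.single j 1) = 0 := by
    simp_rw [hdg]
    have hh2 := hh.mul ((Hom.coord j).mul (hnhom.zpow (-1)))
    rw [integral_radial_mul_hom _ hh2]
    have : ∫ r in Ioi (0 : ℝ), r ^ (n - 1) * (deriv radialBump r *
        r ^ ((1 : ℤ) - n + (1 + 1 * -1))) = ∫ r in Ioi (0 : ℝ), deriv radialBump r := by
      refine setIntegral_congr_fun measurableSet_Ioi fun r hr => ?_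
      have hr : (0 : ℝ) < r := hr
      have e : (1 : ℤ) - n + (1 + 1 * -1) = -((n - 1 : ℕ) : ℤ) := by
        have := NeZero.one_le (n := n); push_cast [this]; ring
      simp only [e, zpow_neg, zpow_natCast]
      field_simp
    rw [this, integral_deriv_radialBump, mul_zero]
  have hR : ∫ y, fderiv ℝ w y (EuclideanSpace.single j 1) * g y =
      (∫ θ : Sph n, pd j w θ ∂sph n) * ∫ r in Ioi (0 : ℝ), radialBump r * r⁻¹ := by
    have := integral_radial_mul_hom radialBump (hh.pd j)
    simp_rw [mul_comm (fderiv ℝ w _ _)]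
    refine this.trans ?_
    congr 1
    refine setIntegral_congr_fun measurableSet_Ioi fun r hr => ?_
    have hr : (0 : ℝ) < r := hr
    have e : (1 : ℤ) - n - 1 = -((n : ℕ) : ℤ) := by ring
    have e2 : r ^ n = r ^ (n - 1) * r := by
      rw [← pow_succ, Nat.sub_add_cancel (NeZero.one_le (n := n))]
    simp only [e, zpow_neg, zpow_natCast, e2]
    field_simp
  rw [hL, hR] at hibp
  have := integral_radialBump_div_pos
  rcases mul_eq_zero.1 (neg_eq_zero.1 hibp.symm) with h | h
  · exact h
  · exact absurd h this.ne'

/-- The surface measure is even: pass to an integral over the space in polar coordinates. -/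
theorem integral_sph_comp_neg [NeZero n] {u : E n → ℝ} (hu : Hom 0 u) :
    ∫ θ : Sph n, u (-(θ : E n)) ∂sph n = ∫ θ : Sph n, u θ ∂sph n := by
  have hu' : Hom 0 fun y => u (-y) := by
    intro t ht y hy
    simpa using hu t ht (-y) (neg_ne_zero.2 hy)
  have hpos : 0 < ∫ r in Ioi (0 : ℝ), radialBump r * r⁻¹ := integral_radialBump_div_pos
  let χ : ℝ → ℝ := fun r => (r ^ (n - 1))⁻¹ * (radialBump r * r⁻¹)
  have h1 := integral_radial_mul_hom χ hu
  have h2 := integral_radial_mul_hom χ hu'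
  have h3 : ∫ y : E n, χ ‖y‖ * u (-y) = ∫ y : E n, χ ‖y‖ * u y := by
    rw [← integral_neg_eq_self (fun y : E n => χ ‖y‖ * u y)]
    simp
  have h4 : ∫ r in Ioi (0 : ℝ), r ^ (n - 1) * (χ r * r ^ (0 : ℤ)) =
      ∫ r in Ioi (0 : ℝ), radialBump r * r⁻¹ := by
    refine setIntegral_congr_fun measurableSet_Ioi fun r hr => ?_
    have hr : (0 : ℝ) < r := hr
    simp only [χ, zpow_zero, mul_one]
    field_simp
  rw [h4] at h1 h2
  rw [h3, h1] at h2
  exact (mul_right_cancel₀ hpos.ne' h2).symm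

/-! ### Derivatives of determinants and inverse matrices -/

section MatrixCalculus

variable {M : E n → Matrix (Fin n) (Fin n) ℝ} {k : WithTop ℕ∞}

theorem SmoothOff.det (hM : ∀ i j, SmoothOff k fun y => M y i j) :
    SmoothOff k fun y => (M y).det := by
  simp only [Matrix.det_apply']
  exact SmoothOff.sum fun σ _ => (SmoothOff.const _).mul (SmoothOff.prod fun i _ => hM _ _)

theorem SmoothOff.adjugate (hM : ∀ i j, SmoothOff k fun y => M y i j) (i j : Fin n) :
    SmoothOff k fun y => (M y).adjugate i j := by
  simp only [Matrix.adjugate_apply]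
  refine SmoothOff.det fun a b => ?_
  simp only [Matrix.updateRow_apply]
  split_ifs
  · exact SmoothOff.const _
  · exact hM a b

theorem SmoothOff.matrix_inv (hM : ∀ i j, SmoothOff k fun y => M y i j)
    (h0 : ∀ y, y ≠ 0 → (M y).det ≠ 0) (i j : Fin n) : SmoothOff k fun y => (M y)⁻¹ i j := by
  simp only [Matrix.inv_def, Matrix.smul_apply, Ring.inverse_eq_inv, smul_eq_mul]
  exact ((SmoothOff.det hM).inv h0).mul (SmoothOff.adjugate hM i j)

theorem pd_prod {ι : Type*} [DecidableEq ι] {s : Finset ι} {f : ι → E n → ℝ}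
    (hf : ∀ j ∈ s, SmoothOff 1 (f j)) (k : Fin n) {y : E n} (hy : y ≠ 0) :
    pd k (fun y => ∏ j ∈ s, f j y) y = ∑ i ∈ s, (∏ j ∈ s.erase i, f j y) * pd k (f i) y := by
  have := HasFDerivAt.finsetProd (u := s) (g := f) (x := y)
    fun i hi => ((hf i hi).differentiableAt one_ne_zero hy).hasFDerivAt
  have h2 : fderiv ℝ (fun y => ∏ j ∈ s, f j y) y = _ := this.fderiv
  simp [pd, h2]

/-- Jacobi's formula for the derivative of a determinant. -/
theorem pd_det (hM : ∀ i j, SmoothOff 1 fun y => M y i j) (k : Fin n) {y : E n} (hy : y ≠ 0) :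
    pd k (fun y => (M y).det) y =
      ∑ i, ∑ j, (M y).adjugate j i * pd k (fun y => M y i j) y := by
  have h1 : ∀ j, ∑ i, (M y).adjugate j i * pd k (fun y => M y i j) y =
      ((M y).updateCol j fun i => pd k (fun y => M y i j) y).det := by
    intro j
    rw [← Matrix.cramer_apply, Matrix.cramer_eq_adjugate_mulVec]
    rfl
  rw [Finset.sum_comm]
  simp only [h1, Matrix.det_apply']
  rw [pd_sum k (fun σ _ => (SmoothOff.const _).mul (SmoothOff.prod fun i _ => hM _ _)) hy,
    Finset.sum_comm]
  refine Finset.sum_congr rfl fun σ _ => ?_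
  rw [pd_const_mul, pd_prod (fun i _ => hM _ _) k hy, Finset.mul_sum]
  refine Finset.sum_congr rfl fun j _ => ?_
  rw [← Finset.mul_prod_erase _ _ (Finset.mem_univ j)]
  simp only [Matrix.updateCol_self]
  rw [mul_comm (∏ _ ∈ _, _)]
  congr 2
  exact Finset.prod_congr rfl fun i hi => by rw [Matrix.updateCol_ne (Finset.ne_of_mem_erase hi)]

/-- `∂ M⁻¹ = -M⁻¹ (∂M) M⁻¹`. -/
theorem pd_matrix_inv (hM : ∀ i j, SmoothOff 1 fun y => M y i j)
    (h0 : ∀ y, y ≠ 0 → (M y).det ≠ 0) (k i j : Fin n) {y : E n} (hy : y ≠ 0) :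
    pd k (fun y => (M y)⁻¹ i j) y =
      -∑ a, ∑ b, (M y)⁻¹ i a * pd k (fun y => M y a b) y * (M y)⁻¹ b j := by
  have hQ := SmoothOff.matrix_inv hM h0
  have hmul : ∀ a, ∑ b, (pd k (fun y => M y a b) y * (M y)⁻¹ b j +
      M y a b * pd k (fun y => (M y)⁻¹ b j) y) = 0 := by
    intro a
    have h1 : ∀ z, z ≠ 0 → ∑ b, M z a b * (M z)⁻¹ b j = (1 : Matrix (Fin n) (Fin n) ℝ) a j := by
      intro z hz
      rw [← Matrix.mul_nonsing_inv (M z) (isUnit_iff_ne_zero.2 (h0 z hz)), Matrix.mul_apply]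
    have h2 := pd_congr h1 k hy
    rw [pd_const, pd_sum k (fun b _ => (hM a b).mul (hQ b j)) hy] at h2
    rw [← h2]
    exact Finset.sum_congr rfl fun b _ => (pd_mul k (hM a b) (hQ b j) hy).symm
  have hinv := Matrix.nonsing_inv_mul (M y) (isUnit_iff_ne_zero.2 (h0 y hy))
  let N : Matrix (Fin n) (Fin n) ℝ := Matrix.of fun a b => pd k (fun y => M y a b) y
  let v : Fin n → ℝ := fun b => pd k (fun y => (M y)⁻¹ b j) y
  have e1 : Matrix.mulVec (M y) v = -Matrix.mulVec N (fun b => (M y)⁻¹ b j) := by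
    funext a
    have := hmul a
    rw [Finset.sum_add_distrib] at this
    simp only [Matrix.mulVec, dotProduct, Pi.neg_apply, N, v, Matrix.of_apply]
    linarith
  have e2 : v = -Matrix.mulVec (M y)⁻¹ (Matrix.mulVec N (fun b => (M y)⁻¹ b j)) := by
    rw [← Matrix.mulVec_neg, ← e1, Matrix.mulVec_mulVec, hinv, Matrix.one_mulVec]
  have := congrFun e2 i
  simp only [v, Pi.neg_apply, Matrix.mulVec, dotProduct, N, Matrix.of_apply] at this
  rw [this]
  simp only [Finset.mul_sum, mul_assoc]

end MatrixCalculus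

/-! ### Potentials and their Hessian metrics -/

/-- The Hessian of `h² / 2`. -/
def hessSq (h : E n → ℝ) (y : E n) : Matrix (Fin n) (Fin n) ℝ :=
  Matrix.of fun i j => pd i (pd j fun y => h y ^ 2 / 2) y

/-- Smooth, even and positive `1`-homogeneous functions `h` for which the Hessian of `h² / 2` is
positive definite: the support functions of the bodies under consideration. -/
structure IsPotential (h : E n → ℝ) : Prop where
  smooth : SmoothOff ∞ h
  hom : Hom 1 h
  pos : ∀ y, y ≠ 0 → 0 < h y
  even : ∀ y, h (-y) = h y
  posDef : ∀ y, y ≠ 0 → (hessSq h y).PosDef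

/-- The inverse of the Hessian of `h² / 2`. -/
def hessInv (h : E n → ℝ) (y : E n) : Matrix (Fin n) (Fin n) ℝ := (hessSq h y)⁻¹

/-- The partial derivatives in the dual coordinates `x = D(h² / 2)`, as differential operators in
the variable `y`. -/
def dualPd (h : E n → ℝ) (j : Fin n) (f : E n → ℝ) (y : E n) : ℝ :=
  ∑ i, hessInv h y j i * pd i f y

/-- The Hilbert–Brunn–Minkowski operator `h² tr(P⁻¹ D²f)`, `P = D²(h² / 2)`, on `0`-homogeneous
functions. -/
def lap (h f : E n → ℝ) (y : E n) : ℝ := h y ^ 2 * ∑ j, dualPd h j (pd j f) y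

/-- The carré du champ `h² ⟨P⁻¹ Df, Dg⟩`, `P = D²(h² / 2)`. -/
def carre (h f g : E n → ℝ) (y : E n) : ℝ := h y ^ 2 * ∑ j, dualPd h j f y * pd j g y

/-- The density `h⁻ⁿ det D²(h² / 2)` of the cone-volume measure on the sphere. -/
def weight (h : E n → ℝ) (y : E n) : ℝ := h y ^ (-(n : ℤ)) * (hessSq h y).det

section Potential

variable {h f g : E n → ℝ} (hh : IsPotential h) {y : E n}

theorem SmoothOff.one {f : E n → ℝ} (hf : SmoothOff ∞ f) : SmoothOff 1 f :=
  hf.of_le (by exact_mod_cast le_top)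

theorem SmoothOff.two {f : E n → ℝ} (hf : SmoothOff ∞ f) : SmoothOff 2 f :=
  hf.of_le (WithTop.coe_le_coe.2 le_top : ((2 : ℕ∞) : WithTop ℕ∞) ≤ ((⊤ : ℕ∞) : WithTop ℕ∞))

theorem SmoothOff.pd_top {f : E n → ℝ} (hf : SmoothOff ∞ f) (i : Fin n) :
    SmoothOff ∞ (CentroAffine.pd i f) := hf.pd (by simp) i

theorem SmoothOff.pd_one {f : E n → ℝ} (hf : SmoothOff 2 f) (i : Fin n) :
    SmoothOff 1 (CentroAffine.pd i f) := hf.pd (by norm_num) i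

include hh in
theorem IsPotential.ne_zero (y : E n) (hy : y ≠ 0) : h y ≠ 0 := (hh.pos y hy).ne'

include hh in
theorem IsPotential.smooth_sq : SmoothOff ∞ fun y => h y ^ 2 / 2 := (hh.smooth.pow 2).div_const 2

include hh in
theorem IsPotential.hom_sq : Hom 2 fun y => h y ^ 2 / 2 := by
  intro t ht y hy
  simp only [hh.hom t ht y hy, zpow_ofNat]; ring

include hh in
theorem IsPotential.smooth_hessSq (i j : Fin n) : SmoothOff ∞ fun y => hessSq h y i j :=
  (hh.smooth_sq.pd_top j).pd_top i

include hh in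
theorem IsPotential.hom_hessSq (i j : Fin n) : Hom 0 fun y => hessSq h y i j :=
  (hh.hom_sq.pd j).pd i

include hh in
theorem IsPotential.hessSq_comm (hy : y ≠ 0) (i j : Fin n) : hessSq h y i j = hessSq h y j i :=
  pd_comm hh.smooth_sq.two i j hy

include hh in
theorem IsPotential.pd_hessSq_comm (hy : y ≠ 0) (k i j : Fin n) :
    pd k (fun y => hessSq h y i j) y = pd i (fun y => hessSq h y k j) y :=
  pd_comm (hh.smooth_sq.pd_top j).two k i hy

include hh in
theorem IsPotential.pd_hessSq_comm' (hy : y ≠ 0) (k i j : Fin n) :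
    pd k (fun y => hessSq h y i j) y = pd k (fun y => hessSq h y j i) y :=
  pd_congr (fun _ hz => hh.hessSq_comm hz i j) k hy

include hh in
theorem IsPotential.det_pos (hy : y ≠ 0) : 0 < (hessSq h y).det := (hh.posDef y hy).det_pos

include hh in
theorem IsPotential.smooth_hessInv (i j : Fin n) : SmoothOff ∞ fun y => hessInv h y i j :=
  SmoothOff.matrix_inv hh.smooth_hessSq (fun _ hy => (hh.det_pos hy).ne') i j

include hh in
theorem IsPotential.hessSq_smul {t : ℝ} (ht : 0 < t) (hy : y ≠ 0) :
    hessSq h (t • y) = hessSq h y := by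
  ext i j
  simpa using hh.hom_hessSq i j t ht y hy

include hh in
theorem IsPotential.hom_hessInv (i j : Fin n) : Hom 0 fun y => hessInv h y i j := by
  intro t ht y hy
  simp only [hessInv, hh.hessSq_smul ht hy, zpow_zero, one_mul]

include hh in
theorem IsPotential.hessInv_posDef (hy : y ≠ 0) : (hessInv h y).PosDef := (hh.posDef y hy).inv

include hh in
theorem IsPotential.hessInv_comm (hy : y ≠ 0) (i j : Fin n) :
    hessInv h y i j = hessInv h y j i := by
  have := (hh.hessInv_posDef hy).1.apply i j
  simpa using this.symm

include hh in
theorem IsPotential.hessSq_mul_hessInv (hy : y ≠ 0) : hessSq h y * hessInv h y = 1 :=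
  Matrix.mul_nonsing_inv _ (isUnit_iff_ne_zero.2 (hh.det_pos hy).ne')

include hh in
theorem IsPotential.hessInv_mul_hessSq (hy : y ≠ 0) : hessInv h y * hessSq h y = 1 :=
  Matrix.nonsing_inv_mul _ (isUnit_iff_ne_zero.2 (hh.det_pos hy).ne')

include hh in
theorem IsPotential.pd_hessInv (hy : y ≠ 0) (k i j : Fin n) :
    pd k (fun y => hessInv h y i j) y =
      -∑ a, ∑ b, hessInv h y i a * pd k (fun y => hessSq h y a b) y * hessInv h y b j :=
  pd_matrix_inv (fun i j => (hh.smooth_hessSq i j).one) (fun _ hy => (hh.det_pos hy).ne') k i j hy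

include hh in
theorem IsPotential.pd_det (hy : y ≠ 0) (k : Fin n) :
    pd k (fun y => (hessSq h y).det) y =
      (hessSq h y).det * ∑ a, ∑ b, hessInv h y a b * pd k (fun y => hessSq h y a b) y := by
  rw [CentroAffine.pd_det (fun i j => (hh.smooth_hessSq i j).one) k hy, Finset.mul_sum]
  refine Finset.sum_congr rfl fun a _ => ?_
  rw [Finset.mul_sum]
  refine Finset.sum_congr rfl fun b _ => ?_
  rw [hh.hessInv_comm hy a b, hessInv, Matrix.inv_def, Matrix.smul_apply, Ring.inverse_eq_inv,
    smul_eq_mul]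
  have := (hh.det_pos hy).ne'
  field_simp

include hh in
/-- The rows of the cofactor matrix of a Hessian are divergence free. -/
theorem IsPotential.piola (hy : y ≠ 0) (j : Fin n) :
    ∑ i, pd i (fun y => (hessSq h y).det * hessInv h y i j) y = 0 := by
  have h1 : ∀ i, pd i (fun y => (hessSq h y).det * hessInv h y i j) y =
      (hessSq h y).det * (∑ a, ∑ b,
        (hessInv h y a b * pd i (fun y => hessSq h y a b) y * hessInv h y i j -
          hessInv h y i a * pd i (fun y => hessSq h y a b) y * hessInv h y b j)) := by
    intro i
    rw [pd_mul i (SmoothOff.det fun i j => (hh.smooth_hessSq i j).one)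
      (hh.smooth_hessInv i j).one hy, hh.pd_det hy, hh.pd_hessInv hy]
    simp only [Finset.sum_sub_distrib, mul_sub, ← Finset.sum_mul]
    ring
  simp only [h1, ← Finset.mul_sum]
  rw [mul_eq_zero]
  right
  simp only [Finset.sum_sub_distrib]
  rw [sub_eq_zero, Finset.sum_comm]
  conv_rhs => rw [Finset.sum_comm]
  refine Finset.sum_congr rfl fun a _ => ?_
  rw [Finset.sum_comm]
  conv_rhs => rw [Finset.sum_comm]
  conv_lhs => rw [Finset.sum_comm]
  refine Finset.sum_congr rfl fun i _ => Finset.sum_congr rfl fun b _ => ?_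
  -- both sides contract the symmetric third derivative in the same way
  rw [hh.pd_hessSq_comm hy i a b, hh.pd_hessSq_comm' hy a i b, hh.pd_hessSq_comm hy a b i,
    hh.hessInv_comm hy a b, hh.pd_hessSq_comm hy b a i]

end Potential

/-! ### Integration by parts -/

theorem SmoothOff.integrable_sph {k : WithTop ℕ∞} {f : E n → ℝ} (hf : SmoothOff k f) :
    Integrable (fun θ : Sph n => f θ) (sph n) :=
  hf.continuous_sph.integrable_of_hasCompactSupport (HasCompactSupport.of_compactSpace _)

section Dual

variable {h f g : E n → ℝ} (hh : IsPotential h) {y : E n}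

theorem dualPd_mul (j : Fin n) (hf : SmoothOff 1 f) (hg : SmoothOff 1 g) (hy : y ≠ 0) :
    dualPd h j (fun y => f y * g y) y = dualPd h j f y * g y + f y * dualPd h j g y := by
  simp only [dualPd, pd_mul _ hf hg hy, Finset.sum_mul, Finset.mul_sum, ← Finset.sum_add_distrib]
  exact Finset.sum_congr rfl fun i _ => by ring

theorem dualPd_sub (j : Fin n) (hf : SmoothOff 1 f) (hg : SmoothOff 1 g) (hy : y ≠ 0) :
    dualPd h j (fun y => f y - g y) y = dualPd h j f y - dualPd h j g y := by
  simp only [dualPd, pd_sub _ hf hg hy, ← Finset.sum_sub_distrib]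
  exact Finset.sum_congr rfl fun i _ => by ring

theorem dualPd_const_mul (j : Fin n) (c : ℝ) :
    dualPd h j (fun y => c * f y) y = c * dualPd h j f y := by
  simp only [dualPd, pd_const_mul, Finset.mul_sum]
  exact Finset.sum_congr rfl fun i _ => by ring

theorem dualPd_sum {ι : Type*} {s : Finset ι} {F : ι → E n → ℝ} (j : Fin n)
    (hF : ∀ i ∈ s, SmoothOff 1 (F i)) (hy : y ≠ 0) :
    dualPd h j (fun y => ∑ i ∈ s, F i y) y = ∑ i ∈ s, dualPd h j (F i) y := by
  simp only [dualPd, pd_sum _ hF hy, Finset.mul_sum]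
  exact Finset.sum_comm

include hh in
theorem IsPotential.smooth_dualPd {k l : WithTop ℕ∞} (j : Fin n) (hf : SmoothOff l f)
    (hkl : k + 1 ≤ l) (hk : k ≤ ∞) : SmoothOff k (dualPd h j f) :=
  SmoothOff.sum fun i _ => ((hh.smooth_hessInv j i).of_le hk).mul (hf.pd hkl i)

include hh in
theorem IsPotential.smooth_dualPd_top (j : Fin n) (hf : SmoothOff ∞ f) :
    SmoothOff ∞ (dualPd h j f) := hh.smooth_dualPd j hf (by simp) le_rfl

include hh in
theorem IsPotential.hom_dualPd {k : ℤ} (j : Fin n) (hf : Hom k f) :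
    Hom (k - 1) (dualPd h j f) :=
  Hom.sum fun i _ => by simpa using (hh.hom_hessInv j i).mul (hf.pd i)

include hh in
/-- The dual coordinate `x = D(h² / 2) = h Dh`, by Euler's identity. -/
theorem IsPotential.sum_hessSq_mul (hy : y ≠ 0) (i : Fin n) :
    ∑ j, hessSq h y i j * y j = h y * pd i h y := by
  have h1 := (hh.hom_sq.pd i).euler (hh.smooth_sq.pd_top i).one hy
  have h2 : pd i (fun y => h y ^ 2 / 2) y = h y * pd i h y := by
    have : (fun y => h y ^ 2 / 2) = fun y => (1 / 2) * h y ^ 2 := by funext y; ring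
    rw [this, pd_const_mul, pd_sq i hh.smooth.one hy]; ring
  rw [h2] at h1
  norm_num at h1
  rw [← h1]
  refine Finset.sum_congr rfl fun j _ => ?_
  rw [mul_comm, hh.hessSq_comm hy]
  rfl

include hh in
theorem IsPotential.dualPd_self (hy : y ≠ 0) (j : Fin n) : dualPd h j h y = y j / h y := by
  have h1 : Matrix.mulVec (hessSq h y) (fun j => y j) = fun i => h y * pd i h y :=
    funext fun i => hh.sum_hessSq_mul hy i
  have h2 : Matrix.mulVec (hessInv h y) (fun i => h y * pd i h y) = fun j => y j := by
    rw [← h1, Matrix.mulVec_mulVec, hh.hessInv_mul_hessSq hy, Matrix.one_mulVec]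
  have h3 := congrFun h2 j
  simp only [Matrix.mulVec, dotProduct] at h3
  rw [eq_div_iff (hh.ne_zero y hy), ← h3, dualPd, Finset.sum_mul]
  exact Finset.sum_congr rfl fun i _ => by ring

include hh in
theorem IsPotential.dualPd_zpow (hy : y ≠ 0) (j : Fin n) (m : ℤ) :
    dualPd h j (fun y => h y ^ m) y = m * h y ^ (m - 2) * y j := by
  have h1 : dualPd h j (fun y => h y ^ m) y = m * h y ^ (m - 1) * dualPd h j h y := by
    simp only [dualPd, pd_zpow _ hh.smooth.one hh.ne_zero m hy, Finset.mul_sum]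
    exact Finset.sum_congr rfl fun i _ => by ring
  have h0 := hh.ne_zero y hy
  rw [h1, hh.dualPd_self hy, show m - 1 = (m - 2) + 1 by ring, zpow_add_one₀ h0]
  field_simp

include hh in
/-- The dual partial derivatives commute, being partial derivatives in other coordinates. -/
theorem IsPotential.dualPd_comm (hf : SmoothOff 2 f) (i j : Fin n) (hy : y ≠ 0) :
    dualPd h i (dualPd h j f) y = dualPd h j (dualPd h i f) y := by
  have key : ∀ i j : Fin n, dualPd h i (dualPd h j f) y =
      -(∑ l, ∑ k, ∑ a, ∑ b, hessInv h y i l * (hessInv h y j a *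
          pd l (fun y => hessSq h y a b) y * hessInv h y b k) * pd k f y) +
        ∑ l, ∑ k, hessInv h y i l * hessInv h y j k * pd l (pd k f) y := by
    intro i j
    have h1 : ∀ l, pd l (dualPd h j f) y = ∑ k, (pd l (fun y => hessInv h y j k) y * pd k f y +
        hessInv h y j k * pd l (pd k f) y) := by
      intro l
      unfold dualPd
      rw [pd_sum l (fun k _ => (hh.smooth_hessInv j k).one.mul (hf.pd_one k)) hy]
      exact Finset.sum_congr rfl fun k _ => pd_mul l (hh.smooth_hessInv j k).one (hf.pd_one k) hy
    rw [dualPd]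
    simp only [h1, hh.pd_hessInv hy, Finset.sum_add_distrib, mul_add, Finset.mul_sum,
      Finset.sum_mul, neg_mul, mul_neg, Finset.sum_neg_distrib, mul_assoc]
  rw [key i j, key j i]
  congr 1
  · congr 1
    -- relabel `l ↔ a` and use the symmetry of the third derivative
    have relabel : ∀ F : Fin n → Fin n → Fin n → Fin n → ℝ,
        ∑ l, ∑ k, ∑ a, ∑ b, F l k a b = ∑ l, ∑ k, ∑ a, ∑ b, F a k l b := by
      intro F
      rw [Finset.sum_comm]
      conv_rhs => rw [Finset.sum_comm]
      exact Finset.sum_congr rfl fun k _ => Finset.sum_comm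
    rw [relabel]
    refine Finset.sum_congr rfl fun l _ => Finset.sum_congr rfl fun k _ =>
      Finset.sum_congr rfl fun a _ => Finset.sum_congr rfl fun b _ => ?_
    rw [hh.pd_hessSq_comm hy a l b]
    ring
  · rw [Finset.sum_comm]
    refine Finset.sum_congr rfl fun k _ => Finset.sum_congr rfl fun l _ => ?_
    rw [pd_comm hf l k hy]; ring

include hh in
/-- The divergence theorem for the dual partial derivatives: by Piola's identity, `det P · dualPd
j w` is a Euclidean divergence. -/
theorem IsPotential.integral_det_mul_dualPd (j : Fin n) {w : E n → ℝ} (hw : SmoothOff 1 w)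
    (hw' : Hom (1 - n) w) : ∫ θ : Sph n, (hessSq h θ).det * dualPd h j w θ ∂sph n = 0 := by
  have hsm : ∀ i, SmoothOff 1 fun y => (hessSq h y).det * hessInv h y i j := fun i =>
    (SmoothOff.det fun i j => (hh.smooth_hessSq i j).one).mul (hh.smooth_hessInv i j).one
  have hhom : ∀ i, Hom (1 - n) fun y => (hessSq h y).det * hessInv h y i j * w y := by
    intro i
    have h1 : Hom 0 fun y => (hessSq h y).det := by
      intro t ht y hy; simp [hh.hessSq_smul ht hy]
    simpa using (h1.mul (hh.hom_hessInv i j)).mul hw'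
  have h1 : ∀ θ : Sph n, (hessSq h θ).det * dualPd h j w θ =
      ∑ i, pd i (fun y => (hessSq h y).det * hessInv h y i j * w y) θ := by
    intro θ
    have hθ := sph_ne_zero θ
    simp only [pd_mul _ (hsm _) hw hθ, Finset.sum_add_distrib, ← Finset.sum_mul, hh.piola hθ j,
      zero_mul, zero_add, dualPd, Finset.mul_sum]
    refine Finset.sum_congr rfl fun i _ => ?_
    rw [hh.hessInv_comm hθ j i]; ring
  simp only [h1]
  rw [integral_finsetSum _ fun i _ =>
    (((hsm i).mul hw).pd (k := 0) (by simp) i).integrable_sph]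
  exact Finset.sum_eq_zero fun i _ => integral_sph_pd_eq_zero i ((hsm i).mul hw) (hhom i)

include hh in
/-- The divergence theorem for a homogeneous vector field `W`, with respect to the cone-volume
measure. -/
theorem IsPotential.integral_divergence {m : ℤ} {W : Fin n → E n → ℝ}
    (hW : ∀ j, SmoothOff 1 (W j)) (hW' : ∀ j, Hom m (W j)) :
    ∫ θ : Sph n, weight h θ * (h θ ^ (1 - m) * ∑ j, dualPd h j (W j) θ +
      (1 - m - n) * h θ ^ (-1 - m) * ∑ j, (θ : E n) j * W j θ) ∂sph n = 0 := by
  have hz : ∀ m : ℤ, SmoothOff 1 fun y => h y ^ m := fun m => hh.smooth.one.zpow hh.ne_zero m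
  have h1 : ∀ θ : Sph n, weight h θ * (h θ ^ (1 - m) * ∑ j, dualPd h j (W j) θ +
      (1 - m - n) * h θ ^ (-1 - m) * ∑ j, (θ : E n) j * W j θ) =
      ∑ j, (hessSq h θ).det * dualPd h j (fun y => h y ^ (1 - m - n) * W j y) θ := by
    intro θ
    have hθ := sph_ne_zero θ
    have h0 := hh.ne_zero θ hθ
    simp only [dualPd_mul _ (hz _) (hW _) hθ, hh.dualPd_zpow hθ]
    rw [← Finset.mul_sum, Finset.sum_add_distrib, ← Finset.mul_sum, weight]
    have e1 : h θ ^ (1 - m - n) = h θ ^ (-(n : ℤ)) * h θ ^ (1 - m) := by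
      rw [← zpow_add₀ h0]; ring_nf
    have e2 : h θ ^ (1 - m - n - 2) = h θ ^ (-(n : ℤ)) * h θ ^ (-1 - m) := by
      rw [← zpow_add₀ h0]; ring_nf
    rw [e1, e2]
    simp only [mul_assoc, ← Finset.mul_sum]
    push_cast
    ring
  simp only [h1]
  have hs := fun j => (hz (1 - m - n)).mul (hW j)
  rw [integral_finsetSum _ fun j _ => ((SmoothOff.det fun i j => ((hh.smooth_hessSq i j).of_le
    (by simp))).mul (hh.smooth_dualPd (k := 0) j (hs j) (by simp) (by simp))).integrable_sph]
  refine Finset.sum_eq_zero fun j _ => hh.integral_det_mul_dualPd j (hs j) ?_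
  have := (hh.hom.zpow (1 - m - n)).mul (hW' j)
  convert! this using 1
  ring

end Dual

/-! ### Traces of products of symmetric matrices -/

section Trace

open Matrix
open scoped MatrixOrder Matrix.Norms.L2Operator

variable {P Q G H : Matrix (Fin n) (Fin n) ℝ} {a b y : Fin n → ℝ} {s : ℝ}

theorem trace_mul_mul_mul_nonneg (hQ : Q.PosSemidef) {S : Matrix (Fin n) (Fin n) ℝ}
    (hS : Sᵀ = S) : 0 ≤ (Q * S * Q * S).trace := by
  obtain ⟨B, rfl⟩ := CStarAlgebra.nonneg_iff_eq_star_mul_self.1 hQ.nonneg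
  have h1 : (B * (S * (star B * B) * S) * star B).PosSemidef := by
    have h2 := (hQ.mul_mul_conjTranspose_same S).mul_mul_conjTranspose_same B
    simpa [conjTranspose_eq_transpose_of_trivial, hS, star_eq_conjTranspose] using h2
  have h3 := h1.trace_nonneg
  rw [trace_mul_comm] at h3
  simpa only [mul_assoc] using h3

/-- Here and below `Q`, `H`, `G` stand for `P⁻¹`, `D²z` and `D²(z h) - z D²h`, while `a = Dh`, `b
= Dz` and `s = h`. -/
theorem trace_mul_of_decomp (hQ : Qᵀ = Q) (ha : Q *ᵥ a = s⁻¹ • y) (hb : b ⬝ᵥ y = 0)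
    (hH : s • H = G - vecMulVec b a - vecMulVec a b) : s * (Q * H).trace = (Q * G).trace := by
  have h1 : s * (Q * H).trace = (Q * (s • H)).trace := by simp
  have h2 : a ⬝ᵥ (Q *ᵥ b) = 0 := by
    rw [dotProduct_mulVec, ← mulVec_transpose, hQ, ha, smul_dotProduct, dotProduct_comm, hb,
      smul_zero]
  rw [h1, hH, mul_sub, mul_sub, mul_vecMulVec, mul_vecMulVec, trace_sub, trace_sub,
    trace_vecMulVec, trace_vecMulVec, dotProduct_comm, h2, ha, smul_dotProduct, dotProduct_comm, hb]
  simp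

/-- Replacing `h D²z` by `D²(z h) - z D²h` in the trace of a square: the mixed terms contribute
the squared gradient. -/
theorem trace_mul_mul_mul_of_decomp (hQ : Qᵀ = Q) (hG : Gᵀ = G) (hGy : G *ᵥ y = 0)
    (ha : Q *ᵥ a = s⁻¹ • y) (hay : a ⬝ᵥ y = s) (hs : s ≠ 0) (hb : b ⬝ᵥ y = 0)
    (hH : s • H = G - vecMulVec b a - vecMulVec a b) :
    s ^ 2 * (Q * H * Q * H).trace = (Q * G * Q * G).trace + 2 * (b ⬝ᵥ Q *ᵥ b) := by
  have h1 : s ^ 2 * (Q * H * Q * H).trace = (Q * (s • H) * Q * (s • H)).trace := by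
    simp [smul_smul, sq, mul_assoc]
  have hab : a ⬝ᵥ (Q *ᵥ b) = 0 := by
    rw [dotProduct_mulVec, ← mulVec_transpose, hQ, ha, smul_dotProduct, dotProduct_comm, hb,
      smul_zero]
  have hGa : G *ᵥ (Q *ᵥ a) = 0 := by rw [ha, mulVec_smul, hGy, smul_zero]
  have haG : ∀ v, a ⬝ᵥ (Q *ᵥ (G *ᵥ v)) = 0 := by
    intro v
    rw [dotProduct_mulVec, ← mulVec_transpose, hQ, dotProduct_mulVec, ← mulVec_transpose, hG, hGa,
      zero_dotProduct]
  have haa : a ⬝ᵥ (Q *ᵥ a) = 1 := by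
    rw [ha, dotProduct_smul, hay, smul_eq_mul, inv_mul_cancel₀ hs]
  have hba : b ⬝ᵥ (Q *ᵥ a) = 0 := by rw [ha, dotProduct_smul, hb, smul_zero]
  have e1 : Q * (s • H) = Q * G - vecMulVec (Q *ᵥ b) a - vecMulVec (Q *ᵥ a) b := by
    rw [hH, mul_sub, mul_sub, mul_vecMulVec, mul_vecMulVec]
  have e2 : Q * (s • H) * Q * (s • H) = (Q * (s • H)) * (Q * (s • H)) := by
    simp only [mul_assoc]
  rw [h1, e2, e1]
  have e3 : ∀ (M : Matrix (Fin n) (Fin n) ℝ) u v, (M * vecMulVec u v).trace = v ⬝ᵥ (M *ᵥ u) := by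
    intro M u v
    rw [mul_vecMulVec, trace_vecMulVec, dotProduct_comm]
  have t1 : (Q * G * vecMulVec (Q *ᵥ b) a).trace = 0 := by rw [e3, ← mulVec_mulVec, haG]
  have t2 : (Q * G * vecMulVec (Q *ᵥ a) b).trace = 0 := by
    rw [e3, ← mulVec_mulVec, hGa, mulVec_zero, dotProduct_zero]
  have t3 : (vecMulVec (Q *ᵥ b) a * (Q * G)).trace = 0 := by rw [trace_mul_comm, t1]
  have t4 : (vecMulVec (Q *ᵥ a) b * (Q * G)).trace = 0 := by rw [trace_mul_comm, t2]
  have haa' : (Q *ᵥ a) ⬝ᵥ a = 1 := by rw [dotProduct_comm, haa]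
  have hbb : (Q *ᵥ b) ⬝ᵥ b = b ⬝ᵥ (Q *ᵥ b) := dotProduct_comm _ _
  have e4 : Q * G * Q * G = Q * G * (Q * G) := by simp only [mul_assoc]
  rw [e4]
  simp only [sub_mul, mul_sub, trace_sub, t1, t2, t3, t4, vecMulVec_mul_vecMulVec,
    trace_vecMulVec, hab, haa, hba, dotProduct_smul, smul_eq_mul, haa', hbb]
  ring

/-- The Cauchy–Schwarz inequality for the trace of a symmetric matrix which vanishes in one
direction. -/
theorem sq_trace_mul_le (hn : 2 ≤ n) (hQ : Q.PosDef) (hQP : Q * P = 1) (hP : Pᵀ = P)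
    (hG : Gᵀ = G) (hGy : G *ᵥ y = 0) (ha : Q *ᵥ a = s⁻¹ • y) (hay : a ⬝ᵥ y = s) (hs : s ≠ 0) :
    (Q * G).trace ^ 2 ≤ ((n : ℝ) - 1) * (Q * G * Q * G).trace := by
  have hn' : (0 : ℝ) < (n : ℝ) - 1 := by
    have : (2 : ℝ) ≤ n := by exact_mod_cast hn
    linarith
  have haa : a ⬝ᵥ (Q *ᵥ a) = 1 := by
    rw [ha, dotProduct_smul, hay, smul_eq_mul, inv_mul_cancel₀ hs]
  have hGa : G *ᵥ (Q *ᵥ a) = 0 := by rw [ha, mulVec_smul, hGy, smul_zero]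
  set t := (Q * G).trace
  have key : ∀ c : ℝ, 0 ≤ (Q * G * Q * G).trace - 2 * c * t + c ^ 2 * (n - 1) := by
    intro c
    have hS : (G - c • (P - vecMulVec a a))ᵀ = G - c • (P - vecMulVec a a) := by
      simp [hG, hP, transpose_vecMulVec]
    have h1 := trace_mul_mul_mul_nonneg hQ.posSemidef hS
    have e1 : Q * (G - c • (P - vecMulVec a a)) = Q * G - c • (1 - vecMulVec (Q *ᵥ a) a) := by
      rw [mul_sub, mul_smul_comm, mul_sub, hQP, mul_vecMulVec]
    have e2 : ∀ S : Matrix (Fin n) (Fin n) ℝ, Q * S * Q * S = (Q * S) * (Q * S) := by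
      intro S; simp only [mul_assoc]
    rw [e2, e1] at h1
    have e3 : ((1 : Matrix (Fin n) (Fin n) ℝ) - vecMulVec (Q *ᵥ a) a) * (1 - vecMulVec (Q *ᵥ a) a)
        = 1 - vecMulVec (Q *ᵥ a) a := by
      rw [sub_mul, mul_sub, one_mul, one_mul, mul_sub, vecMulVec_mul_vecMulVec, haa]
      simp
    have e4 : (Q * G * (1 - vecMulVec (Q *ᵥ a) a)) = Q * G := by
      rw [mul_sub, mul_vecMulVec, ← mulVec_mulVec, hGa]
      simp
    have e5 : (1 - vecMulVec (Q *ᵥ a) a : Matrix (Fin n) (Fin n) ℝ).trace = n - 1 := by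
      rw [trace_sub, trace_vecMulVec, dotProduct_comm, haa]; simp
    have e6 : ((1 - vecMulVec (Q *ᵥ a) a) * (Q * G)).trace = t := by
      rw [trace_mul_comm, e4]
    rw [sub_mul, mul_sub, mul_sub, trace_sub, trace_sub, trace_sub, mul_smul_comm, smul_mul_assoc,
      smul_mul_smul_comm, trace_smul, trace_smul, trace_smul, e3, e4, e5, e6] at h1
    rw [e2]
    simp only [smul_eq_mul] at h1
    linarith [h1]
  have := key (t / (n - 1))
  field_simp at this
  nlinarith [this]

end Trace


section Bochner

variable {h f g z : E n → ℝ} (hh : IsPotential h) {y : E n}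

/-- Integration against the cone-volume measure. -/
def wint (h f : E n → ℝ) : ℝ := ∫ θ : Sph n, weight h θ * f θ ∂sph n

include hh in
theorem IsPotential.smooth_weight : SmoothOff ∞ (weight h) :=
  (hh.smooth.zpow hh.ne_zero _).mul (SmoothOff.det hh.smooth_hessSq)

include hh in
theorem IsPotential.weight_pos (hy : y ≠ 0) : 0 < weight h y :=
  mul_pos (zpow_pos (hh.pos y hy) _) (hh.det_pos hy)

include hh in
theorem IsPotential.integrable_weight_mul (hf : SmoothOff 0 f) :
    Integrable (fun θ : Sph n => weight h θ * f θ) (sph n) :=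
  ((hh.smooth_weight.of_le (by simp)).mul hf).integrable_sph

include hh in
theorem IsPotential.wint_add (hf : SmoothOff 0 f) (hg : SmoothOff 0 g) :
    wint h (fun y => f y + g y) = wint h f + wint h g := by
  simp only [wint, mul_add]
  exact integral_add (hh.integrable_weight_mul hf) (hh.integrable_weight_mul hg)

include hh in
theorem IsPotential.wint_sub (hf : SmoothOff 0 f) (hg : SmoothOff 0 g) :
    wint h (fun y => f y - g y) = wint h f - wint h g := by
  simp only [wint, mul_sub]
  exact integral_sub (hh.integrable_weight_mul hf) (hh.integrable_weight_mul hg)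

theorem wint_const_mul (c : ℝ) : wint h (fun y => c * f y) = c * wint h f := by
  simp only [wint, mul_left_comm _ c, integral_const_mul]

theorem wint_neg : wint h (fun y => -f y) = -wint h f := by
  simpa using wint_const_mul (h := h) (f := f) (-1)

theorem wint_congr (hfg : ∀ y, y ≠ 0 → f y = g y) : wint h f = wint h g :=
  integral_congr_ae (.of_forall fun θ => by simp only [hfg θ (sph_ne_zero θ)])

include hh in
theorem IsPotential.wint_mono (hf : SmoothOff 0 f) (hg : SmoothOff 0 g)
    (hfg : ∀ y, y ≠ 0 → f y ≤ g y) : wint h f ≤ wint h g :=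
  integral_mono (hh.integrable_weight_mul hf) (hh.integrable_weight_mul hg) fun θ =>
    mul_le_mul_of_nonneg_left (hfg θ (sph_ne_zero θ)) (hh.weight_pos (sph_ne_zero θ)).le

include hh in
theorem IsPotential.wint_nonneg (hf : ∀ y, y ≠ 0 → 0 ≤ f y) : 0 ≤ wint h f :=
  integral_nonneg fun θ =>
    mul_nonneg (hh.weight_pos (sph_ne_zero θ)).le (hf θ (sph_ne_zero θ))

include hh in
theorem IsPotential.smooth_lap {k : WithTop ℕ∞} (hf : SmoothOff (k + 2) f) (hk : k ≤ ∞) :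
    SmoothOff k (lap h f) := by
  refine ((hh.smooth.of_le hk).pow 2).mul (SmoothOff.sum fun j _ => ?_)
  refine hh.smooth_dualPd (l := k + 1) j (hf.pd ?_ j) le_rfl hk
  rw [add_assoc, one_add_one_eq_two]

include hh in
theorem IsPotential.smooth_lap_top (hf : SmoothOff ∞ f) : SmoothOff ∞ (lap h f) :=
  hh.smooth_lap (hf.of_le (le_of_eq rfl)) le_rfl

include hh in
theorem IsPotential.smooth_carre {k : WithTop ℕ∞} (hf : SmoothOff (k + 1) f)
    (hg : SmoothOff (k + 1) g) (hk : k ≤ ∞) : SmoothOff k (carre h f g) :=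
  ((hh.smooth.of_le hk).pow 2).mul (SmoothOff.sum fun j _ =>
    (hh.smooth_dualPd j hf le_rfl hk).mul (hg.pd le_rfl j))

include hh in
theorem IsPotential.smooth_carre_zero (hf : SmoothOff 1 f) (hg : SmoothOff 1 g) :
    SmoothOff 0 (carre h f g) := hh.smooth_carre (by simpa using hf) (by simpa using hg) (by simp)

include hh in
theorem IsPotential.smooth_lap_zero (hf : SmoothOff 2 f) :
    SmoothOff 0 (lap h f) := hh.smooth_lap (by simpa using hf) (by simp)

include hh in
theorem IsPotential.carre_comm (hy : y ≠ 0) : carre h f g y = carre h g f y := by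
  simp only [carre, dualPd, Finset.sum_mul]
  rw [Finset.sum_comm]
  congr 1
  refine Finset.sum_congr rfl fun i _ => Finset.sum_congr rfl fun j _ => ?_
  rw [hh.hessInv_comm hy j i]; ring

include hh in
theorem IsPotential.carre_self_nonneg (hy : y ≠ 0) : 0 ≤ carre h f f y := by
  refine mul_nonneg (sq_nonneg _) ?_
  have := (hh.hessInv_posDef hy).posSemidef.dotProduct_mulVec_nonneg (fun i => pd i f y)
  simp only [dotProduct, Matrix.mulVec, star_trivial] at this
  refine this.trans_eq (Finset.sum_congr rfl fun j _ => ?_)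
  simp only [dualPd]; ring

/-- A `0`-homogeneous function has no radial derivative. -/
theorem Hom.sum_mul_pd (hz : Hom 0 z) (hs : SmoothOff 1 z) (hy : y ≠ 0) :
    ∑ i, y i * CentroAffine.pd i z y = 0 := by
  simpa using hz.euler hs hy

theorem Hom.sum_mul_pd_pd (hz : Hom 0 z) (hs : SmoothOff 2 z) (hy : y ≠ 0) (l : Fin n) :
    ∑ j, y j * CentroAffine.pd l (CentroAffine.pd j z) y = -CentroAffine.pd l z y := by
  have := (hz.pd l).euler (hs.pd_one l) hy
  norm_num at this
  rw [← this]
  exact Finset.sum_congr rfl fun j _ => by rw [pd_comm hs l j hy]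

include hh in
/-- Green's formula for the Hilbert–Brunn–Minkowski operator. -/
theorem IsPotential.wint_mul_lap (hf : SmoothOff 1 f) (hf0 : Hom 0 f) (hg : SmoothOff 2 g)
    (hg0 : Hom 0 g) : wint h (fun y => f y * lap h g y) = -wint h (carre h f g) := by
  have hW : ∀ j, SmoothOff 1 fun y => f y * pd j g y := fun j => hf.mul (hg.pd_one j)
  have hW' : ∀ j, Hom (-1) fun y => f y * pd j g y := fun j => by simpa using hf0.mul (hg0.pd j)
  have h1 := hh.integral_divergence hW hW'
  have h2 : wint h (fun y => f y * lap h g y + carre h f g y) = 0 := by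
    rw [← h1]
    refine integral_congr_ae (.of_forall fun θ => ?_)
    have hθ := sph_ne_zero θ
    have e1 : ∑ j, (θ : E n) j * (f θ * pd j g θ) = 0 := by
      simp only [mul_left_comm _ (f θ), ← Finset.mul_sum]
      rw [hg0.sum_mul_pd (hg.of_le (by norm_num)) hθ, mul_zero]
    simp only [dualPd_mul _ hf (hg.pd_one _) hθ, e1, Finset.sum_add_distrib, lap, carre,
      ← Finset.mul_sum]
    norm_num
    left
    ring
  rw [hh.wint_add ((hf.of_le (by simp)).mul (hh.smooth_lap_zero hg))
    (hh.smooth_carre_zero hf (hg.of_le (by norm_num)))] at h2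
  linarith

/-- The Euclidean Hessian. -/
def hess (z : E n → ℝ) (y : E n) : Matrix (Fin n) (Fin n) ℝ :=
  Matrix.of fun i j => pd i (pd j z) y

/-- `D²(z h) - z D²h`: the part of the Hessian of `z h` which does not vanish for constant `z`. -/
def conjHess (h z : E n → ℝ) (y : E n) : Matrix (Fin n) (Fin n) ℝ :=
  h y • hess z y + Matrix.vecMulVec (fun i => pd i z y) (fun i => pd i h y) +
    Matrix.vecMulVec (fun i => pd i h y) (fun i => pd i z y)

/-- The squared norm `h² tr((P⁻¹ G)²)` of `G = D²(z h) - z D²h`. -/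
def conjHessSq (h z : E n → ℝ) (y : E n) : ℝ :=
  h y ^ 2 * (hessInv h y * conjHess h z y * hessInv h y * conjHess h z y).trace

theorem dualPd_pd_eq (i j : Fin n) : dualPd h i (pd j z) y = (hessInv h y * hess z y) i j := by
  simp [dualPd, Matrix.mul_apply, hess]

theorem lap_eq_trace : lap h z y = h y ^ 2 * (hessInv h y * hess z y).trace := by
  simp only [lap, dualPd_pd_eq, Matrix.trace, Matrix.diag]

theorem carre_eq_dotProduct : carre h f g y =
    h y ^ 2 * ((fun j => pd j g y) ⬝ᵥ (hessInv h y).mulVec fun i => pd i f y) := by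
  simp only [carre, dualPd, dotProduct, Matrix.mulVec]
  congr 1
  exact Finset.sum_congr rfl fun j _ => mul_comm _ _

include hh in
/-- The Bochner formula, in terms of the full Euclidean Hessian. -/
theorem IsPotential.bochner_hess (hz : SmoothOff ∞ z) (hz0 : Hom 0 z) :
    wint h (fun y => lap h z y ^ 2 -
      h y ^ 4 * (hessInv h y * hess z y * hessInv h y * hess z y).trace +
      (4 - n) * carre h z z y) = 0 := by
  have hV := fun j => (hz.pd_top j)
  have hDV := fun i j => hh.smooth_dualPd_top i (hV j)
  -- the vector field `V div V - (V · ∇) V` for `V = Dz`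
  let W : Fin n → E n → ℝ := fun j y =>
    pd j z y * ∑ i, dualPd h i (pd i z) y - ∑ i, pd i z y * dualPd h i (pd j z) y
  have hW : ∀ j, SmoothOff 1 (W j) := fun j =>
    (((hV j).mul (SmoothOff.sum fun i _ => hDV i i)).sub
      (SmoothOff.sum fun i _ => (hV i).mul (hDV i j))).one
  have hV0 := fun j => hz0.pd j
  have hDV0 := fun i j => hh.hom_dualPd i (hV0 j)
  have hW0 : ∀ j, Hom (-3) (W j) := fun j => by
    refine Hom.sub ?_ ?_
    · simpa using (hV0 j).mul (Hom.sum (s := Finset.univ) fun i _ => hDV0 i i)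
    · exact Hom.sum fun i _ => by simpa using (hV0 i).mul (hDV0 i j)
  rw [← hh.integral_divergence hW hW0]
  refine integral_congr_ae (.of_forall fun θ => ?_)
  have hθ := sph_ne_zero θ
  have e1 : ∑ j, dualPd h j (W j) θ = (∑ i, dualPd h i (pd i z) θ) ^ 2 -
      (hessInv h θ * hess z θ * hessInv h θ * hess z θ).trace := by
    have t1 : (hessInv h θ * hess z θ * hessInv h θ * hess z θ).trace =
        ∑ j, ∑ i, dualPd h j (pd i z) θ * dualPd h i (pd j z) θ := by
      rw [Matrix.mul_assoc (hessInv h θ * hess z θ)]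
      simp only [Matrix.trace, Matrix.diag, Matrix.mul_apply (M := hessInv h θ * hess z θ),
        dualPd_pd_eq]
    have t2 : ∀ j, dualPd h j (W j) θ =
        dualPd h j (pd j z) θ * ∑ i, dualPd h i (pd i z) θ +
        pd j z θ * ∑ i, dualPd h j (dualPd h i (pd i z)) θ -
        (∑ i, dualPd h j (pd i z) θ * dualPd h i (pd j z) θ +
          ∑ i, pd i z θ * dualPd h j (dualPd h i (pd j z)) θ) := by
      intro j
      rw [dualPd_sub j ((hV j).mul (SmoothOff.sum fun i _ => hDV i i)).one
        (SmoothOff.sum fun i _ => (hV i).mul (hDV i j)).one hθ,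
        dualPd_mul j (hV j).one (SmoothOff.sum fun i _ => hDV i i).one hθ,
        dualPd_sum j (fun i _ => (hDV i i).one) hθ,
        dualPd_sum j (fun i _ => ((hV i).mul (hDV i j)).one) hθ, ← Finset.sum_add_distrib]
      congr 1
      exact Finset.sum_congr rfl fun i _ => dualPd_mul j (hV i).one (hDV i j).one hθ
    simp only [t2, t1, Finset.sum_sub_distrib, Finset.sum_add_distrib, ← Finset.sum_mul]
    -- the terms with third derivatives of `z` cancel since the dual derivatives commute
    have t3 : ∑ j, pd j z θ * ∑ i, dualPd h j (dualPd h i (pd i z)) θ =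
        ∑ j, ∑ i, pd i z θ * dualPd h j (dualPd h i (pd j z)) θ := by
      rw [Finset.sum_comm]
      refine Finset.sum_congr rfl fun i _ => ?_
      rw [Finset.mul_sum]
      exact Finset.sum_congr rfl fun j _ => by rw [hh.dualPd_comm (hV j).two i j hθ]
    rw [t3]
    ring
  have e2 : ∑ j, (θ : E n) j * W j θ = ∑ i, dualPd h i z θ * pd i z θ := by
    have t1 : ∀ i, ∑ j, (θ : E n) j * dualPd h i (pd j z) θ = -dualPd h i z θ := by
      intro i
      simp only [dualPd, Finset.mul_sum]
      rw [Finset.sum_comm, ← Finset.sum_neg_distrib]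
      refine Finset.sum_congr rfl fun l _ => ?_
      simp only [mul_left_comm _ (hessInv h θ i l), ← Finset.mul_sum]
      rw [hz0.sum_mul_pd_pd hz.two hθ]; ring
    simp only [W, mul_sub, Finset.sum_sub_distrib, ← mul_assoc, ← Finset.sum_mul]
    rw [hz0.sum_mul_pd hz.one hθ, zero_mul, zero_sub]
    simp only [Finset.mul_sum]
    rw [Finset.sum_comm, ← Finset.sum_neg_distrib]
    refine Finset.sum_congr rfl fun i _ => ?_
    rw [← neg_neg (dualPd h i z θ), ← t1 i]
    simp only [Finset.sum_mul, ← Finset.sum_neg_distrib, neg_mul]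
    exact Finset.sum_congr rfl fun j _ => by ring
  beta_reduce
  rw [e1, e2]
  simp only [lap, carre]
  rw [show (1 : ℤ) - -3 = 4 by norm_num, show (-1 : ℤ) - -3 = 2 by norm_num, zpow_ofNat, zpow_ofNat]
  push_cast
  ring

include hh in
theorem IsPotential.sum_mul_pd (hy : y ≠ 0) : ∑ i, y i * pd i h y = h y := by
  simpa using hh.hom.euler hh.smooth.one hy

theorem hess_transpose (hz : SmoothOff 2 z) (hy : y ≠ 0) : (hess z y).transpose = hess z y := by
  ext i j; exact pd_comm hz j i hy

theorem conjHess_transpose (hz : SmoothOff 2 z) (hy : y ≠ 0) :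
    (conjHess h z y).transpose = conjHess h z y := by
  simp only [conjHess, Matrix.transpose_add, Matrix.transpose_smul, hess_transpose hz hy,
    Matrix.transpose_vecMulVec]
  abel

include hh in
theorem IsPotential.conjHess_mulVec (hz : SmoothOff 2 z) (hz0 : Hom 0 z) (hy : y ≠ 0) :
    (conjHess h z y).mulVec (fun j => y j) = 0 := by
  have h1 : (hess z y).mulVec (fun j => y j) = -fun i => pd i z y := by
    funext l
    have := hz0.sum_mul_pd_pd hz hy l
    simp only [Matrix.mulVec, dotProduct, hess, Matrix.of_apply, Pi.neg_apply, ← this]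
    exact Finset.sum_congr rfl fun j _ => mul_comm _ _
  have h2 : (fun i => pd i h y) ⬝ᵥ (fun j => y j) = h y := by
    rw [dotProduct_comm]; exact hh.sum_mul_pd hy
  have h3 : (fun i => pd i z y) ⬝ᵥ (fun j => y j) = 0 := by
    rw [dotProduct_comm]; exact hz0.sum_mul_pd (hz.of_le (by norm_num)) hy
  simp only [conjHess, Matrix.add_mulVec, Matrix.smul_mulVec, h1, Matrix.vecMulVec_mulVec, h2, h3]
  simp

include hh in
theorem IsPotential.hessInv_transpose (hy : y ≠ 0) : (hessInv h y).transpose = hessInv h y := by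
  ext i j; exact hh.hessInv_comm hy j i

include hh in
theorem IsPotential.hessInv_mulVec_pd (hy : y ≠ 0) :
    (hessInv h y).mulVec (fun i => pd i h y) = (h y)⁻¹ • fun j => y j := by
  funext j
  have := hh.dualPd_self hy j
  simp only [dualPd] at this
  simp [Matrix.mulVec, dotProduct, this, div_eq_inv_mul]

theorem smul_hess_eq : h y • hess z y = conjHess h z y -
    Matrix.vecMulVec (fun i => pd i z y) (fun i => pd i h y) -
    Matrix.vecMulVec (fun i => pd i h y) (fun i => pd i z y) := by
  rw [conjHess]; abel

include hh in
theorem IsPotential.trace_hess_eq (hz : SmoothOff 2 z) (hz0 : Hom 0 z) (hy : y ≠ 0) :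
    h y ^ 4 * (hessInv h y * hess z y * hessInv h y * hess z y).trace =
      conjHessSq h z y + 2 * carre h z z y := by
  have := trace_mul_mul_mul_of_decomp (hh.hessInv_transpose hy) (conjHess_transpose hz hy)
    (hh.conjHess_mulVec hz hz0 hy) (hh.hessInv_mulVec_pd hy)
    (by rw [dotProduct_comm]; exact hh.sum_mul_pd hy) (hh.ne_zero y hy)
    (by rw [dotProduct_comm]; exact hz0.sum_mul_pd (hz.of_le (by norm_num)) hy)
    (smul_hess_eq (h := h) (z := z) (y := y))
  rw [conjHessSq, carre_eq_dotProduct]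
  linear_combination h y ^ 2 * this

include hh in
theorem IsPotential.sq_lap_le (hn : 2 ≤ n) (hz : SmoothOff 2 z) (hz0 : Hom 0 z) (hy : y ≠ 0) :
    lap h z y ^ 2 ≤ ((n : ℝ) - 1) * conjHessSq h z y := by
  have h1 := trace_mul_of_decomp (hh.hessInv_transpose hy) (hh.hessInv_mulVec_pd hy)
    (by rw [dotProduct_comm]; exact hz0.sum_mul_pd (hz.of_le (by norm_num)) hy)
    (smul_hess_eq (h := h) (z := z) (y := y))
  have hP : (hessSq h y).transpose = hessSq h y := by ext i j; exact hh.hessSq_comm hy j i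
  have h2 := sq_trace_mul_le hn (hh.hessInv_posDef hy) (hh.hessInv_mul_hessSq hy) hP
    (conjHess_transpose hz hy) (hh.conjHess_mulVec hz hz0 hy) (hh.hessInv_mulVec_pd hy)
    (by rw [dotProduct_comm]; exact hh.sum_mul_pd hy) (hh.ne_zero y hy)
  rw [lap_eq_trace, conjHessSq]
  have h3 : (h y ^ 2 * (hessInv h y * hess z y).trace) ^ 2 =
      h y ^ 2 * (hessInv h y * conjHess h z y).trace ^ 2 := by rw [← h1]; ring
  rw [h3]
  calc _ ≤ h y ^ 2 * _ := mul_le_mul_of_nonneg_left h2 (sq_nonneg _)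
    _ = _ := by ring

include hh in
theorem IsPotential.smooth_conjHess (hz : SmoothOff ∞ z) (i j : Fin n) :
    SmoothOff ∞ fun y => conjHess h z y i j := by
  simp only [conjHess, Matrix.add_apply, Matrix.smul_apply, hess, Matrix.of_apply,
    Matrix.vecMulVec_apply, smul_eq_mul]
  exact ((hh.smooth.mul ((hz.pd_top j).pd_top i)).add ((hz.pd_top i).mul (hh.smooth.pd_top j))).add
    ((hh.smooth.pd_top i).mul (hz.pd_top j))

theorem SmoothOff.trace_mul {k : WithTop ℕ∞} {M N : E n → Matrix (Fin n) (Fin n) ℝ}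
    (hM : ∀ i j, SmoothOff k fun y => M y i j) (hN : ∀ i j, SmoothOff k fun y => N y i j) :
    SmoothOff k fun y => (M y * N y * M y * N y).trace := by
  simp only [Matrix.trace, Matrix.diag, Matrix.mul_apply]
  exact SmoothOff.sum fun i _ => SmoothOff.sum fun j _ => (SmoothOff.sum fun k _ =>
    (SmoothOff.sum fun l _ => (hM _ _).mul (hN _ _)).mul (hM _ _)).mul (hN _ _)

include hh in
theorem IsPotential.smooth_conjHessSq (hz : SmoothOff ∞ z) : SmoothOff ∞ (conjHessSq h z) :=
  (hh.smooth.pow 2).mul (SmoothOff.trace_mul hh.smooth_hessInv (hh.smooth_conjHess hz))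

include hh in
/-- The centro-affine Bochner formula. -/
theorem IsPotential.bochner (hz : SmoothOff ∞ z) (hz0 : Hom 0 z) :
    wint h (fun y => lap h z y ^ 2) =
      wint h (conjHessSq h z) + (n - 2) * wint h (carre h z z) := by
  have h1 := hh.bochner_hess hz hz0
  have s1 : SmoothOff 0 fun y => lap h z y ^ 2 := ((hh.smooth_lap_top hz).pow 2).of_le (by simp)
  have s2 : SmoothOff 0 (conjHessSq h z) := (hh.smooth_conjHessSq hz).of_le (by simp)
  have s3 : SmoothOff 0 (carre h z z) := hh.smooth_carre_zero hz.one hz.one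
  have h2 : wint h (fun y => lap h z y ^ 2 - (conjHessSq h z y + (n - 2) * carre h z z y)) = 0 := by
    rw [← h1]
    refine wint_congr fun y hy => ?_
    rw [hh.trace_hess_eq hz.two hz0 hy]; ring
  rw [hh.wint_sub s1 (s2.add ((SmoothOff.const _).mul s3)),
    hh.wint_add s2 ((SmoothOff.const _).mul s3), wint_const_mul] at h2
  linarith

include hh in
/-- Lichnerowicz' inequality. -/
theorem IsPotential.lichnerowicz (hn : 3 ≤ n) (hz : SmoothOff ∞ z) (hz0 : Hom 0 z) :
    ((n : ℝ) - 1) * wint h (carre h z z) ≤ wint h (fun y => lap h z y ^ 2) := by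
  have h1 := hh.bochner hz hz0
  have h2 : wint h (fun y => lap h z y ^ 2) ≤ ((n : ℝ) - 1) * wint h (conjHessSq h z) := by
    rw [← wint_const_mul]
    exact hh.wint_mono (((hh.smooth_lap_top hz).pow 2).of_le (by simp))
      ((SmoothOff.const _).mul ((hh.smooth_conjHessSq hz).of_le (by simp)))
      fun y hy => hh.sq_lap_le (by omega) hz.two hz0 hy
  have hn' : (3 : ℝ) ≤ n := by exact_mod_cast hn
  have h3 : ((n : ℝ) - 2) * (wint h (fun y => lap h z y ^ 2) -
      ((n : ℝ) - 1) * wint h (carre h z z)) ≥ 0 := by nlinarith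
  have : 0 ≤ wint h (fun y => lap h z y ^ 2) - ((n : ℝ) - 1) * wint h (carre h z z) :=
    nonneg_of_mul_nonneg_right h3 (by linarith)
  linarith

end Bochner

/-! ### A duality argument for spectral gaps, and continuation of dense ranges -/

section Gap

variable {h f g z : E n → ℝ} (hh : IsPotential h) {y : E n}

theorem carre_sub_const_mul_left (hf : SmoothOff 1 f) (hg : SmoothOff 1 g) (c : ℝ) (hy : y ≠ 0) :
    carre h (fun y => f y - c * g y) z y = carre h f z y - c * carre h g z y := by
  have hc : SmoothOff 1 fun y => c * g y := (SmoothOff.const c).mul hg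
  simp only [carre, dualPd_sub _ hf hc hy, dualPd_const_mul, sub_mul, Finset.sum_sub_distrib,
    mul_sub, mul_assoc, ← Finset.mul_sum]
  ring

include hh in
theorem IsPotential.carre_sub_const_mul_self (hf : SmoothOff 1 f) (hg : SmoothOff 1 g) (c : ℝ)
    (hy : y ≠ 0) :
    carre h (fun y => f y - c * g y) (fun y => f y - c * g y) y =
      carre h f f y - 2 * c * carre h f g y + c ^ 2 * carre h g g y := by
  rw [carre_sub_const_mul_left hf hg c hy, hh.carre_comm hy (f := f),
    hh.carre_comm hy (f := g), carre_sub_const_mul_left hf hg c hy,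
    carre_sub_const_mul_left hf hg c hy, hh.carre_comm hy (f := g) (g := f)]
  ring

include hh in
/-- Hörmander's duality argument: if the functions `-Δv`, with `v` in a class of functions on which
`λ ∫ |grad v|² ≤ ∫ (Δv)²`, come `L²`-close to `u`, then `λ ∫ u² ≤ ∫ |grad u|²`. -/
theorem IsPotential.gap_of_dense {lam : ℝ} (hlam : 0 ≤ lam) {D : Set (E n → ℝ)}
    (hD : ∀ v ∈ D, SmoothOff ∞ v ∧ Hom 0 v)
    (hB : ∀ v ∈ D, lam * wint h (carre h v v) ≤ wint h (fun y => lap h v y ^ 2))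
    {u : E n → ℝ} (hu : SmoothOff 2 u) (hu0 : Hom 0 u)
    (hd : ∀ ε > 0, ∃ v ∈ D, wint h (fun y => (-lap h v y - u y) ^ 2) < ε) :
    lam * wint h (fun y => u y ^ 2) ≤ wint h (carre h u u) := by
  refine le_of_forall_pos_le_add fun ε hε => ?_
  obtain ⟨v, hvD, hv⟩ := hd (ε / (lam + 1)) (by positivity)
  obtain ⟨hvs, hv0⟩ := hD v hvD
  have hu1 : SmoothOff 1 u := hu.of_le (by norm_num)
  have hu00 : SmoothOff 0 u := hu.of_le (by simp)
  have hl0 : SmoothOff 0 (lap h v) := (hh.smooth_lap_top hvs).of_le (by simp)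
  have s1 := hh.smooth_carre_zero hu1 hu1
  have s2 := hh.smooth_carre_zero hu1 hvs.one
  have s3 := hh.smooth_carre_zero hvs.one hvs.one
  -- expand `0 ≤ ∫ |grad (u - λ v)|²` and use that `-Δv` is close to `u`
  have h1 : 0 ≤ wint h (fun y => carre h u u y - 2 * lam * carre h u v y +
      lam ^ 2 * carre h v v y) :=
    hh.wint_nonneg fun y hy => by
      rw [← hh.carre_sub_const_mul_self hu1 hvs.one lam hy]
      exact hh.carre_self_nonneg hy
  rw [hh.wint_add (s1.sub ((SmoothOff.const _).mul s2)) ((SmoothOff.const _).mul s3),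
    hh.wint_sub s1 ((SmoothOff.const _).mul s2), wint_const_mul, wint_const_mul] at h1
  have h2 := hh.wint_mul_lap hu1 hu0 hvs.two hv0
  have h3 : wint h (fun y => (-lap h v y - u y) ^ 2) = wint h (fun y => lap h v y ^ 2) +
      2 * wint h (fun y => u y * lap h v y) + wint h (fun y => u y ^ 2) := by
    rw [← wint_const_mul, ← hh.wint_add (hl0.pow 2) ((SmoothOff.const _).mul (hu00.mul hl0)),
      ← hh.wint_add ((hl0.pow 2).add ((SmoothOff.const _).mul (hu00.mul hl0))) (hu00.pow 2)]
    exact wint_congr fun y _ => by ring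
  have h4 := mul_le_mul_of_nonneg_left (hB v hvD) hlam
  have h5 : lam * (ε / (lam + 1)) ≤ ε := by
    rw [mul_div_assoc', div_le_iff₀ (by linarith)]; nlinarith
  have h6 := mul_le_mul_of_nonneg_left hv.le hlam
  nlinarith

end Gap

section Continuation

variable {V : Type*} [AddCommGroup V]

/-- If `T` has dense range for a quadratic seminorm `q`, then so has any `T'` close to `T`. -/
theorem dense_of_close {q : V → ℝ} {C D : AddSubgroup V}
    (hq0 : ∀ a ∈ C, 0 ≤ q a) (hq : ∀ a ∈ C, ∀ b ∈ C, q (a - b) ≤ 2 * q a + 2 * q b)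
    {T T' : V → V} (hT : ∀ u ∈ D, T u ∈ C) (hT' : ∀ u ∈ D, T' u ∈ C)
    (hadd : ∀ u ∈ D, ∀ v ∈ D, T' (u + v) = T' u + T' v)
    (hclose : ∀ u ∈ D, q (T' u - T u) ≤ 1 / 16 * q (T u))
    (hdense : ∀ w ∈ C, ∀ ε > 0, ∃ u ∈ D, q (w - T u) < ε) :
    ∀ w ∈ C, ∀ ε > 0, ∃ u ∈ D, q (w - T' u) < ε := by
  have hT'z : T' 0 = 0 := by simpa using hadd 0 D.zero_mem 0 D.zero_mem
  -- an approximate solution which halves the square of the norm, to be iterated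
  have step : ∀ w ∈ C, ∃ u ∈ D, q (w - T' u) ≤ 1 / 2 * q w := by
    intro w hw
    rcases (hq0 w hw).eq_or_lt with h0 | h0
    · exact ⟨0, D.zero_mem, by rw [hT'z, sub_zero, ← h0]; norm_num⟩
    · obtain ⟨u, hu, hlt⟩ := hdense w hw (q w / 9) (by positivity)
      refine ⟨u, hu, ?_⟩
      have h1 := hq w hw (w - T u) (C.sub_mem hw (hT u hu))
      rw [sub_sub_cancel] at h1
      have h2 := hq (w - T u) (C.sub_mem hw (hT u hu)) (T' u - T u)
        (C.sub_mem (hT' u hu) (hT u hu))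
      rw [sub_sub_sub_cancel_right] at h2
      have h3 := hclose u hu
      linarith
  have iter : ∀ k : ℕ, ∀ w ∈ C, ∃ u ∈ D, q (w - T' u) ≤ (1 / 2) ^ k * q w := by
    intro k
    induction k with
    | zero => exact fun w hw => ⟨0, D.zero_mem, by simp [hT'z]⟩
    | succ k ih =>
      intro w hw
      obtain ⟨u, hu, h1⟩ := ih w hw
      obtain ⟨v, hv, h2⟩ := step (w - T' u) (C.sub_mem hw (hT' u hu))
      refine ⟨u + v, D.add_mem hu hv, ?_⟩
      rw [hadd u hu v hv, ← sub_sub, pow_succ]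
      nlinarith
  intro w hw ε hε
  obtain ⟨k, hk⟩ := exists_pow_lt_of_lt_one (show 0 < ε / (q w + 1) by
    have := hq0 w hw; positivity) (by norm_num : (1 / 2 : ℝ) < 1)
  obtain ⟨u, hu, h1⟩ := iter k w hw
  refine ⟨u, hu, h1.trans_lt ?_⟩
  have := hq0 w hw
  rw [lt_div_iff₀ (by linarith)] at hk
  have : 0 < (1 / 2 : ℝ) ^ k := by positivity
  nlinarith

/-- The method of continuity for dense ranges. -/
theorem dense_of_path {q : V → ℝ} {C D : AddSubgroup V}
    (hq0 : ∀ a ∈ C, 0 ≤ q a) (hq : ∀ a ∈ C, ∀ b ∈ C, q (a - b) ≤ 2 * q a + 2 * q b)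
    {T : ℝ → V → V} (hT : ∀ t ∈ Icc (0 : ℝ) 1, ∀ u ∈ D, T t u ∈ C)
    (hadd : ∀ t ∈ Icc (0 : ℝ) 1, ∀ u ∈ D, ∀ v ∈ D, T t (u + v) = T t u + T t v)
    {δ : ℝ} (hδ : 0 < δ)
    (hclose : ∀ s ∈ Icc (0 : ℝ) 1, ∀ t ∈ Icc (0 : ℝ) 1, |s - t| < δ →
      ∀ u ∈ D, q (T s u - T t u) ≤ 1 / 16 * q (T t u))
    (hdense : ∀ w ∈ C, ∀ ε > 0, ∃ u ∈ D, q (w - T 0 u) < ε) :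
    ∀ w ∈ C, ∀ ε > 0, ∃ u ∈ D, q (w - T 1 u) < ε := by
  obtain ⟨N, hN⟩ := exists_nat_gt (1 / δ)
  have hN0 : (0 : ℝ) < N := lt_trans (by positivity) hN
  have key : ∀ k : ℕ, k ≤ N → ∀ w ∈ C, ∀ ε > 0, ∃ u ∈ D, q (w - T (k / N) u) < ε := by
    intro k
    induction k with
    | zero => intro _; simpa using hdense
    | succ k ih =>
      intro hk
      have m1 : ((k : ℝ) / N) ∈ Icc (0 : ℝ) 1 := by
        refine ⟨by positivity, ?_⟩
        rw [div_le_one hN0]; exact_mod_cast (Nat.le_succ k).trans hk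
      have m2 : (((k + 1 : ℕ) : ℝ) / N) ∈ Icc (0 : ℝ) 1 := by
        refine ⟨by positivity, ?_⟩
        rw [div_le_one hN0]; exact_mod_cast hk
      refine dense_of_close hq0 hq (hT _ m1) (hT _ m2) (hadd _ m2)
        (hclose _ m2 _ m1 ?_) (ih ((Nat.le_succ k).trans hk))
      rw [← sub_div]
      push_cast
      rw [add_sub_cancel_left, abs_of_pos (by positivity), div_lt_iff₀ hN0]
      rw [div_lt_iff₀ hδ] at hN
      linarith
  have := key N le_rfl
  rwa [div_self hN0.ne'] at this

end Continuation

/-! ### The Euclidean ball and the segment joining it to a potential -/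

section Segment

variable {h f : E n → ℝ} {y : E n}

theorem pd_normSq (j : Fin n) : pd j (fun y : E n => ‖y‖ ^ 2) y = 2 * y j := by
  have h5 : HasFDerivAt (fun y : E n => ‖y‖ ^ 2) _ y := (hasFDerivAt_id y).norm_sq
  unfold pd
  rw [h5.fderiv]
  simp [EuclideanSpace.inner_single_right]

theorem normSq_hess (i j : Fin n) :
    pd i (pd j fun y : E n => ‖y‖ ^ 2) y = 2 * (1 : Matrix (Fin n) (Fin n) ℝ) i j := by
  have h1 : (pd j fun y : E n => ‖y‖ ^ 2) = fun y => 2 * y j := by funext y; exact pd_normSq j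
  rw [h1, pd_const_mul, pd_coord, Matrix.one_apply]

/-- The square root of the convex combination of the squares of the Euclidean norm and of `h`. -/
def segment (h : E n → ℝ) (t : ℝ) (y : E n) : ℝ := Real.sqrt ((1 - t) * ‖y‖ ^ 2 + t * h y ^ 2)

theorem IsPotential.segment_pos_aux (hh : IsPotential h) {t : ℝ} (ht : t ∈ Icc (0 : ℝ) 1)
    (hy : y ≠ 0) : 0 < (1 - t) * ‖y‖ ^ 2 + t * h y ^ 2 := by
  have h1 : 0 < ‖y‖ ^ 2 := by have := norm_pos_iff.2 hy; positivity
  have h2 : 0 < h y ^ 2 := by have := hh.pos y hy; positivity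
  rcases ht.1.eq_or_lt with h0 | h0
  · rw [← h0]; simpa using h1
  · have := mul_pos h0 h2
    have := mul_nonneg (sub_nonneg.2 ht.2) h1.le
    linarith

theorem IsPotential.segment_sq (hh : IsPotential h) {t : ℝ} (ht : t ∈ Icc (0 : ℝ) 1)
    (hy : y ≠ 0) : segment h t y ^ 2 = (1 - t) * ‖y‖ ^ 2 + t * h y ^ 2 :=
  Real.sq_sqrt (hh.segment_pos_aux ht hy).le

theorem IsPotential.hessSq_segment (hh : IsPotential h) {t : ℝ} (ht : t ∈ Icc (0 : ℝ) 1)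
    (hy : y ≠ 0) : hessSq (segment h t) y = (1 - t) • 1 + t • hessSq h y := by
  ext i j
  have hsq : SmoothOff ∞ fun y : E n => ‖y‖ ^ 2 := SmoothOff.normSq
  have h1 : ∀ z, z ≠ 0 → segment h t z ^ 2 / 2 =
      (1 - t) / 2 * ‖z‖ ^ 2 + t * (h z ^ 2 / 2) := by
    intro z hz; rw [hh.segment_sq ht hz]; ring
  have h2 : ∀ z, z ≠ 0 → pd j (fun y => segment h t y ^ 2 / 2) z =
      (1 - t) / 2 * pd j (fun y : E n => ‖y‖ ^ 2) z + t * pd j (fun y => h y ^ 2 / 2) z := by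
    intro z hz
    rw [pd_congr h1 j hz, pd_add j ((SmoothOff.const _).mul hsq.one)
      ((SmoothOff.const _).mul hh.smooth_sq.one) hz, pd_const_mul, pd_const_mul]
  simp only [hessSq, Matrix.of_apply, Matrix.add_apply, Matrix.smul_apply, smul_eq_mul]
  rw [pd_congr h2 i hy, pd_add i ((SmoothOff.const _).mul (hsq.pd_top j).one)
      ((SmoothOff.const _).mul (hh.smooth_sq.pd_top j).one) hy, pd_const_mul, pd_const_mul,
      normSq_hess]
  ring

theorem IsPotential.segment (hh : IsPotential h) {t : ℝ} (ht : t ∈ Icc (0 : ℝ) 1) :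
    IsPotential (segment h t) where
  smooth := SmoothOff.sqrt (((SmoothOff.const _).mul SmoothOff.normSq).add
    ((SmoothOff.const _).mul (hh.smooth.pow 2))) fun _ hy => (hh.segment_pos_aux ht hy).ne'
  hom := by
    intro s hs y hy
    have : (1 - t) * ‖s • y‖ ^ 2 + t * h (s • y) ^ 2 =
        s ^ 2 * ((1 - t) * ‖y‖ ^ 2 + t * h y ^ 2) := by
      rw [hh.hom s hs y hy, norm_smul, Real.norm_eq_abs, abs_of_pos hs, zpow_one]; ring
    rw [CentroAffine.segment, this, Real.sqrt_mul (sq_nonneg s), Real.sqrt_sq hs.le, zpow_one]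
    rfl
  pos := fun _ hy => Real.sqrt_pos.2 (hh.segment_pos_aux ht hy)
  even := fun y => by simp [CentroAffine.segment, hh.even]
  posDef := fun y hy => by
    rw [hh.hessSq_segment ht hy]
    rcases ht.1.eq_or_lt with h0 | h0
    · rw [← h0]; simpa using Matrix.PosDef.one
    · exact Matrix.PosDef.posSemidef_add (Matrix.PosSemidef.one.smul (sub_nonneg.2 ht.2))
        ((hh.posDef y hy).smul h0)

end Segment

/-! ### The Laplacian of the round sphere on polynomials -/

section Round

variable {f u : E n → ℝ} {y : E n}

theorem hessSq_norm : hessSq (fun y : E n => ‖y‖) y = 1 := by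
  have h1 : (fun y : E n => ‖y‖ ^ 2 / 2) = fun y => (1 / 2) * ‖y‖ ^ 2 := by funext y; ring
  have h2 : ∀ j : Fin n, (pd j fun y : E n => (1 / 2) * ‖y‖ ^ 2) =
      fun y => (1 / 2) * pd j (fun y : E n => ‖y‖ ^ 2) y := fun j => by
    funext y; rw [pd_const_mul]
  ext i j
  simp only [hessSq, h1, h2, Matrix.of_apply, pd_const_mul, normSq_hess]
  ring

theorem isPotential_norm : IsPotential (fun y : E n => ‖y‖) where
  smooth := SmoothOff.norm
  hom := fun t ht y _ => by simp [norm_smul, abs_of_pos ht]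
  pos := fun y hy => norm_pos_iff.2 hy
  even := fun y => norm_neg y
  posDef := fun y _ => by rw [hessSq_norm]; exact Matrix.PosDef.one

theorem dualPd_norm (j : Fin n) : dualPd (fun y : E n => ‖y‖) j f y = pd j f y := by
  simp [dualPd, hessInv, hessSq_norm, Matrix.one_apply]

theorem lap_norm : lap (fun y : E n => ‖y‖) f y = ‖y‖ ^ 2 * ∑ j, pd j (pd j f) y := by
  simp only [lap, dualPd_norm]

/-- The rotation vector field in the plane of the `i`-th and `j`-th coordinates. -/
def rot (i j : Fin n) (f : E n → ℝ) (y : E n) : ℝ := y i * pd j f y - y j * pd i f y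

theorem rot_mul (i j : Fin n) (hf : SmoothOff 1 f) (hu : SmoothOff 1 u) (hy : y ≠ 0) :
    rot i j (fun y => f y * u y) y = rot i j f y * u y + f y * rot i j u y := by
  simp only [rot, pd_mul _ hf hu hy]; ring

theorem norm_sq_eq_sum (y : E n) : ‖y‖ ^ 2 = ∑ i, y i ^ 2 := by
  rw [EuclideanSpace.norm_sq_eq]; simp

/-- The Laplacian of the round sphere is the Casimir operator of the rotation group. -/
theorem lap_norm_eq_sum_rot (hu : SmoothOff 2 u) (hu0 : Hom 0 u) (hy : y ≠ 0) :
    lap (fun y : E n => ‖y‖) u y = 1 / 2 * ∑ i, ∑ j, rot i j (rot i j u) y := by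
  have hu1 : SmoothOff 1 u := hu.of_le (by norm_num)
  have key : ∀ i j : Fin n, rot i j (rot i j u) y =
      y i ^ 2 * pd j (pd j u) y + y j ^ 2 * pd i (pd i u) y +
      (if j = i then y i * pd j u y else 0) + (if i = j then y j * pd i u y else 0)
      - y i * pd i u y - y j * pd j u y
      - y i * (y j * pd j (pd i u) y) - y j * (y i * pd i (pd j u) y) := by
    intro i j
    have h1 : ∀ k, pd k (rot i j u) y =
        (if k = i then 1 else 0) * pd j u y + y i * pd k (pd j u) y -
        ((if k = j then 1 else 0) * pd i u y + y j * pd k (pd i u) y) := by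
      intro k
      unfold rot
      rw [pd_sub k ((SmoothOff.coord i).mul (hu.pd_one j))
        ((SmoothOff.coord j).mul (hu.pd_one i)) hy, pd_mul k (SmoothOff.coord i) (hu.pd_one j) hy,
        pd_mul k (SmoothOff.coord j) (hu.pd_one i) hy, pd_coord, pd_coord]
    rw [rot, h1, h1]
    simp only [if_true]
    split_ifs <;> ring
  simp only [key, Finset.sum_add_distrib, Finset.sum_sub_distrib, ← Finset.mul_sum,
    Finset.sum_ite_eq, Finset.sum_ite_eq', Finset.mem_univ, if_true]
  have e1 := hu0.sum_mul_pd hu1 hy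
  have e2 : ∀ i : Fin n, ∑ j, y j * pd j (pd i u) y = -pd i u y := by
    intro i
    rw [← hu0.sum_mul_pd_pd hu hy i]
    exact Finset.sum_congr rfl fun j _ => by rw [pd_comm hu j i hy]
  have e3 : ∑ x, y x * ∑ i, y i * pd x (pd i u) y = 0 := by
    simp only [hu0.sum_mul_pd_pd hu hy, mul_neg, Finset.sum_neg_distrib, e1, neg_zero]
  have e4 : ∑ i, ∑ j, y j * (y i * pd i (pd j u) y) = 0 := by
    rw [← e3]
    refine Finset.sum_congr rfl fun i _ => ?_
    rw [Finset.mul_sum]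
    exact Finset.sum_congr rfl fun j _ => by ring
  have e5 : ∑ i, y i * (((Finset.univ : Finset (Fin n)).card : ℝ) * pd i u y) = 0 := by
    simp only [mul_left_comm _ (((Finset.univ : Finset (Fin n)).card : ℕ) : ℝ), ← Finset.mul_sum,
      e1, mul_zero]
  simp only [e2, e4, e5, mul_neg, Finset.sum_neg_distrib, e1, Finset.sum_const, nsmul_eq_mul,
    mul_zero,
    lap_norm, norm_sq_eq_sum, ← Finset.sum_mul, ← Finset.mul_sum]
  ring

end Round

section Polynomials

open MvPolynomial

/-- The `0`-homogeneous extension of the restriction of a polynomial to the unit sphere. -/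
def polyExt (p : MvPolynomial (Fin n) ℝ) (y : E n) : ℝ := eval (fun i => y i * ‖y‖⁻¹) p

theorem polyExt_add (p q : MvPolynomial (Fin n) ℝ) (y : E n) :
    polyExt (p + q) y = polyExt p y + polyExt q y := by simp [polyExt]

theorem polyExt_smooth (p : MvPolynomial (Fin n) ℝ) : SmoothOff ∞ (polyExt p) := by
  induction p using MvPolynomial.induction_on with
  | C a =>
    have : polyExt (C a : MvPolynomial (Fin n) ℝ) = fun _ => a := by funext y; simp [polyExt]
    rw [this]
    exact SmoothOff.const a
  | add p q hp hq => exact (hp.add hq).congr fun y _ => polyExt_add p q y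
  | mul_X p i hp =>
    exact (hp.mul ((SmoothOff.coord i).mul
      ((SmoothOff.norm).inv fun y hy => norm_ne_zero_iff.2 hy))).congr fun y _ => by simp [polyExt]

theorem polyExt_hom (p : MvPolynomial (Fin n) ℝ) : Hom 0 (polyExt p) := by
  intro t ht y hy
  have : ∀ i, (t • y) i * ‖t • y‖⁻¹ = y i * ‖y‖⁻¹ := by
    intro i
    simp only [norm_smul, Real.norm_eq_abs, abs_of_pos ht, PiLp.smul_apply, smul_eq_mul]
    field_simp
  simp only [polyExt, this, zpow_zero, one_mul]

theorem polyExt_sph (p : MvPolynomial (Fin n) ℝ) (θ : Sph n) :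
    polyExt p θ = eval (fun i => (θ : E n) i) p := by simp [polyExt]

/-- The rotation vector field as a derivation of polynomials. -/
def polyRot (i j : Fin n) (p : MvPolynomial (Fin n) ℝ) : MvPolynomial (Fin n) ℝ :=
  X i * pderiv j p - X j * pderiv i p

/-- Rotations annihilate the norm, so they act on restrictions of polynomials to the sphere through
the polynomials themselves. -/
theorem rot_polyExt (i j : Fin n) (p : MvPolynomial (Fin n) ℝ) {y : E n} (hy : y ≠ 0) :
    rot i j (polyExt p) y = polyExt (polyRot i j p) y := by
  induction p using MvPolynomial.induction_on with
  | C a =>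
    have : polyExt (C a : MvPolynomial (Fin n) ℝ) = fun _ => a := by funext y; simp [polyExt]
    rw [this]
    simp [rot, polyRot, polyExt, pd_const]
  | add p q hp hq =>
    have h1 : polyExt (p + q) = fun y => polyExt p y + polyExt q y := funext (polyExt_add p q)
    have h2 : polyRot i j (p + q) = polyRot i j p + polyRot i j q := by
      simp only [polyRot, map_add]; ring
    rw [h1, h2, polyExt_add, ← hp, ← hq]
    simp only [rot, pd_add _ (polyExt_smooth p).one (polyExt_smooth q).one hy]
    ring
  | mul_X p k hp =>
    have hinv : SmoothOff 1 fun y : E n => ‖y‖⁻¹ :=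
      (SmoothOff.norm).inv fun y hy => norm_ne_zero_iff.2 hy
    have h1 : polyExt (p * X k) = fun y => polyExt p y * (y k * ‖y‖⁻¹) := by
      funext y; simp [polyExt]
    have h3 : rot i j (fun y : E n => ‖y‖⁻¹) y = 0 := by
      have e1 : ∀ k, pd k (fun y : E n => ‖y‖⁻¹) y = -‖y‖⁻¹ ^ 3 * y k := by
        intro k
        have hs : SmoothOff 1 fun y : E n => ‖y‖ := SmoothOff.norm
        have a1 := pd_sq k hs hy
        have a2 := pd_zpow k hs (fun y hy => norm_ne_zero_iff.2 hy) (-1) hy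
        rw [pd_normSq] at a1
        have hpos := norm_pos_iff.2 hy
        simp only [zpow_neg_one] at a2
        rw [a2, show (-1 : ℤ) - 1 = -(2 : ℕ) by norm_num, zpow_neg, zpow_natCast]
        push_cast
        field_simp
        linarith
      simp only [rot, e1]; ring
    have h4 : rot i j (fun y : E n => y k) y =
        y i * (if j = k then 1 else 0) - y j * (if i = k then 1 else 0) := by
      simp only [rot, pd_coord]
    rw [h1, rot_mul i j (polyExt_smooth p).one ((SmoothOff.coord k).mul hinv) hy,
      rot_mul i j (SmoothOff.coord k) hinv hy, h3, h4, hp]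
    simp only [polyExt, polyRot, map_sub, map_mul, pderiv_mul, map_add, eval_X, pderiv_X,
      Pi.single_apply]
    simp only [eq_comm (a := k)]
    split_ifs <;> simp <;> ring

/-- `(1/2) ∑ Rᵢⱼ²` on polynomials: the spherical Laplacian. -/
def polyLap (p : MvPolynomial (Fin n) ℝ) : MvPolynomial (Fin n) ℝ :=
  C (1 / 2) * ∑ i, ∑ j, polyRot i j (polyRot i j p)

theorem lap_polyExt (p : MvPolynomial (Fin n) ℝ) {y : E n} (hy : y ≠ 0) :
    lap (fun y : E n => ‖y‖) (polyExt p) y = polyExt (polyLap p) y := by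
  rw [lap_norm_eq_sum_rot (polyExt_smooth p).two (polyExt_hom p) hy]
  have h1 : ∀ i j, rot i j (rot i j (polyExt p)) y = polyExt (polyRot i j (polyRot i j p)) y := by
    intro i j
    rw [← rot_polyExt i j _ hy]
    simp only [rot]
    rw [pd_congr (fun z hz => rot_polyExt i j p hz), pd_congr (fun z hz => rot_polyExt i j p hz)]
    all_goals exact hy
  simp only [h1]
  simp [polyLap, polyExt]

theorem totalDegree_pderiv_le (j : Fin n) (p : MvPolynomial (Fin n) ℝ) :
    (pderiv j p).totalDegree ≤ p.totalDegree - 1 := by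
  rw [totalDegree, Finset.sup_le_iff]
  intro m hm
  rw [mem_support_iff, coeff_pderiv] at hm
  have h1 : m + Finsupp.single j 1 ∈ p.support := mem_support_iff.2 (left_ne_zero_of_mul hm)
  have h2 := le_totalDegree h1
  rw [Finsupp.sum_add_index' (by simp) (by simp), Finsupp.sum_single_index rfl] at h2
  omega

theorem totalDegree_X_mul_pderiv_le (i j : Fin n) (p : MvPolynomial (Fin n) ℝ) :
    (X i * pderiv j p).totalDegree ≤ p.totalDegree := by
  rcases Nat.eq_zero_or_pos p.totalDegree with h | h
  · rw [totalDegree_eq_zero_iff_eq_C.1 h]; simp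
  · refine (totalDegree_mul _ _).trans ?_
    have := totalDegree_pderiv_le j p
    rw [totalDegree_X]
    omega

theorem polyRot_mem (i j : Fin n) {p : MvPolynomial (Fin n) ℝ} {N : ℕ}
    (hp : p ∈ restrictTotalDegree (Fin n) ℝ N) : polyRot i j p ∈ restrictTotalDegree (Fin n) ℝ N :=
  Submodule.sub_mem _
    ((mem_restrictTotalDegree _ _ _).2 ((totalDegree_X_mul_pderiv_le i j p).trans
      ((mem_restrictTotalDegree _ _ _).1 hp)))
    ((mem_restrictTotalDegree _ _ _).2 ((totalDegree_X_mul_pderiv_le j i p).trans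
      ((mem_restrictTotalDegree _ _ _).1 hp)))

/-- The polynomial Laplacian as a linear map. -/
def polyLapLin (n : ℕ) : MvPolynomial (Fin n) ℝ →ₗ[ℝ] MvPolynomial (Fin n) ℝ where
  toFun := polyLap
  map_add' p q := by
    have : ∀ i j (p q : MvPolynomial (Fin n) ℝ), polyRot i j (p + q) = polyRot i j p + polyRot i j q
      := fun i j p q => by simp only [polyRot, map_add]; ring
    simp only [polyLap, this, Finset.sum_add_distrib, mul_add]
  map_smul' c p := by
    have : ∀ i j (p : MvPolynomial (Fin n) ℝ), polyRot i j (c • p) = c • polyRot i j p :=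
      fun i j p => by simp only [polyRot, Derivation.map_smul, mul_smul_comm, smul_sub]
    simp only [polyLap, this, ← Finset.smul_sum, mul_smul_comm, RingHom.id_apply]

theorem polyLap_mem {p : MvPolynomial (Fin n) ℝ} {N : ℕ}
    (hp : p ∈ restrictTotalDegree (Fin n) ℝ N) : polyLap p ∈ restrictTotalDegree (Fin n) ℝ N := by
  rw [polyLap, C_mul']
  exact Submodule.smul_mem _ _ (Submodule.sum_mem _ fun i _ => Submodule.sum_mem _ fun j _ =>
    polyRot_mem i j (polyRot_mem i j hp))

/-- If `L` preserves a finite-dimensional space `W` and has there the same kernel as `e`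
after composition with `e`, then `e ∘ L` and `e` have the same range on `W`. -/
theorem exists_apply_eq_of_ker_eq {V F : Type*} [AddCommGroup V] [Module ℝ V] [AddCommGroup F]
    [Module ℝ F] (W : Submodule ℝ V) [FiniteDimensional ℝ W] (L : V →ₗ[ℝ] V) (e : V →ₗ[ℝ] F)
    (hL : ∀ p ∈ W, L p ∈ W) (hker : ∀ p ∈ W, e (L p) = 0 ↔ e p = 0) {p : V} (hp : p ∈ W) :
    ∃ q ∈ W, e (L q) = e p := by
  let a : W →ₗ[ℝ] F := e.domRestrict W
  let b : W →ₗ[ℝ] F := (e ∘ₗ L).domRestrict W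
  have hk : LinearMap.ker b = LinearMap.ker a := by
    ext ⟨x, hx⟩
    simpa [a, b] using hker x hx
  have hle : LinearMap.range b ≤ LinearMap.range a := by
    rintro _ ⟨⟨x, hx⟩, rfl⟩
    exact ⟨⟨L x, hL x hx⟩, rfl⟩
  have h1 := a.finrank_range_add_finrank_ker
  have h2 := b.finrank_range_add_finrank_ker
  rw [hk] at h2
  have heq := Submodule.eq_of_le_of_finrank_eq hle (by omega)
  have : a ⟨p, hp⟩ ∈ LinearMap.range b := heq ▸ LinearMap.mem_range_self a _
  obtain ⟨⟨q, hq⟩, h⟩ := this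
  exact ⟨q, hq, h⟩

/-- Stone–Weierstrass on the sphere. -/
theorem exists_polyExt_near {w : E n → ℝ} (hw : SmoothOff 0 w) {ε : ℝ} (hε : 0 < ε) :
    ∃ p : MvPolynomial (Fin n) ℝ, ∀ θ : Sph n, |polyExt p θ - w θ| < ε := by
  let co : Fin n → C(Sph n, ℝ) := fun i =>
    ⟨fun θ => (θ : E n) i, (EuclideanSpace.proj (𝕜 := ℝ) i).continuous.comp continuous_subtype_val⟩
  let A : MvPolynomial (Fin n) ℝ →ₐ[ℝ] C(Sph n, ℝ) := aeval co
  have hA : ∀ p (θ : Sph n), A p θ = polyExt p θ := by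
    intro p θ
    rw [polyExt_sph]
    induction p using MvPolynomial.induction_on with
    | C a => simp [A]
    | add p q hp hq => simp [hp, hq]
    | mul_X p i hp =>
      simp only [map_mul, ContinuousMap.mul_apply, hp, eval_X]
      simp only [A, aeval_X]
      rfl
  have hsep : A.range.SeparatesPoints := by
    intro θ θ' hne
    have : ∃ i, (θ : E n) i ≠ (θ' : E n) i := by
      by_contra! h
      exact hne (Subtype.ext (by ext i; exact h i))
    obtain ⟨i, hi⟩ := this
    refine ⟨A (X i), ⟨A (X i), ⟨X i, rfl⟩, rfl⟩, fun h => hi ?_⟩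
    have h2 : co i θ = co i θ' := by simpa [A] using h
    exact h2
  obtain ⟨⟨_, p, rfl⟩, hp⟩ := ContinuousMap.exists_mem_subalgebra_near_continuousMap_of_separatesPoints
    A.range hsep ⟨fun θ : Sph n => w θ, hw.continuous_sph⟩ ε hε
  refine ⟨p, fun θ => ?_⟩
  have := (ContinuousMap.norm_lt_iff _ hε).1 hp θ
  simpa [hA] using this

end Polynomials

/-! ### Solving the equation on the round sphere -/

section Solve

variable {h z : E n → ℝ} (hh : IsPotential h)

include hh in
/-- A nonnegative continuous function of vanishing integral vanishes on the sphere. -/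
theorem IsPotential.eq_zero_of_wint_eq_zero {f : E n → ℝ} (hf : SmoothOff 0 f)
    (hf0 : ∀ y, y ≠ 0 → 0 ≤ f y) (hi : wint h f = 0) (θ : Sph n) : f θ = 0 := by
  have hc : Continuous fun θ : Sph n => weight h θ * f θ :=
    ((hh.smooth_weight.of_le (by simp)).mul hf).continuous_sph
  by_contra hne
  have hpos := hc.integral_pos_of_hasCompactSupport_nonneg_nonzero (μ := sph n) (x := θ)
    (HasCompactSupport.of_compactSpace _)
    (fun θ => mul_nonneg (hh.weight_pos (sph_ne_zero θ)).le (hf0 θ (sph_ne_zero θ)))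
    (mul_ne_zero (hh.weight_pos (sph_ne_zero θ)).ne' hne)
  exact hpos.ne' hi

theorem Hom.eq_sph {f : E n → ℝ} {k : ℤ} (hf : Hom k f) {y : E n} (hy : y ≠ 0) :
    ∃ θ : Sph n, f y = ‖y‖ ^ k * f θ := by
  have hn := norm_pos_iff.2 hy
  refine ⟨⟨‖y‖⁻¹ • y, by simp [norm_smul, hn.ne']⟩, ?_⟩
  have := hf ‖y‖ hn (‖y‖⁻¹ • y) (smul_ne_zero (inv_ne_zero hn.ne') hy)
  rw [smul_inv_smul₀ hn.ne'] at this
  exact this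

include hh in
/-- Functions of vanishing Dirichlet energy are constant. -/
theorem IsPotential.eq_const_of_wint_carre_eq_zero (hn : 2 ≤ n) (hz : SmoothOff 1 z)
    (hz0 : Hom 0 z) (hi : wint h (carre h z z) = 0) : ∃ c, ∀ y, y ≠ 0 → z y = c := by
  have h1 := hh.eq_zero_of_wint_eq_zero (hh.smooth_carre_zero hz hz)
    (fun y hy => hh.carre_self_nonneg hy) hi
  have h2 : ∀ j, ∀ θ : Sph n, pd j z θ = 0 := by
    intro j θ
    have hθ := sph_ne_zero θ
    have h3 := h1 θ
    rw [carre_eq_dotProduct, mul_eq_zero] at h3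
    rcases h3 with h3 | h3
    · exact absurd h3 (pow_ne_zero _ (hh.ne_zero θ hθ))
    · by_contra hne
      have := (hh.hessInv_posDef hθ).dotProduct_mulVec_pos (x := fun i => pd i z θ)
        (fun h0 => hne (congrFun h0 j))
      simp only [star_trivial] at this
      exact this.ne' h3
  have h4 : ∀ y, y ≠ 0 → fderiv ℝ z y = 0 := by
    intro y hy
    ext v
    rw [fderiv_eq_sum_pd]
    refine Finset.sum_eq_zero fun j _ => ?_
    obtain ⟨θ, hθ⟩ := (hz0.pd j).eq_sph hy
    rw [hθ, h2 j θ, mul_zero, mul_zero]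
  have hrank : 1 < Module.rank ℝ (E n) := by
    rw [← Module.finrank_eq_rank, finrank_euclideanSpace_fin]
    exact_mod_cast hn
  obtain ⟨c, hc⟩ := isOpen_compl_singleton.exists_is_const_of_fderiv_eq_zero
    (isConnected_compl_singleton_of_one_lt_rank hrank (0 : E n)).isPreconnected
    (fun y hy => (hz.differentiableAt one_ne_zero hy).differentiableWithinAt)
    (fun y hy => h4 y hy)
  exact ⟨c, fun y hy => hc y hy⟩

open MvPolynomial in
/-- On the round sphere, `c - Δ` is invertible on polynomials of bounded degree and mean zero. -/
theorem exists_poly_solution (hn : 2 ≤ n) {c : ℝ} (hc : 0 ≤ c) {p : MvPolynomial (Fin n) ℝ}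
    (hp : wint (fun y : E n => ‖y‖) (polyExt p) = 0) :
    ∃ q : MvPolynomial (Fin n) ℝ, wint (fun y : E n => ‖y‖) (polyExt q) = 0 ∧
      ∀ θ : Sph n, c * polyExt q θ - lap (fun y : E n => ‖y‖) (polyExt q) θ = polyExt p θ := by
  set h0 : E n → ℝ := fun y => ‖y‖
  have hh0 : IsPotential h0 := isPotential_norm
  have hext0 : ∀ p : MvPolynomial (Fin n) ℝ, SmoothOff 0 (polyExt p) := fun p =>
    (polyExt_smooth p).of_le (by simp)
  let e : MvPolynomial (Fin n) ℝ →ₗ[ℝ] (Sph n → ℝ) :=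
    { toFun := fun p θ => polyExt p θ
      map_add' := fun p q => by funext θ; exact polyExt_add p q θ
      map_smul' := fun c p => by funext θ; simp [polyExt, smul_eval] }
  let m : MvPolynomial (Fin n) ℝ →ₗ[ℝ] ℝ :=
    { toFun := fun p => wint h0 (polyExt p)
      map_add' := fun p q => by
        rw [← hh0.wint_add (hext0 p) (hext0 q)]
        exact wint_congr fun y _ => polyExt_add p q y
      map_smul' := fun c p => by
        rw [RingHom.id_apply, smul_eq_mul, ← wint_const_mul]
        exact wint_congr fun y _ => by simp [polyExt, smul_eval] }
  let L : MvPolynomial (Fin n) ℝ →ₗ[ℝ] MvPolynomial (Fin n) ℝ :=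
    c • LinearMap.id - polyLapLin n
  have hL : ∀ q, ∀ y, y ≠ 0 → polyExt (L q) y = c * polyExt q y - lap h0 (polyExt q) y := by
    intro q y hy
    rw [lap_polyExt q hy]
    simp [L, polyExt, smul_eval, polyLapLin]
    rfl
  have hlapmean : ∀ q, wint h0 (lap h0 (polyExt q)) = 0 := by
    intro q
    have h1 := hh0.wint_mul_lap (SmoothOff.const 1) (Hom.const 1) (polyExt_smooth q).two
      (polyExt_hom q)
    have h2 : wint h0 (carre h0 (fun _ => 1) (polyExt q)) = 0 := by
      have : carre h0 (fun _ => 1) (polyExt q) = fun _ => 0 := by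
        funext y; simp [carre, dualPd, pd_const]
      rw [this]; simp [wint]
    rw [h2] at h1
    simpa using h1
  let W : Submodule ℝ (MvPolynomial (Fin n) ℝ) :=
    restrictTotalDegree (Fin n) ℝ p.totalDegree ⊓ LinearMap.ker m
  have : FiniteDimensional ℝ W :=
    Submodule.finiteDimensional_of_le (inf_le_left (b := LinearMap.ker m))
  have hLW : ∀ q ∈ W, L q ∈ W := by
    rintro q ⟨hq1, hq2⟩
    refine ⟨Submodule.sub_mem _ (Submodule.smul_mem _ _ hq1) (polyLap_mem hq1), ?_⟩
    change wint h0 (polyExt (L q)) = 0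
    have hq2' : wint h0 (polyExt q) = 0 := hq2
    rw [wint_congr (hL q), hh0.wint_sub ((SmoothOff.const _).mul (hext0 q))
      (hh0.smooth_lap_zero (polyExt_smooth q).two), wint_const_mul, hlapmean, hq2']
    ring
  have hker : ∀ q ∈ W, e (L q) = 0 ↔ e q = 0 := by
    rintro q ⟨_, hq2⟩
    have hq2' : wint h0 (polyExt q) = 0 := hq2
    have hq : SmoothOff 2 (polyExt q) := (polyExt_smooth q).two
    constructor
    · intro h
      have h1 : wint h0 (fun y => polyExt q y * (c * polyExt q y - lap h0 (polyExt q) y)) = 0 := by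
        rw [← wint_congr (f := fun y => polyExt q y * polyExt (L q) y)
          fun y hy => by rw [hL q y hy]]
        have : ∀ θ : Sph n, polyExt (L q) θ = 0 := fun θ => congrFun h θ
        simp [wint, this]
      have h2 : wint h0 (fun y => polyExt q y * (c * polyExt q y - lap h0 (polyExt q) y)) =
          c * wint h0 (fun y => polyExt q y ^ 2) + wint h0 (carre h0 (polyExt q) (polyExt q)) := by
        rw [← neg_neg (wint h0 (carre h0 (polyExt q) (polyExt q))),
          ← hh0.wint_mul_lap (polyExt_smooth q).one (polyExt_hom q) hq (polyExt_hom q),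
          ← sub_eq_add_neg, ← wint_const_mul, ← hh0.wint_sub
            ((SmoothOff.const _).mul ((hext0 q).pow 2)) ((hext0 q).mul (hh0.smooth_lap_zero hq))]
        exact wint_congr fun y _ => by ring
      have h3 : 0 ≤ wint h0 (fun y => polyExt q y ^ 2) := hh0.wint_nonneg fun _ _ => sq_nonneg _
      have h4 : 0 ≤ wint h0 (carre h0 (polyExt q) (polyExt q)) :=
        hh0.wint_nonneg fun _ hy => hh0.carre_self_nonneg hy
      have h5 := mul_nonneg hc h3
      obtain ⟨a, ha⟩ := hh0.eq_const_of_wint_carre_eq_zero hn (polyExt_smooth q).one (polyExt_hom q)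
        (by linarith)
      have h6 : a ^ 2 = 0 ∨ IsEmpty (Sph n) := by
        rcases isEmpty_or_nonempty (Sph n) with hE | ⟨⟨θ⟩⟩
        · exact Or.inr hE
        · left
          have h7 : wint h0 (fun y => polyExt q y ^ 2) = 0 := by
            rw [wint_congr (g := fun y => a * polyExt q y)
              fun y hy => by rw [ha y hy]; ring, wint_const_mul, hq2', mul_zero]
          have := hh0.eq_zero_of_wint_eq_zero ((hext0 q).pow 2) (fun _ _ => sq_nonneg _) h7 θ
          rwa [ha θ (sph_ne_zero θ)] at this
      funext θ
      rcases h6 with h6 | h6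
      · change polyExt q θ = 0
        rw [ha θ (sph_ne_zero θ)]
        exact pow_eq_zero_iff (two_ne_zero) |>.1 h6
      · exact (h6.false θ).elim
    · intro h
      have h1 : ∀ y, y ≠ 0 → polyExt q y = 0 := by
        intro y hy
        obtain ⟨θ, hθ⟩ := (polyExt_hom q).eq_sph hy
        rw [hθ, show polyExt q θ = 0 from congrFun h θ, mul_zero]
      funext θ
      change polyExt (L q) θ = 0
      have h2 : ∀ j, ∀ y, y ≠ 0 → pd j (polyExt q) y = 0 := fun j y hy => by
        rw [pd_congr h1 j hy, pd_const]
      have h3 : ∀ j, ∀ y, y ≠ 0 → pd j (pd j (polyExt q)) y = 0 := fun j y hy => by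
        rw [pd_congr (h2 j) j hy, pd_const]
      rw [hL q θ (sph_ne_zero θ), h1 θ (sph_ne_zero θ), lap_norm]
      simp [h3 _ _ (sph_ne_zero θ)]
  obtain ⟨q, hqW, hq⟩ := exists_apply_eq_of_ker_eq W L e hLW hker
    (p := p) ⟨(mem_restrictTotalDegree _ _ _).2 le_rfl, hp⟩
  refine ⟨q, hqW.2, fun θ => ?_⟩
  rw [← hL q θ (sph_ne_zero θ)]
  exact congrFun hq θ

/-- On the round sphere, `c - Δ` has dense range in the functions of mean zero. -/
theorem dense_round (hn : 2 ≤ n) {c : ℝ} (hc : 0 ≤ c) {w : E n → ℝ} (hw : SmoothOff 0 w)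
    (hw0 : wint (fun y : E n => ‖y‖) w = 0) {ε : ℝ} (hε : 0 < ε) :
    ∃ u : E n → ℝ, SmoothOff ∞ u ∧ Hom 0 u ∧ wint (fun y : E n => ‖y‖) u = 0 ∧
      wint (fun y : E n => ‖y‖)
        (fun y => (w y - (c * u y - lap (fun y : E n => ‖y‖) u y)) ^ 2) < ε := by
  set h0 : E n → ℝ := fun y => ‖y‖
  have hh0 : IsPotential h0 := isPotential_norm
  set M := wint h0 fun _ => 1
  have hM : 0 ≤ M := hh0.wint_nonneg fun _ _ => zero_le_one
  have hext0 : ∀ p : MvPolynomial (Fin n) ℝ, SmoothOff 0 (polyExt p) := fun p =>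
    (polyExt_smooth p).of_le (by simp)
  obtain ⟨δ, hδ, hδε⟩ : ∃ δ > 0, 4 * δ ^ 2 * M < ε := by
    refine ⟨Real.sqrt (ε / (8 * (M + 1))), Real.sqrt_pos.2 (by positivity), ?_⟩
    rw [Real.sq_sqrt (by positivity)]
    have : 4 * (ε / (8 * (M + 1))) * M = ε * (M / (2 * (M + 1))) := by field_simp; ring
    rw [this]
    have : M / (2 * (M + 1)) < 1 := by rw [div_lt_one (by linarith)]; linarith
    nlinarith
  obtain ⟨p, hp⟩ := exists_polyExt_near hw hδ
  have hpw : |wint h0 (polyExt p)| ≤ δ * M := by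
    have h1 : wint h0 (polyExt p) = ∫ θ : Sph n, weight h0 θ * (polyExt p θ - w θ) ∂sph n := by
      have := hh0.wint_sub (hext0 p) hw
      rw [hw0, sub_zero] at this
      exact this.symm
    rw [h1]
    refine (abs_integral_le_integral_abs).trans ?_
    rw [← wint_const_mul]
    refine integral_mono ((hh0.integrable_weight_mul ((hext0 p).sub hw)).abs)
      (hh0.integrable_weight_mul ((SmoothOff.const _).mul (SmoothOff.const _))) fun θ => ?_
    have hwt := hh0.weight_pos (sph_ne_zero θ)
    simp only [abs_mul, abs_of_pos hwt, mul_one]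
    exact mul_le_mul_of_nonneg_left (hp θ).le hwt.le
  -- correct the polynomial by its mean
  obtain ⟨a, ha, haδ⟩ : ∃ a : ℝ, wint h0 (polyExt p) = a * M ∧ |a| ≤ δ := by
    rcases hM.eq_or_lt with h | h
    · refine ⟨0, ?_, by simpa using hδ.le⟩
      rw [← h, mul_zero] at hpw
      rw [zero_mul]; exact abs_nonpos_iff.1 hpw
    · refine ⟨wint h0 (polyExt p) / M, by field_simp, ?_⟩
      rw [abs_div, abs_of_pos h, div_le_iff₀ h]; exact hpw
  have hpa : ∀ y, polyExt (p - MvPolynomial.C a) y = polyExt p y - a := fun y => by simp [polyExt]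
  have hmean : wint h0 (polyExt (p - MvPolynomial.C a)) = 0 := by
    rw [wint_congr fun y _ => hpa y, hh0.wint_sub (hext0 p) (SmoothOff.const a)]
    have : wint h0 (fun _ => a) = a * M := by rw [← wint_const_mul]; simp
    rw [this, ha, sub_self]
  obtain ⟨q, hq0, hq⟩ := exists_poly_solution hn hc hmean
  refine ⟨polyExt q, polyExt_smooth q, polyExt_hom q, hq0, lt_of_le_of_lt ?_ hδε⟩
  rw [← wint_const_mul]
  refine integral_mono (hh0.integrable_weight_mul ((hw.sub (((SmoothOff.const _).mul
    (hext0 q)).sub (hh0.smooth_lap_zero (polyExt_smooth q).two))).pow 2))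
    (hh0.integrable_weight_mul ((SmoothOff.const _).mul (SmoothOff.const _))) fun θ => ?_
  refine mul_le_mul_of_nonneg_left ?_ (hh0.weight_pos (sph_ne_zero θ)).le
  beta_reduce
  rw [hq θ, hpa, mul_one]
  have h1 := abs_lt.1 (hp θ)
  have h2 := abs_le.1 haδ
  nlinarith

end Solve

/-! ### Density of the range for general potentials -/

section Trace

open Matrix
open scoped MatrixOrder Matrix.Norms.L2Operator

theorem trace_mul_nonneg {A B : Matrix (Fin n) (Fin n) ℝ} (hA : A.PosSemidef)
    (hB : B.PosSemidef) : 0 ≤ (A * B).trace := by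
  obtain ⟨C, rfl⟩ := CStarAlgebra.nonneg_iff_eq_star_mul_self.1 hB.nonneg
  have h1 := (hA.mul_mul_conjTranspose_same C).trace_nonneg
  rw [trace_mul_comm, ← mul_assoc, trace_mul_comm] at h1
  exact h1

theorem trace_mul_mul_mul_ge {A H : Matrix (Fin n) (Fin n) ℝ} {m : ℝ} (hm : 0 ≤ m)
    (hA : (A - m • 1).PosSemidef) (hA' : A.PosSemidef) (hH : Hᵀ = H) :
    m ^ 2 * (H * H).trace ≤ (A * H * A * H).trace := by
  have h1 := trace_mul_nonneg hA (hA'.mul_mul_conjTranspose_same H)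
  have h2 := trace_mul_nonneg hA (PosSemidef.one.mul_mul_conjTranspose_same H)
  have hH' : Hᴴ = H := by rw [conjTranspose_eq_transpose_of_trivial, hH]
  rw [hH', sub_mul, trace_sub, smul_mul_assoc, one_mul, trace_smul, smul_eq_mul] at h1 h2
  rw [mul_one] at h2
  have e1 : (A * (H * A * H)).trace = (A * H * A * H).trace := by simp only [mul_assoc]
  have e2 : (H * A * H).trace = (A * (H * H)).trace := by
    rw [mul_assoc, trace_mul_comm, mul_assoc]
  rw [e1, e2] at h1
  nlinarith

end Trace

section Path

variable {h u : E n → ℝ} (hh : IsPotential h) {y : E n}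

theorem lap_add_const (hu : SmoothOff 2 u) (a : ℝ) (hy : y ≠ 0) :
    lap h (fun y => u y + a) y = lap h u y := by
  have hu1 : SmoothOff 1 u := hu.of_le (by norm_num)
  have h1 : ∀ j, ∀ y, y ≠ 0 → pd j (fun y => u y + a) y = pd j u y := fun j y hy => by
    rw [pd_add j hu1 (SmoothOff.const a) hy, pd_const, add_zero]
  simp only [lap, dualPd]
  congr 1
  exact Finset.sum_congr rfl fun j _ => Finset.sum_congr rfl fun i _ => by
    rw [pd_congr (h1 j) i hy]

theorem lap_congr_potential {k : E n → ℝ} (hk : ∀ y, y ≠ 0 → k y = h y) (hy : y ≠ 0) :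
    lap k u y = lap h u y := by
  have h1 : hessSq k y = hessSq h y := by
    ext i j
    have e1 : ∀ z, z ≠ 0 → k z ^ 2 / 2 = h z ^ 2 / 2 := fun z hz => by rw [hk z hz]
    exact pd_congr (fun z hz => pd_congr e1 j hz) i hy
  simp only [lap, dualPd, hessInv, h1, hk y hy]

theorem lap_add {v : E n → ℝ} (hu : SmoothOff 2 u) (hv : SmoothOff 2 v) (hy : y ≠ 0) :
    lap h (fun y => u y + v y) y = lap h u y + lap h v y := by
  have h1 : ∀ j, ∀ y, y ≠ 0 → pd j (fun y => u y + v y) y = pd j u y + pd j v y :=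
    fun j y hy => pd_add j (hu.of_le (by norm_num)) (hv.of_le (by norm_num)) hy
  simp only [lap, dualPd, ← mul_add, ← Finset.sum_add_distrib]
  congr 1
  exact Finset.sum_congr rfl fun j _ => Finset.sum_congr rfl fun i _ => by
    rw [pd_congr (h1 j) i hy, pd_add i (hu.pd_one j) (hv.pd_one j) hy]

theorem lap_const_mul (c : ℝ) (y : E n) : lap h (fun y => c * u y) y = c * lap h u y := by
  have h1 : ∀ j, pd j (fun y => c * u y) = fun y => c * pd j u y :=
    fun j => funext fun y => pd_const_mul j c
  simp only [lap, h1, dualPd_const_mul, ← Finset.mul_sum]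
  ring

/-- The coefficients of the operator `lap (segment h t)` on the sphere. -/
def segCoeff (h : E n → ℝ) (p : Icc (0 : ℝ) 1 × Sph n) : Fin n → Fin n → ℝ := fun j i =>
  segment h p.1 p.2 ^ 2 * hessInv (segment h p.1) p.2 j i

include hh in
theorem IsPotential.continuous_segment :
    Continuous fun p : Icc (0 : ℝ) 1 × Sph n => CentroAffine.segment h p.1 p.2 := by
  have h1 : Continuous fun p : Icc (0 : ℝ) 1 × Sph n => h p.2 :=
    hh.smooth.continuous_sph.comp continuous_snd
  have h0 : Continuous fun p : Icc (0 : ℝ) 1 × Sph n => (p.1 : ℝ) :=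
    continuous_subtype_val.comp continuous_fst
  have h2 : Continuous fun p : Icc (0 : ℝ) 1 × Sph n => ‖(p.2 : E n)‖ :=
    (continuous_subtype_val.comp continuous_snd).norm
  exact (((continuous_const.sub h0).mul (h2.pow 2)).add (h0.mul (h1.pow 2))).sqrt

include hh in
theorem IsPotential.continuous_hessSq_segment :
    Continuous fun p : Icc (0 : ℝ) 1 × Sph n => hessSq (CentroAffine.segment h p.1) p.2 := by
  refine continuous_matrix fun i j => ?_
  have h1 : Continuous fun p : Icc (0 : ℝ) 1 × Sph n => hessSq h p.2 i j :=
    (hh.smooth_hessSq i j).continuous_sph.comp continuous_snd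
  have h2 : ∀ p : Icc (0 : ℝ) 1 × Sph n, hessSq (CentroAffine.segment h p.1) p.2 i j =
      (1 - (p.1 : ℝ)) * (1 : Matrix (Fin n) (Fin n) ℝ) i j + p.1 * hessSq h p.2 i j := by
    intro p
    rw [hh.hessSq_segment p.1.2 (sph_ne_zero p.2)]
    simp
  simp only [h2]
  fun_prop

include hh in
theorem IsPotential.continuous_det_segment :
    Continuous fun p : Icc (0 : ℝ) 1 × Sph n => (hessSq (CentroAffine.segment h p.1) p.2).det :=
  hh.continuous_hessSq_segment.matrix_det

include hh in
theorem IsPotential.continuous_segCoeff : Continuous (segCoeff h) := by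
  refine continuous_pi fun j => continuous_pi fun i => ?_
  unfold segCoeff
  refine (hh.continuous_segment.pow 2).mul ?_
  simp only [hessInv, Matrix.inv_def, Matrix.smul_apply, Ring.inverse_eq_inv, smul_eq_mul]
  refine (hh.continuous_det_segment.inv₀ fun p =>
    ((hh.segment p.1.2).det_pos (sph_ne_zero p.2)).ne').mul ?_
  exact hh.continuous_hessSq_segment.matrix_adjugate.matrix_elem j i

include hh in
theorem IsPotential.exists_weight_segment_bounds :
    ∃ a > 0, ∃ b > 0, ∀ (t : Icc (0 : ℝ) 1) (θ : Sph n),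
      a ≤ weight (CentroAffine.segment h t) θ ∧ weight (CentroAffine.segment h t) θ ≤ b := by
  rcases isEmpty_or_nonempty (Sph n) with hE | hE
  · exact ⟨1, one_pos, 1, one_pos, fun _ θ => (hE.false θ).elim⟩
  have hc : Continuous fun p : Icc (0 : ℝ) 1 × Sph n =>
      weight (CentroAffine.segment h p.1) p.2 := by
    unfold weight
    refine Continuous.mul ?_ hh.continuous_det_segment
    exact hh.continuous_segment.zpow₀ _ fun p =>
      Or.inl ((hh.segment p.1.2).ne_zero _ (sph_ne_zero p.2))
  obtain ⟨p, -, hp⟩ := isCompact_univ.exists_isMinOn univ_nonempty hc.continuousOn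
  obtain ⟨q, -, hq⟩ := isCompact_univ.exists_isMaxOn univ_nonempty hc.continuousOn
  exact ⟨_, (hh.segment p.1.2).weight_pos (sph_ne_zero p.2), _,
    (hh.segment q.1.2).weight_pos (sph_ne_zero q.2),
    fun t θ => ⟨hp (mem_univ (t, θ)), hq (mem_univ (t, θ))⟩⟩

include hh in
/-- Uniform ellipticity along the segment, by compactness. -/
theorem IsPotential.exists_segCoeff_ge : ∃ m : ℝ, 0 < m ∧ ∀ p : Icc (0 : ℝ) 1 × Sph n,
    (Matrix.of (segCoeff h p) - m • 1).PosSemidef := by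
  rcases isEmpty_or_nonempty (Sph n) with hE | hE
  · exact ⟨1, one_pos, fun p => (hE.false p.2).elim⟩
  let F : (Icc (0 : ℝ) 1 × Sph n) × Sph n → ℝ := fun q =>
    ∑ j, (q.2 : E n) j * ∑ i, segCoeff h q.1 j i * (q.2 : E n) i
  have hF : Continuous F := by
    have h1 : ∀ j i, Continuous fun q : (Icc (0 : ℝ) 1 × Sph n) × Sph n => segCoeff h q.1 j i :=
      fun j i => (continuous_apply i).comp ((continuous_apply j).comp
        (hh.continuous_segCoeff.comp continuous_fst))
    have h2 : ∀ i, Continuous fun q : (Icc (0 : ℝ) 1 × Sph n) × Sph n => (q.2 : E n) i :=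
      fun i => (EuclideanSpace.proj (𝕜 := ℝ) i).continuous.comp
        (continuous_subtype_val.comp continuous_snd)
    exact continuous_finsetSum _ fun j _ => (h2 j).mul
      (continuous_finsetSum _ fun i _ => (h1 j i).mul (h2 i))
  obtain ⟨q, -, hq⟩ := isCompact_univ.exists_isMinOn univ_nonempty hF.continuousOn
  have hsym : ∀ p, (Matrix.of (segCoeff h p)) = CentroAffine.segment h p.1 p.2 ^ 2 •
      hessInv (CentroAffine.segment h p.1) p.2 := fun p => by ext j i; simp [segCoeff]
  have hpd : ∀ p, (Matrix.of (segCoeff h p)).PosDef := fun p => by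
    rw [hsym]
    exact ((hh.segment p.1.2).hessInv_posDef (sph_ne_zero p.2)).smul
      (by have := (hh.segment p.1.2).pos _ (sph_ne_zero p.2); positivity)
  have hFeq : ∀ (p) (v : Sph n), F (p, v) = (fun i => (v : E n) i) ⬝ᵥ
      (Matrix.of (segCoeff h p)).mulVec fun i => (v : E n) i := fun p v => rfl
  have hpos : 0 < F q := by
    rw [← Prod.mk.eta (p := q), hFeq]
    have := (hpd q.1).dotProduct_mulVec_pos (x := fun i => (q.2 : E n) i) (fun h0 => by
      apply sph_ne_zero q.2
      ext i; exact congrFun h0 i)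
    simpa using this
  refine ⟨F q, hpos, fun p => Matrix.PosSemidef.of_dotProduct_mulVec_nonneg ?_ fun x => ?_⟩
  · exact (hpd p).1.sub (by simp [Matrix.IsHermitian])
  · let v : E n := WithLp.toLp 2 x
    rcases eq_or_ne v 0 with hv | hv
    · have : x = 0 := by
        have : WithLp.toLp 2 x = 0 := hv
        simpa using this
      simp [this]
    · have hvn := norm_pos_iff.2 hv
      have h1 := hq (mem_univ (p, (⟨‖v‖⁻¹ • v, by simp [norm_smul, hvn.ne']⟩ : Sph n)))
      simp only [mem_ofPred_eq] at h1
      have h2 : (fun i => (‖v‖⁻¹ • v) i) = ‖v‖⁻¹ • x := by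
        funext i; simp [v]
      have h1' : F q ≤ ‖v‖⁻¹ * (‖v‖⁻¹ * (x ⬝ᵥ (Matrix.of (segCoeff h p)).mulVec x)) := by
        refine h1.trans (le_of_eq ?_)
        rw [hFeq]
        simp only [h2, Matrix.mulVec_smul, smul_dotProduct, dotProduct_smul, smul_eq_mul]
      have h3 : ‖v‖ ^ 2 = x ⬝ᵥ x := by
        rw [norm_sq_eq_sum, dotProduct]
        exact Finset.sum_congr rfl fun i _ => by simp [v, sq]
      rw [star_trivial, Matrix.sub_mulVec, dotProduct_sub, Matrix.smul_mulVec, Matrix.one_mulVec,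
        dotProduct_smul, ← h3, smul_eq_mul]
      have h4 := mul_le_mul_of_nonneg_right h1' (sq_nonneg ‖v‖)
      have h5 : ‖v‖⁻¹ * (‖v‖⁻¹ * (x ⬝ᵥ (Matrix.of (segCoeff h p)).mulVec x)) * ‖v‖ ^ 2 =
          x ⬝ᵥ (Matrix.of (segCoeff h p)).mulVec x := by field_simp
      linarith

theorem lap_segment_eq (t : Icc (0 : ℝ) 1) (θ : Sph n) :
    lap (segment h t) u θ = ∑ j, ∑ i, segCoeff h (t, θ) j i * hess u θ i j := by
  simp only [lap, dualPd, segCoeff, hess, Matrix.of_apply, Finset.mul_sum, mul_assoc]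

include hh in
/-- Energy identity for the operator `c - Δ`. -/
theorem IsPotential.wint_sq_resolvent (hu : SmoothOff ∞ u) (hu0 : Hom 0 u) (c : ℝ) :
    wint h (fun y => (c * u y - lap h u y) ^ 2) = c ^ 2 * wint h (fun y => u y ^ 2) +
      2 * c * wint h (carre h u u) + wint h (fun y => lap h u y ^ 2) := by
  have hu00 : SmoothOff 0 u := hu.of_le (by simp)
  have hl0 : SmoothOff 0 (lap h u) := hh.smooth_lap_zero hu.two
  have h1 := hh.wint_mul_lap hu.one hu0 hu.two hu0
  have h2 : wint h (fun y => (c * u y - lap h u y) ^ 2) =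
      wint h (fun y => c ^ 2 * u y ^ 2 - 2 * c * (u y * lap h u y) + lap h u y ^ 2) :=
    wint_congr fun y _ => by ring
  rw [h2, hh.wint_add (((SmoothOff.const _).mul (hu00.pow 2)).sub
    ((SmoothOff.const _).mul (hu00.mul hl0))) (hl0.pow 2),
    hh.wint_sub ((SmoothOff.const _).mul (hu00.pow 2)) ((SmoothOff.const _).mul (hu00.mul hl0)),
    wint_const_mul, wint_const_mul, h1]
  ring

include hh in
/-- The a priori estimate for second derivatives, a consequence of the Bochner formula. -/
theorem IsPotential.wint_hess_le (hn : 2 ≤ n) (hu : SmoothOff ∞ u) (hu0 : Hom 0 u) {c : ℝ}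
    (hc : 0 < c) :
    wint h (fun y => h y ^ 4 * (hessInv h y * hess u y * hessInv h y * hess u y).trace) ≤
      (1 + 1 / c) * wint h (fun y => (c * u y - lap h u y) ^ 2) := by
  have hl0 : SmoothOff 0 (lap h u) := hh.smooth_lap_zero hu.two
  have htr : SmoothOff 0 fun y =>
      h y ^ 4 * (hessInv h y * hess u y * hessInv h y * hess u y).trace :=
    ((hh.smooth.pow 4).mul (SmoothOff.trace_mul hh.smooth_hessInv
      fun i j => (hu.pd_top j).pd_top i)).of_le (by simp)
  have hcar := hh.smooth_carre_zero hu.one hu.one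
  have h1 := hh.bochner_hess hu hu0
  rw [hh.wint_add ((hl0.pow 2).sub htr) ((SmoothOff.const _).mul hcar),
    hh.wint_sub (hl0.pow 2) htr, wint_const_mul] at h1
  have h2 := hh.wint_sq_resolvent hu hu0 c
  have h3 : 0 ≤ wint h (carre h u u) := hh.wint_nonneg fun _ hy => hh.carre_self_nonneg hy
  have h4 : 0 ≤ wint h (fun y => u y ^ 2) := hh.wint_nonneg fun _ _ => sq_nonneg _
  have h5 : 0 ≤ wint h (fun y => lap h u y ^ 2) := hh.wint_nonneg fun _ _ => sq_nonneg _
  have hn' : (2 : ℝ) ≤ n := by exact_mod_cast hn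
  have h6 : 1 / c * (c ^ 2 * wint h (fun y => u y ^ 2) +
      2 * c * wint h (carre h u u) + wint h (fun y => lap h u y ^ 2)) =
      c * wint h (fun y => u y ^ 2) + 2 * wint h (carre h u u) +
        1 / c * wint h (fun y => lap h u y ^ 2) := by field_simp
  rw [h2, add_mul, h6]
  have h7 : 0 ≤ 1 / c * wint h (fun y => lap h u y ^ 2) := by positivity
  have h8 : 0 ≤ c * wint h (fun y => u y ^ 2) := by positivity
  have h9 : 0 ≤ c ^ 2 * wint h (fun y => u y ^ 2) := by positivity
  have h10 : 0 ≤ 2 * c * wint h (carre h u u) := by positivity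
  nlinarith

theorem weight_norm (θ : Sph n) : weight (fun y : E n => ‖y‖) θ = 1 := by
  simp [weight, hessSq_norm]

theorem sq_sum_sum_le (a b : Fin n → Fin n → ℝ) {η : ℝ} (hab : ∀ j i, |a j i| ≤ η) :
    (∑ j, ∑ i, a j i * b i j) ^ 2 ≤ (n * η) ^ 2 * ∑ i, ∑ j, b i j * b i j := by
  have h1 : ∑ j, ∑ i, a j i * b i j = ∑ p : Fin n × Fin n, a p.1 p.2 * b p.2 p.1 := by
    rw [Fintype.sum_prod_type]
  have h2 : ∑ i, ∑ j, b i j * b i j = ∑ p : Fin n × Fin n, b p.2 p.1 ^ 2 := by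
    rw [Fintype.sum_prod_type, Finset.sum_comm]
    simp only [sq]
  rw [h1, h2]
  refine (Finset.sum_mul_sq_le_sq_mul_sq _ _ _).trans ?_
  refine mul_le_mul_of_nonneg_right ?_ (Finset.sum_nonneg fun _ _ => sq_nonneg _)
  calc ∑ p : Fin n × Fin n, a p.1 p.2 ^ 2 ≤ ∑ _p : Fin n × Fin n, η ^ 2 :=
        Finset.sum_le_sum fun p _ => sq_le_sq' (by linarith [(abs_le.1 (hab p.1 p.2)).1])
          (abs_le.1 (hab p.1 p.2)).2
    _ = (n * η) ^ 2 := by simp; ring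

include hh in
/-- Along the segment, the operators vary continuously relative to their own size. -/
theorem IsPotential.exists_segment_close (hn : 2 ≤ n) {c : ℝ} (hc : 0 < c) :
    ∃ δ > 0, ∀ s ∈ Icc (0 : ℝ) 1, ∀ t ∈ Icc (0 : ℝ) 1, |s - t| < δ → ∀ u : E n → ℝ,
      SmoothOff ∞ u → Hom 0 u →
      wint (fun y : E n => ‖y‖) (fun y => ((c * u y - lap (CentroAffine.segment h s) u y) -
        (c * u y - lap (CentroAffine.segment h t) u y)) ^ 2) ≤
      1 / 16 * wint (fun y : E n => ‖y‖)
        (fun y => (c * u y - lap (CentroAffine.segment h t) u y) ^ 2) := by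
  obtain ⟨a, ha, b, hb, hab⟩ := hh.exists_weight_segment_bounds
  obtain ⟨m, hm, hmc⟩ := hh.exists_segCoeff_ge
  obtain ⟨η, hη, hηs⟩ : ∃ η > 0, (n * η) ^ 2 / m ^ 2 * (1 + 1 / c) * b / a ≤ 1 / 16 := by
    have hn0 : (0 : ℝ) < n := by exact_mod_cast (by omega : 0 < n)
    let K : ℝ := n ^ 2 / m ^ 2 * (1 + 1 / c) * b / a
    have hK : 0 < K := by positivity
    refine ⟨Real.sqrt (1 / (16 * K)), Real.sqrt_pos.2 (by positivity), ?_⟩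
    rw [mul_pow, Real.sq_sqrt (by positivity)]
    have : (n : ℝ) ^ 2 * (1 / (16 * K)) / m ^ 2 * (1 + 1 / c) * b / a = K * (1 / (16 * K)) := by
      simp only [K]; ring
    rw [this]
    apply le_of_eq
    field_simp
  obtain ⟨δ, hδ, hδ'⟩ := Metric.uniformContinuous_iff.1
    (CompactSpace.uniformContinuous_of_continuous hh.continuous_segCoeff) η hη
  refine ⟨δ, hδ, fun s hs t ht hst u hu hu0 => ?_⟩
  set k := CentroAffine.segment h t with hk
  have hkp : IsPotential k := hh.segment ht
  have hkp' : IsPotential (CentroAffine.segment h s) := hh.segment hs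
  have hu00 : SmoothOff 0 u := hu.of_le (by simp)
  have hl0 : SmoothOff 0 (lap k u) := hkp.smooth_lap_zero hu.two
  have hl0' : SmoothOff 0 (lap (CentroAffine.segment h s) u) := hkp'.smooth_lap_zero hu.two
  have htr : SmoothOff 0 fun y =>
      k y ^ 4 * (hessInv k y * hess u y * hessInv k y * hess u y).trace :=
    ((hkp.smooth.pow 4).mul (SmoothOff.trace_mul hkp.smooth_hessInv
      fun i j => (hu.pd_top j).pd_top i)).of_le (by simp)
  -- pointwise bound of the difference by the Hessian
  have hpt : ∀ θ : Sph n, ((c * u θ - lap (CentroAffine.segment h s) u θ) -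
      (c * u θ - lap k u θ)) ^ 2 ≤ (n * η) ^ 2 / m ^ 2 *
      (k θ ^ 4 * (hessInv k θ * hess u θ * hessInv k θ * hess u θ).trace) := by
    intro θ
    have hd : dist (⟨t, ht⟩, θ) ((⟨s, hs⟩ : Icc (0 : ℝ) 1), θ) < δ := by
      rw [Prod.dist_eq, dist_self, max_eq_left dist_nonneg, Subtype.dist_eq, dist_comm]
      exact hst
    have hη' := hδ' hd
    have e1 : (c * u θ - lap (CentroAffine.segment h s) u θ) - (c * u θ - lap k u θ) =
        ∑ j, ∑ i, (segCoeff h (⟨t, ht⟩, θ) j i - segCoeff h (⟨s, hs⟩, θ) j i) * hess u θ i j := by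
      have l1 := lap_segment_eq (h := h) (u := u) ⟨t, ht⟩ θ
      have l2 := lap_segment_eq (h := h) (u := u) ⟨s, hs⟩ θ
      simp only [← hk] at l1 l2
      rw [l1, l2]
      simp only [sub_mul, Finset.sum_sub_distrib]
      ring
    have hcoef : ∀ j i, |segCoeff h (⟨t, ht⟩, θ) j i - segCoeff h (⟨s, hs⟩, θ) j i| ≤ η := by
      intro j i
      have h1 := (dist_le_pi_dist (segCoeff h (⟨t, ht⟩, θ)) (segCoeff h (⟨s, hs⟩, θ)) j)
      have h2 := (dist_le_pi_dist (segCoeff h (⟨t, ht⟩, θ) j) (segCoeff h (⟨s, hs⟩, θ) j) i)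
      rw [Real.dist_eq] at h2
      linarith
    rw [e1]
    refine (sq_sum_sum_le _ _ hcoef).trans ?_
    have hsym := hess_transpose hu.two (sph_ne_zero θ)
    have e2 : ∑ i, ∑ j, hess u θ i j * hess u θ i j = (hess u θ * hess u θ).trace := by
      simp only [Matrix.trace, Matrix.diag, Matrix.mul_apply]
      refine Finset.sum_congr rfl fun i _ => Finset.sum_congr rfl fun j _ => ?_
      conv_lhs => rw [← hsym]
      simp only [Matrix.transpose_apply]
      have : hess u θ j i = hess u θ i j := by
        conv_lhs => rw [← hsym]
        rfl
      rw [this]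
    have hA : Matrix.of (segCoeff h (⟨t, ht⟩, θ)) = k θ ^ 2 • hessInv k θ := by
      ext j i; simp [segCoeff, hk]
    have h3 := hmc (⟨t, ht⟩, θ)
    have h3' : (Matrix.of (segCoeff h (⟨t, ht⟩, θ))).PosSemidef := by
      rw [hA]
      exact (hkp.hessInv_posDef (sph_ne_zero θ)).posSemidef.smul (sq_nonneg _)
    have h4 := trace_mul_mul_mul_ge hm.le h3 h3' hsym
    have e3 : (Matrix.of (segCoeff h (⟨t, ht⟩, θ)) * hess u θ *
        Matrix.of (segCoeff h (⟨t, ht⟩, θ)) * hess u θ).trace =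
        k θ ^ 4 * (hessInv k θ * hess u θ * hessInv k θ * hess u θ).trace := by
      rw [hA]
      simp only [smul_mul_assoc, mul_smul_comm, smul_smul, Matrix.trace_smul, smul_eq_mul]
      ring
    rw [e2, div_mul_eq_mul_div, le_div_iff₀ (by positivity), ← e3, mul_assoc]
    refine mul_le_mul_of_nonneg_left ?_ (sq_nonneg _)
    rw [mul_comm]; exact h4
  -- comparison of the measures
  have hcmp1 : ∀ f : E n → ℝ, SmoothOff 0 f → (∀ y, y ≠ 0 → 0 ≤ f y) →
      a * wint (fun y : E n => ‖y‖) f ≤ wint k f := by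
    intro f hf hf0
    rw [← wint_const_mul]
    refine integral_mono (isPotential_norm.integrable_weight_mul ((SmoothOff.const _).mul hf))
      (hkp.integrable_weight_mul hf) fun θ => ?_
    simp only [weight_norm, one_mul]
    exact mul_le_mul_of_nonneg_right (hab ⟨t, ht⟩ θ).1 (hf0 θ (sph_ne_zero θ))
  have hcmp2 : ∀ f : E n → ℝ, SmoothOff 0 f → (∀ y, y ≠ 0 → 0 ≤ f y) →
      wint k f ≤ b * wint (fun y : E n => ‖y‖) f := by
    intro f hf hf0
    rw [← wint_const_mul]
    refine integral_mono (hkp.integrable_weight_mul hf)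
      (isPotential_norm.integrable_weight_mul ((SmoothOff.const _).mul hf)) fun θ => ?_
    simp only [weight_norm, one_mul]
    exact mul_le_mul_of_nonneg_right (hab ⟨t, ht⟩ θ).2 (hf0 θ (sph_ne_zero θ))
  have hdiff : SmoothOff 0 fun y => ((c * u y - lap (CentroAffine.segment h s) u y) -
      (c * u y - lap k u y)) ^ 2 :=
    ((((SmoothOff.const c).mul hu00).sub hl0').sub (((SmoothOff.const c).mul hu00).sub hl0)).pow 2
  have h1 := hcmp1 _ hdiff fun _ _ => sq_nonneg _
  have h2 : wint k (fun y => ((c * u y - lap (CentroAffine.segment h s) u y) -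
      (c * u y - lap k u y)) ^ 2) ≤ (n * η) ^ 2 / m ^ 2 *
      wint k (fun y => k y ^ 4 * (hessInv k y * hess u y * hessInv k y * hess u y).trace) := by
    rw [← wint_const_mul]
    refine integral_mono (hkp.integrable_weight_mul hdiff)
      (hkp.integrable_weight_mul ((SmoothOff.const _).mul htr)) fun θ => ?_
    exact mul_le_mul_of_nonneg_left (hpt θ) (hkp.weight_pos (sph_ne_zero θ)).le
  have h3 := hkp.wint_hess_le hn hu hu0 hc
  have h4 := hcmp2 (fun y => (c * u y - lap k u y) ^ 2)
    ((((SmoothOff.const c).mul hu00).sub hl0).pow 2) fun _ _ => sq_nonneg _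
  set X := wint (fun y : E n => ‖y‖) (fun y => ((c * u y - lap (CentroAffine.segment h s) u y) -
      (c * u y - lap k u y)) ^ 2)
  set Y := wint (fun y : E n => ‖y‖) (fun y => (c * u y - lap k u y) ^ 2)
  have hY : 0 ≤ Y := isPotential_norm.wint_nonneg fun _ _ => sq_nonneg _
  have h5 : a * X ≤ (n * η) ^ 2 / m ^ 2 * ((1 + 1 / c) * (b * Y)) :=
    h1.trans (h2.trans (mul_le_mul_of_nonneg_left
      (h3.trans (mul_le_mul_of_nonneg_left h4 (by positivity))) (by positivity)))
  have h6 : X ≤ ((n * η) ^ 2 / m ^ 2 * (1 + 1 / c) * b / a) * Y := by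
    rw [div_mul_eq_mul_div, le_div_iff₀ ha]
    linarith
  exact h6.trans (mul_le_mul_of_nonneg_right hηs hY)

include hh in
theorem IsPotential.wint_sq_sub_le {f g : E n → ℝ} (hf : SmoothOff 0 f) (hg : SmoothOff 0 g) :
    wint h (fun y => (f y - g y) ^ 2) ≤
      2 * wint h (fun y => f y ^ 2) + 2 * wint h (fun y => g y ^ 2) := by
  rw [← wint_const_mul, ← wint_const_mul, ← hh.wint_add ((SmoothOff.const _).mul (hf.pow 2))
    ((SmoothOff.const _).mul (hg.pow 2))]
  exact hh.wint_mono ((hf.sub hg).pow 2) (((SmoothOff.const _).mul (hf.pow 2)).add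
    ((SmoothOff.const _).mul (hg.pow 2))) fun y _ => by nlinarith [sq_nonneg (f y + g y)]

/-- Continuous functions off the origin. -/
def contOff (n : ℕ) : AddSubgroup (E n → ℝ) where
  carrier := {f | SmoothOff 0 f}
  zero_mem' := SmoothOff.const 0
  add_mem' hf hg := SmoothOff.add hf hg
  neg_mem' hf := SmoothOff.neg hf

/-- Smooth `0`-homogeneous functions off the origin. -/
def smoothHom (n : ℕ) : AddSubgroup (E n → ℝ) where
  carrier := {f | SmoothOff ∞ f ∧ Hom 0 f}
  zero_mem' := ⟨SmoothOff.const 0, Hom.const 0⟩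
  add_mem' hf hg := ⟨hf.1.add hg.1, hf.2.add hg.2⟩
  neg_mem' hf := ⟨hf.1.neg, (hf.2.const_mul (-1)).congr fun y _ => by simp⟩

include hh in
/-- For `c > 0` the range of `c - Δ` on smooth functions is dense, in `L²` with respect to the
surface measure, which does not change along the segment. -/
theorem IsPotential.dense_round_measure (hn : 2 ≤ n) {c : ℝ} (hc : 0 < c) {w : E n → ℝ}
    (hw : SmoothOff 0 w) {ε : ℝ} (hε : 0 < ε) :
    ∃ u : E n → ℝ, SmoothOff ∞ u ∧ Hom 0 u ∧
      wint (fun y : E n => ‖y‖) (fun y => (w y - (c * u y - lap h u y)) ^ 2) < ε := by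
  obtain ⟨δ, hδ, hclose⟩ := hh.exists_segment_close hn hc
  have h01 : (0 : ℝ) ∈ Icc (0 : ℝ) 1 := ⟨le_rfl, zero_le_one⟩
  have h11 : (1 : ℝ) ∈ Icc (0 : ℝ) 1 := ⟨zero_le_one, le_rfl⟩
  have hseg0 : ∀ y : E n, y ≠ 0 → CentroAffine.segment h 0 y = ‖y‖ := fun y _ => by
    simp [CentroAffine.segment]
  have hseg1 : ∀ y : E n, y ≠ 0 → CentroAffine.segment h 1 y = h y := fun y hy => by
    simp [CentroAffine.segment, Real.sqrt_sq (hh.pos y hy).le]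
  have hr : IsPotential fun y : E n => ‖y‖ := isPotential_norm
  let q : (E n → ℝ) → ℝ := fun f => wint (fun y : E n => ‖y‖) fun y => f y ^ 2
  -- the value at the origin is irrelevant; it is set to `0` to make the operators additive
  let T : ℝ → (E n → ℝ) → E n → ℝ := fun t u y =>
    if y = 0 then 0 else c * u y - lap (CentroAffine.segment h t) u y
  have hTy : ∀ t u y, y ≠ 0 → T t u y = c * u y - lap (CentroAffine.segment h t) u y :=
    fun t u y hy => if_neg hy
  have key : ∀ w ∈ contOff n, ∀ ε > 0, ∃ u ∈ smoothHom n, q (w - T 1 u) < ε := by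
    refine dense_of_path (q := q) (T := T) (fun a _ => hr.wint_nonneg fun _ _ => sq_nonneg _)
      (fun a ha b hb => hr.wint_sq_sub_le ha hb) (fun t ht u hu => ?_) (fun t ht u hu v hv => ?_)
      hδ (fun s hs t ht hst u hu => ?_) (fun w hw ε hε => ?_)
    · exact (((SmoothOff.const c).mul (hu.1.of_le (by simp))).sub
        ((hh.segment ht).smooth_lap_zero hu.1.two)).congr fun y hy => hTy t u y hy
    · funext y
      rcases eq_or_ne y 0 with hy | hy
      · simp [T, hy]
      · have h1 := lap_add (h := CentroAffine.segment h t) hu.1.two hv.1.two hy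
        have h2 : lap (CentroAffine.segment h t) (u + v) y = _ := h1
        simp only [Pi.add_apply]
        rw [hTy t _ y hy, hTy t u y hy, hTy t v y hy, h2, Pi.add_apply]
        ring
    · have h1 := hclose s hs t ht hst u hu.1 hu.2
      refine le_trans (le_of_eq ?_) (h1.trans (le_of_eq ?_))
      · exact wint_congr fun y hy => by rw [Pi.sub_apply, hTy s u y hy, hTy t u y hy]
      · congr 1
        exact wint_congr fun y hy => by rw [hTy t u y hy]
    · have hn0 : n ≠ 0 := by omega
      have : Nontrivial (E n) := by
        have : Nonempty (Fin n) := ⟨⟨0, by omega⟩⟩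
        infer_instance
      have hM : 0 < wint (fun y : E n => ‖y‖) fun _ => 1 := by
        refine lt_of_le_of_ne (hr.wint_nonneg fun _ _ => zero_le_one) fun h0 => ?_
        have h1 : (sph n) univ = 0 := by
          have : wint (fun y : E n => ‖y‖) (fun _ => 1) = (sph n).real univ := by
            simp [wint, weight_norm]
          rw [this] at h0
          exact (measureReal_eq_zero_iff (by exact measure_ne_top _ _)).1 h0.symm
        exact Measure.measure_univ_ne_zero.2 (by
          have := Measure.toSphere_ne_zero (volume : Measure (E n))
          exact this) h1
      set M := wint (fun y : E n => ‖y‖) fun _ => 1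
      set a := wint (fun y : E n => ‖y‖) w / M
      have hw0 : wint (fun y : E n => ‖y‖) (fun y => w y - a * 1) = 0 := by
        rw [hr.wint_sub hw (SmoothOff.const _), wint_const_mul]
        simp only [a]
        rw [div_mul_cancel₀ _ hM.ne', sub_self]
      obtain ⟨u, hu, hu0, -, hlt⟩ := dense_round hn hc.le (hw.sub (SmoothOff.const (a * 1))) hw0 hε
      -- the mean value `a` of `w` is the image of the constant `a / c`
      refine ⟨fun y => u y + a / c, ⟨hu.add (SmoothOff.const _), hu0.add (Hom.const _)⟩, ?_⟩
      refine lt_of_eq_of_lt (wint_congr fun y hy => ?_) hlt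
      rw [Pi.sub_apply, hTy 0 (fun y => u y + a / c) y hy, lap_congr_potential hseg0 hy,
        lap_add_const hu.two _ hy]
      field_simp
      ring
  obtain ⟨u, hu, hlt⟩ := key w hw ε hε
  refine ⟨u, hu.1, hu.2, lt_of_eq_of_lt (wint_congr fun y hy => ?_) hlt⟩
  rw [Pi.sub_apply, hTy 1 u y hy, lap_congr_potential hseg1 hy]

end Path

/-! ### Spectral gaps and dense ranges on functions of given parity -/

section Parity

variable {h f g u v w : E n → ℝ} (hh : IsPotential h) {y : E n}

theorem integral_sph_neg (hn : n ≠ 0) (f : E n → ℝ) :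
    ∫ θ : Sph n, f (-(θ : E n)) ∂sph n = ∫ θ : Sph n, f θ ∂sph n := by
  have : NeZero n := ⟨hn⟩
  have h0 : Hom 0 fun y : E n => f (‖y‖⁻¹ • y) := by
    intro t ht y hy
    simp only [zpow_zero, one_mul, norm_smul, Real.norm_of_nonneg ht.le, smul_smul]
    congr 2
    field_simp
  have h1 := integral_sph_comp_neg h0
  simpa using h1

include hh in
theorem IsPotential.hessSq_neg (y : E n) : hessSq h (-y) = hessSq h y := by
  have e1 : (fun y => h y ^ 2 / 2) = fun y => h (-y) ^ 2 / 2 := funext fun y => by rw [hh.even]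
  ext i j
  have h1 : ∀ y, pd j (fun y => h y ^ 2 / 2) y = -pd j (fun y => h y ^ 2 / 2) (-y) := fun y => by
    conv_lhs => rw [e1]
    exact pd_comp_neg (f := fun y => h y ^ 2 / 2) j
  have h2 : pd j (fun y => h y ^ 2 / 2) = fun y => -pd j (fun y => h y ^ 2 / 2) (-y) := funext h1
  have h3 : pd i (pd j fun y => h y ^ 2 / 2) y = pd i (pd j fun y => h y ^ 2 / 2) (-y) := by
    conv_lhs => rw [h2, pd_neg, pd_comp_neg, neg_neg]
  exact h3.symm

include hh in
theorem IsPotential.weight_neg (y : E n) : weight h (-y) = weight h y := by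
  simp only [weight, hh.even, hh.hessSq_neg]

include hh in
theorem IsPotential.wint_comp_neg (hn : n ≠ 0) (f : E n → ℝ) :
    wint h (fun y => f (-y)) = wint h f := by
  have := integral_sph_neg hn fun y => weight h y * f y
  simp only [hh.weight_neg] at this
  exact this

include hh in
theorem IsPotential.lap_comp_neg (u : E n → ℝ) (y : E n) :
    lap h (fun y => u (-y)) y = lap h u (-y) := by
  have h1 : ∀ j, pd j (fun y => u (-y)) = fun y => -pd j u (-y) := fun j =>
    funext fun y => pd_comp_neg j
  have h2 : ∀ i j, pd i (pd j fun y => u (-y)) y = pd i (pd j u) (-y) := fun i j => by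
    rw [h1, pd_neg, pd_comp_neg, neg_neg]
  simp only [lap, dualPd, h2, hh.even, hessInv, hh.hessSq_neg]

include hh in
theorem IsPotential.wint_lap (hu : SmoothOff 2 u) (hu0 : Hom 0 u) : wint h (lap h u) = 0 := by
  have h1 := hh.wint_mul_lap (SmoothOff.const 1) (Hom.const 1) hu hu0
  have h2 : wint h (carre h (fun _ => 1) u) = 0 := by
    have : ∀ y, carre h (fun _ => (1 : ℝ)) u y = 0 := fun y => by
      simp [carre, dualPd, pd_const]
    simp [wint, this]
  simpa [h2] using h1

/-- Continuous functions off the origin, of parity `s` and of mean zero. -/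
def IsPotential.meanZero (hh : IsPotential h) (s : ℝ) : AddSubgroup (E n → ℝ) where
  carrier := {f | SmoothOff 0 f ∧ (∀ y, y ≠ 0 → f (-y) = s * f y) ∧ wint h f = 0}
  zero_mem' := ⟨SmoothOff.const 0, fun _ _ => by simp, by simp [wint]⟩
  add_mem' {f g} hf hg := ⟨hf.1.add hg.1,
    fun y hy => by simp only [Pi.add_apply, hf.2.1 y hy, hg.2.1 y hy, mul_add],
    (hh.wint_add hf.1 hg.1).trans (by rw [hf.2.2, hg.2.2, add_zero])⟩
  neg_mem' {f} hf := ⟨hf.1.neg, fun y hy => by simp only [Pi.neg_apply, hf.2.1 y hy, mul_neg],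
    wint_neg.trans (by rw [hf.2.2, neg_zero])⟩

/-- Smooth `0`-homogeneous functions of parity `s` and of mean zero. -/
def IsPotential.smoothMeanZero (hh : IsPotential h) (s : ℝ) : AddSubgroup (E n → ℝ) :=
  smoothHom n ⊓ hh.meanZero s

theorem IsPotential.smul_sub_lap_mem {s : ℝ} (hu : u ∈ hh.smoothMeanZero s) (c : ℝ) :
    (fun y => c * u y - lap h u y) ∈ hh.meanZero s := by
  obtain ⟨⟨hu, hu0⟩, hu1, hus, hum⟩ := hu
  have hl0 := hh.smooth_lap_zero hu.two
  refine ⟨((SmoothOff.const c).mul hu1).sub hl0, fun y hy => ?_, ?_⟩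
  · have h1 : lap h u (-y) = s * lap h u y := by
      rw [← hh.lap_comp_neg, ← lap_const_mul]
      have e1 : ∀ j z, z ≠ 0 → pd j (fun y => u (-y)) z = pd j (fun y => s * u y) z :=
        fun j z hz => pd_congr hus j hz
      simp only [lap, dualPd]
      congr 1
      exact Finset.sum_congr rfl fun j _ => Finset.sum_congr rfl fun i _ => by
        rw [pd_congr (e1 j) i hy]
    simp only [h1, hus y hy]; ring
  · rw [hh.wint_sub ((SmoothOff.const c).mul hu1) hl0, wint_const_mul, hum,
      hh.wint_lap hu.two hu0]
    ring

include hh in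
theorem IsPotential.wint_one_pos (hn : 2 ≤ n) : 0 < wint h fun _ => 1 := by
  refine lt_of_le_of_ne (hh.wint_nonneg fun _ _ => zero_le_one) fun h0 => ?_
  have h1 : Continuous fun θ : Sph n => weight h θ * 1 :=
    (hh.smooth_weight.continuous_sph).mul continuous_const
  have hpos : ∀ θ : Sph n, 0 < weight h θ * 1 := fun θ => by
    rw [mul_one]; exact hh.weight_pos (sph_ne_zero θ)
  have h2 := (integral_eq_zero_iff_of_nonneg (μ := sph n) (fun θ => (hpos θ).le)
    (hh.integrable_weight_mul (SmoothOff.const 1))).1 h0.symm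
  have : Nontrivial (E n) := by
    have : Nonempty (Fin n) := ⟨⟨0, by omega⟩⟩
    infer_instance
  have h3 : sph n ≠ 0 := Measure.toSphere_ne_zero _
  have h4 : (MeasureTheory.ae (sph n)).NeBot := ae_neBot.2 h3
  obtain ⟨θ, hθ⟩ := h2.exists
  exact (hpos θ).ne' hθ

include hh in
/-- The cone-volume measure and the surface measure are comparable. -/
theorem IsPotential.exists_weight_bounds : ∃ a : ℝ, 0 < a ∧ ∃ b : ℝ, 0 < b ∧
    (∀ f : E n → ℝ, SmoothOff 0 f → (∀ y, y ≠ 0 → 0 ≤ f y) →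
      a * wint (fun y : E n => ‖y‖) f ≤ wint h f) ∧
    (∀ f : E n → ℝ, SmoothOff 0 f → (∀ y, y ≠ 0 → 0 ≤ f y) →
      wint h f ≤ b * wint (fun y : E n => ‖y‖) f) := by
  obtain ⟨a, ha, b, hb, hab⟩ := hh.exists_weight_segment_bounds
  have h11 : (1 : ℝ) ∈ Icc (0 : ℝ) 1 := ⟨zero_le_one, le_rfl⟩
  have hseg1 : ∀ y : E n, y ≠ 0 → CentroAffine.segment h 1 y = h y := fun y hy => by
    simp [CentroAffine.segment, Real.sqrt_sq (hh.pos y hy).le]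
  have hw : ∀ θ : Sph n, weight (CentroAffine.segment h 1) θ = weight h θ := fun θ => by
    simp only [weight, hseg1 _ (sph_ne_zero θ), hh.hessSq_segment h11 (sph_ne_zero θ)]
    simp
  refine ⟨a, ha, b, hb, fun f hf hf0 => ?_, fun f hf hf0 => ?_⟩
  · rw [← wint_const_mul]
    refine integral_mono (isPotential_norm.integrable_weight_mul ((SmoothOff.const _).mul hf))
      (hh.integrable_weight_mul hf) fun θ => ?_
    simp only [weight_norm, one_mul, ← hw]
    exact mul_le_mul_of_nonneg_right (hab ⟨1, h11⟩ θ).1 (hf0 θ (sph_ne_zero θ))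
  · rw [← wint_const_mul]
    refine integral_mono (hh.integrable_weight_mul hf)
      (isPotential_norm.integrable_weight_mul ((SmoothOff.const _).mul hf)) fun θ => ?_
    simp only [weight_norm, one_mul, ← hw]
    exact mul_le_mul_of_nonneg_right (hab ⟨1, h11⟩ θ).2 (hf0 θ (sph_ne_zero θ))

/-- For `c > 0` the range of `c - Δ` on smooth functions of given parity and mean zero is dense. -/
theorem IsPotential.dense_resolvent (hn : 2 ≤ n) {s : ℝ} (hs : s * s = 1) {c : ℝ} (hc : 0 < c)
    (hw : w ∈ hh.meanZero s) {ε : ℝ} (hε : 0 < ε) :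
    ∃ u ∈ hh.smoothMeanZero s, wint h (fun y => (w y - (c * u y - lap h u y)) ^ 2) < ε := by
  obtain ⟨hw0, hws, hwm⟩ := hw
  obtain ⟨_, -, b, hb, -, hcmp⟩ := hh.exists_weight_bounds
  obtain ⟨u, hu, hu0, hlt⟩ := hh.dense_round_measure hn hc hw0 (div_pos hε hb)
  have hn0 : n ≠ 0 := by omega
  have hl0 := hh.smooth_lap_zero hu.two
  have hu00 : SmoothOff 0 u := hu.of_le (by simp)
  -- the error of the approximation, and its projection to the functions of parity `s`
  set F : E n → ℝ := fun y => w y - (c * u y - lap h u y) with hF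
  have hF0 : SmoothOff 0 F := hw0.sub (((SmoothOff.const c).mul hu00).sub hl0)
  have hF1 : wint h (fun y => F y ^ 2) < ε := by
    have := hcmp (fun y => F y ^ 2) (hF0.pow 2) fun _ _ => sq_nonneg _
    refine this.trans_lt ?_
    rw [lt_div_iff₀ hb] at hlt
    linarith
  set v : E n → ℝ := fun y => 1 / 2 * (u y + s * u (-y)) with hv
  have hvs : SmoothOff ∞ v := (SmoothOff.const _).mul (hu.add ((SmoothOff.const s).mul hu.comp_neg))
  have hv0 : Hom 0 v := by
    intro t ht y hy
    simp only [hv, zpow_zero, one_mul, ← smul_neg]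
    have h1 := hu0 t ht y hy
    have h2 := hu0 t ht (-y) (neg_ne_zero.2 hy)
    simp only [zpow_zero, one_mul] at h1 h2
    rw [h1, h2]
  have hv00 : SmoothOff 0 v := hvs.of_le (by simp)
  have hvp : ∀ y, v (-y) = s * v y := fun y => by
    simp only [hv, neg_neg]
    linear_combination (-1 / 2 * u (-y)) * hs
  have hlv : ∀ y, y ≠ 0 → lap h v y = 1 / 2 * (lap h u y + s * lap h u (-y)) := fun y hy => by
    simp only [hv]
    rw [lap_const_mul, lap_add (v := fun y => s * u (-y)) hu.two
      ((SmoothOff.const s).mul hu.comp_neg.two) hy, lap_const_mul, hh.lap_comp_neg]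
  set m := wint h v / wint h fun _ => 1
  have hM := hh.wint_one_pos hn
  have hm : wint h v = m * wint h fun _ => 1 := by simp only [m]; rw [div_mul_cancel₀ _ hM.ne']
  have hms : m = s * m := by
    have h1 := hh.wint_comp_neg hn0 v
    simp only [hvp, wint_const_mul] at h1
    simp only [m]
    rw [← mul_div_assoc, h1]
  set z : E n → ℝ := fun y => v y + -m with hz
  have hFn : SmoothOff 0 fun y => F (-y) := hF0.comp_neg
  have hG : ∀ y, y ≠ 0 →
      w y - (c * z y - lap h z y) = 1 / 2 * (F y + s * F (-y)) + c * m := fun y hy => by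
    have hlz : lap h z y = 1 / 2 * (lap h u y + s * lap h u (-y)) :=
      (lap_add_const hvs.two _ hy).trans (hlv y hy)
    rw [hlz]
    simp only [hz, hF, hws y hy, hv]
    linear_combination (-1 / 2 * w y) * hs
  have hzc : SmoothOff 0 z := hv00.add (SmoothOff.const _)
  have hzm : wint h z = 0 := by
    simp only [hz]
    rw [hh.wint_add hv00 (SmoothOff.const _), hm]
    have := wint_const_mul (h := h) (f := fun _ => 1) (-m)
    simp only [mul_one] at this
    rw [this]; ring
  have hzmem : z ∈ hh.smoothMeanZero s := by
    refine ⟨⟨hvs.add (SmoothOff.const _), hv0.add (Hom.const _)⟩, hzc, fun y _ => ?_, hzm⟩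
    simp only [hz, hvp]
    linear_combination -hms
  refine ⟨z, hzmem, ?_⟩
  have hwint0 : wint h (fun y => w y - (c * z y - lap h z y)) = 0 := by
    have h1 := (hh.smul_sub_lap_mem hzmem c)
    rw [hh.wint_sub hw0 h1.1, hwm, h1.2.2, sub_zero]
  set G : E n → ℝ := fun y => 1 / 2 * (F y + s * F (-y))
  have hGs : SmoothOff 0 G :=
    (SmoothOff.const _).mul (hF0.add ((SmoothOff.const s).mul hFn))
  have hG1 : wint h (fun y => (G y + c * m) ^ 2) ≤ wint h (fun y => G y ^ 2) := by
    have e1 : wint h (fun y => G y + c * m) = 0 := by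
      rw [← hwint0]; exact wint_congr fun y hy => (hG y hy).symm
    have e2 : wint h (fun y => G y ^ 2) = wint h (fun y => (G y + c * m) ^ 2 -
        2 * (c * m) * (G y + c * m) + (c * m) ^ 2 * 1) := wint_congr fun y _ => by ring
    have s1 : SmoothOff 0 fun y => G y + c * m := hGs.add (SmoothOff.const _)
    rw [e2, hh.wint_add ((s1.pow 2).sub ((SmoothOff.const _).mul s1)) (SmoothOff.const _),
      hh.wint_sub (s1.pow 2) ((SmoothOff.const _).mul s1), wint_const_mul, e1, wint_const_mul]
    have := mul_nonneg (sq_nonneg (c * m)) hM.le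
    linarith
  have hG2 : wint h (fun y => G y ^ 2) ≤ wint h (fun y => F y ^ 2) := by
    have e1 : wint h (fun y => F (-y) ^ 2) = wint h (fun y => F y ^ 2) :=
      hh.wint_comp_neg hn0 fun y => F y ^ 2
    have e2 : wint h (fun y => 1 / 2 * (F y ^ 2 + F (-y) ^ 2)) = wint h (fun y => F y ^ 2) := by
      rw [wint_const_mul, hh.wint_add (hF0.pow 2) (hFn.pow 2), e1]; ring
    rw [← e2]
    refine hh.wint_mono (hGs.pow 2)
      ((SmoothOff.const _).mul ((hF0.pow 2).add (hFn.pow 2))) fun y _ => ?_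
    simp only [G]
    nlinarith [sq_nonneg (F y - s * F (-y)), sq_nonneg (F y + s * F (-y)),
      congrArg (· * F (-y) ^ 2) hs]
  refine lt_of_le_of_lt (le_of_eq_of_le (wint_congr fun y hy => ?_) (hG1.trans hG2)) hF1
  rw [hG y hy]

include hh in
theorem IsPotential.wint_mul_le_sq (hf : SmoothOff 0 f) (hg : SmoothOff 0 g) {m : ℝ} (hm : 0 < m)
    (h1 : m * wint h (fun y => f y ^ 2) ≤ wint h (fun y => f y * g y)) :
    m ^ 2 * wint h (fun y => f y ^ 2) ≤ wint h (fun y => g y ^ 2) := by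
  have h2 : 0 ≤ wint h (fun y => m ^ 2 * f y ^ 2 - 2 * m * (f y * g y) + g y ^ 2) :=
    hh.wint_nonneg fun y _ => by nlinarith [sq_nonneg (m * f y - g y)]
  rw [hh.wint_add (((SmoothOff.const _).mul (hf.pow 2)).sub ((SmoothOff.const _).mul (hf.mul hg)))
    (hg.pow 2), hh.wint_sub ((SmoothOff.const _).mul (hf.pow 2))
    ((SmoothOff.const _).mul (hf.mul hg)), wint_const_mul, wint_const_mul] at h2
  nlinarith

include hh in
/-- The a priori estimate below a spectral gap. -/
theorem IsPotential.sq_mul_wint_le (hu : SmoothOff 2 u) (hu0 : Hom 0 u) {lam c : ℝ}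
    (hc : 0 < lam + c) (hgap : lam * wint h (fun y => u y ^ 2) ≤ wint h (carre h u u)) :
    (lam + c) ^ 2 * wint h (fun y => u y ^ 2) ≤ wint h (fun y => (c * u y - lap h u y) ^ 2) := by
  have hu00 : SmoothOff 0 u := hu.of_le (by simp)
  have hl0 := hh.smooth_lap_zero hu
  refine hh.wint_mul_le_sq hu00 (((SmoothOff.const c).mul hu00).sub hl0) hc ?_
  have h1 : wint h (fun y => u y * (c * u y - lap h u y)) =
      c * wint h (fun y => u y ^ 2) + wint h (carre h u u) := by
    have h2 := hh.wint_mul_lap (hu.of_le (by norm_num)) hu0 hu hu0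
    have h3 : wint h (fun y => u y * (c * u y - lap h u y)) =
      wint h (fun y => c * u y ^ 2 - u y * lap h u y) := wint_congr fun y _ => by ring
    rw [h3, hh.wint_sub ((SmoothOff.const _).mul (hu00.pow 2)) (hu00.mul hl0), wint_const_mul, h2]
    ring
  rw [h1]; linarith

/-- Below a spectral gap, the range of `-Δ - μ` is dense. -/
theorem IsPotential.dense_of_gap (hn : 2 ≤ n) {s : ℝ} (hs : s * s = 1) {lam μ : ℝ}
    (hlam : 0 ≤ lam) (hμ : μ < lam)
    (hgap : ∀ u ∈ hh.smoothMeanZero s, lam * wint h (fun y => u y ^ 2) ≤ wint h (carre h u u))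
    (hw : w ∈ hh.meanZero s) {ε : ℝ} (hε : 0 < ε) :
    ∃ u ∈ hh.smoothMeanZero s, wint h (fun y => (w y - (-lap h u y - μ * u y)) ^ 2) < ε := by
  let q : (E n → ℝ) → ℝ := fun f => wint h fun y => f y ^ 2
  let k : ℝ → ℝ := fun t => 1 - t * (1 + μ)
  -- the value at the origin is irrelevant; it is set to `0` to make the operators additive
  let T : ℝ → (E n → ℝ) → E n → ℝ := fun t u y => if y = 0 then 0 else k t * u y - lap h u y
  have hTy : ∀ t u y, y ≠ 0 → T t u y = k t * u y - lap h u y := fun t u y hy => if_neg hy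
  obtain ⟨m, hm, hm1, hm2⟩ : ∃ m : ℝ, 0 < m ∧ m ≤ lam + 1 ∧ m ≤ lam - μ :=
    ⟨min (lam + 1) (lam - μ), lt_min (by linarith) (by linarith), min_le_left _ _, min_le_right _ _⟩
  have hmk : ∀ t ∈ Icc (0 : ℝ) 1, m ≤ lam + k t := fun t ht => by
    simp only [k]
    nlinarith [mul_nonneg ht.1 (sub_nonneg.2 hm2),
      mul_nonneg (sub_nonneg.2 ht.2) (sub_nonneg.2 hm1)]
  have key : ∀ w ∈ hh.meanZero s, ∀ ε > 0, ∃ u ∈ hh.smoothMeanZero s, q (w - T 1 u) < ε := by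
    refine dense_of_path (q := q) (T := T) (C := hh.meanZero s)
      (fun a _ => hh.wint_nonneg fun _ _ => sq_nonneg _)
      (fun a ha b hb => hh.wint_sq_sub_le ha.1 hb.1) (fun t ht u hu => ?_)
      (fun t ht u hu v hv => ?_) (δ := m / (4 * (|1 + μ| + 1))) (by positivity)
      (fun a ha b hb hab u hu => ?_) (fun w hw ε hε => ?_)
    · obtain ⟨h1, h2, h3⟩ := hh.smul_sub_lap_mem hu (k t)
      refine ⟨h1.congr fun y hy => hTy t u y hy, fun y hy => ?_, ?_⟩
      · rw [hTy _ _ _ hy, hTy _ _ _ (neg_ne_zero.2 hy)]; exact h2 y hy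
      · rw [← h3]; exact wint_congr fun y hy => hTy t u y hy
    · funext y
      rcases eq_or_ne y 0 with hy | hy
      · simp [T, hy]
      · have h2 : lap h (u + v) y = _ := lap_add (h := h) hu.1.1.two hv.1.1.two hy
        simp only [Pi.add_apply]
        rw [hTy t _ y hy, hTy t u y hy, hTy t v y hy, h2, Pi.add_apply]
        ring
    · have e1 : q (T a u - T b u) = ((a - b) * (1 + μ)) ^ 2 * wint h fun y => u y ^ 2 := by
        rw [← wint_const_mul]
        refine wint_congr fun y hy => ?_
        rw [Pi.sub_apply, hTy a u y hy, hTy b u y hy]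
        simp only [k]; ring
      have e2 : q (T b u) = wint h fun y => (k b * u y - lap h u y) ^ 2 :=
        wint_congr fun y hy => by rw [hTy b u y hy]
      have h1 := hh.sq_mul_wint_le hu.1.1.two hu.1.2 (lt_of_lt_of_le hm (hmk b hb)) (hgap u hu)
      have hU : 0 ≤ wint h fun y => u y ^ 2 := hh.wint_nonneg fun _ _ => sq_nonneg _
      rw [e1, e2]
      have h2 : |(a - b) * (1 + μ)| ≤ m / 4 := by
        rw [abs_mul]
        have : |a - b| * |1 + μ| ≤ m / (4 * (|1 + μ| + 1)) * (|1 + μ| + 1) :=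
          mul_le_mul hab.le (by linarith) (abs_nonneg _) (by positivity)
        refine this.trans (le_of_eq ?_)
        field_simp
      have h3 : ((a - b) * (1 + μ)) ^ 2 ≤ 1 / 16 * (lam + k b) ^ 2 := by
        rw [← sq_abs]
        have := hmk b hb
        nlinarith [abs_nonneg ((a - b) * (1 + μ))]
      have := mul_le_mul_of_nonneg_right h3 hU
      linarith
    · obtain ⟨u, hu, hlt⟩ := hh.dense_resolvent hn hs one_pos hw hε
      refine ⟨u, hu, lt_of_eq_of_lt (wint_congr fun y hy => ?_) hlt⟩
      rw [Pi.sub_apply, hTy 0 u y hy]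
      simp [k]
  obtain ⟨u, hu, hlt⟩ := key w hw ε hε
  refine ⟨u, hu, lt_of_eq_of_lt (wint_congr fun y hy => ?_) hlt⟩
  rw [Pi.sub_apply, hTy 1 u y hy]
  simp only [k]; ring

/-- A lower bound for `∫ (Δv)²` by `∫ |grad v|²`, together with some spectral gap, gives a
spectral gap with the constant of the lower bound. -/
theorem IsPotential.gap_of_lap_sq (hn : 2 ≤ n) {s : ℝ} (hs : s * s = 1) {lam kap : ℝ}
    (hlam : 0 ≤ lam) (hkap : 0 < kap)
    (hgap : ∀ u ∈ hh.smoothMeanZero s, kap * wint h (fun y => u y ^ 2) ≤ wint h (carre h u u))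
    (hB : ∀ v ∈ hh.smoothMeanZero s,
      lam * wint h (carre h v v) ≤ wint h (fun y => lap h v y ^ 2))
    (hu : SmoothOff 2 u) (hu0 : Hom 0 u) (hum : u ∈ hh.meanZero s) :
    lam * wint h (fun y => u y ^ 2) ≤ wint h (carre h u u) := by
  refine hh.gap_of_dense hlam (D := hh.smoothMeanZero s) (fun v hv => hv.1) hB hu hu0
    fun ε hε => ?_
  obtain ⟨v, hv, hlt⟩ := hh.dense_of_gap hn hs hkap.le hkap hgap hum hε
  refine ⟨v, hv, lt_of_eq_of_lt (wint_congr fun y _ => ?_) hlt⟩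
  ring

/-- The Poincaré inequality on the round sphere. -/
theorem round_gap (hn : 3 ≤ n) (hu : SmoothOff 2 u) (hu0 : Hom 0 u)
    (hum : wint (fun y : E n => ‖y‖) u = 0) :
    ((n : ℝ) - 1) * wint (fun y : E n => ‖y‖) (fun y => u y ^ 2) ≤
      wint (fun y : E n => ‖y‖) (carre (fun y => ‖y‖) u u) := by
  have hn' : (3 : ℝ) ≤ n := by exact_mod_cast hn
  refine isPotential_norm.gap_of_dense (by linarith) (D := {v | SmoothOff ∞ v ∧ Hom 0 v})
    (fun v hv => hv) (fun v hv => isPotential_norm.lichnerowicz hn hv.1 hv.2) hu hu0 fun ε hε => ?_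
  obtain ⟨v, hv, hv0, -, hlt⟩ := dense_round (by omega) le_rfl (hu.of_le (by simp)) hum hε
  refine ⟨v, ⟨hv, hv0⟩, lt_of_eq_of_lt (wint_congr fun y _ => ?_) hlt⟩
  ring

include hh in
theorem IsPotential.exists_carre_ge : ∃ m : ℝ, 0 < m ∧ ∀ u : E n → ℝ, ∀ θ : Sph n,
    m * carre (fun y => ‖y‖) u u θ ≤ carre h u u θ := by
  obtain ⟨m, hm, hmc⟩ := hh.exists_segCoeff_ge
  have h11 : (1 : ℝ) ∈ Icc (0 : ℝ) 1 := ⟨zero_le_one, le_rfl⟩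
  refine ⟨m, hm, fun u θ => ?_⟩
  have hA : Matrix.of (segCoeff h (⟨1, h11⟩, θ)) = h θ ^ 2 • hessInv h θ := by
    have hs : CentroAffine.segment h 1 θ = h θ := by
      simp [CentroAffine.segment, Real.sqrt_sq (hh.pos _ (sph_ne_zero θ)).le]
    ext j i
    simp [segCoeff, hs, hessInv, hh.hessSq_segment h11 (sph_ne_zero θ)]
  have h1 := (hmc (⟨1, h11⟩, θ)).dotProduct_mulVec_nonneg fun i => pd i u θ
  rw [hA, star_trivial, Matrix.sub_mulVec, dotProduct_sub, Matrix.smul_mulVec, Matrix.smul_mulVec,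
    Matrix.one_mulVec, dotProduct_smul, dotProduct_smul] at h1
  have h2 : carre (fun y => ‖y‖) u u θ = (fun i => pd i u θ) ⬝ᵥ fun i => pd i u θ := by
    rw [carre_eq_dotProduct]
    simp [hessInv, hessSq_norm]
  rw [h2, carre_eq_dotProduct]
  simp only [smul_eq_mul] at h1
  linarith

include hh in
/-- Some spectral gap, by comparison with the round sphere. The constant is irrelevant: it only
serves to make the range of `-Δ` dense in the functions of mean zero. -/
theorem IsPotential.exists_gap (hn : 3 ≤ n) : ∃ kap : ℝ, 0 < kap ∧ ∀ u : E n → ℝ, SmoothOff 2 u →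
    Hom 0 u → wint h u = 0 → kap * wint h (fun y => u y ^ 2) ≤ wint h (carre h u u) := by
  obtain ⟨a, ha, b, hb, hcmp1, hcmp2⟩ := hh.exists_weight_bounds
  obtain ⟨m, hm, hmc⟩ := hh.exists_carre_ge
  have hn' : (3 : ℝ) ≤ n := by exact_mod_cast hn
  have hr : IsPotential fun y : E n => ‖y‖ := isPotential_norm
  refine ⟨m * a / b, by positivity, fun u hu hu0 hum => ?_⟩
  have hu00 : SmoothOff 0 u := hu.of_le (by simp)
  have hu1 : SmoothOff 1 u := hu.of_le (by norm_num)
  have hM := hr.wint_one_pos (n := n) (by omega)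
  set r := wint (fun y : E n => ‖y‖) u / wint (fun y : E n => ‖y‖) fun _ => 1
  set v : E n → ℝ := fun y => u y + -r * 1 with hv
  have hvs : SmoothOff 2 v := hu.add (SmoothOff.const _)
  have hv00 : SmoothOff 0 v := hvs.of_le (by simp)
  have hvm : wint (fun y : E n => ‖y‖) v = 0 := by
    simp only [hv]
    rw [hr.wint_add hu00 (SmoothOff.const _), wint_const_mul]
    simp only [r]
    rw [neg_mul, div_mul_cancel₀ _ hM.ne', add_neg_cancel]
  have hg := round_gap hn hvs (hu0.add (Hom.const _)) hvm
  have hcv : ∀ y, y ≠ 0 → carre (fun y => ‖y‖) v v y = carre (fun y => ‖y‖) u u y := fun y hy => by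
    have h1 : ∀ j, pd j v y = pd j u y := fun j => by
      simp only [hv]
      rw [pd_add j hu1 (SmoothOff.const _) hy, pd_const, add_zero]
    simp only [carre, dualPd, h1]
  rw [wint_congr hcv] at hg
  have h1 : wint h (fun y => u y ^ 2) ≤ wint h (fun y => v y ^ 2) := by
    have e1 : wint h (fun y => v y ^ 2) = wint h (fun y => u y ^ 2 - 2 * r * u y + r ^ 2 * 1) :=
      wint_congr fun y _ => by simp only [hv]; ring
    rw [e1, hh.wint_add ((hu00.pow 2).sub ((SmoothOff.const _).mul hu00)) (SmoothOff.const _),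
      hh.wint_sub (hu00.pow 2) ((SmoothOff.const _).mul hu00), wint_const_mul, hum, wint_const_mul]
    have : 0 ≤ wint h fun _ => 1 := hh.wint_nonneg fun _ _ => zero_le_one
    have := mul_nonneg (sq_nonneg r) this
    linarith
  have h2 := hcmp2 (fun y => v y ^ 2) (hv00.pow 2) fun _ _ => sq_nonneg _
  have h3 := hcmp1 (carre (fun y => ‖y‖) u u) (hr.smooth_carre_zero hu1 hu1)
    fun y hy => hr.carre_self_nonneg hy
  have h4 : m * wint h (carre (fun y => ‖y‖) u u) ≤ wint h (carre h u u) := by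
    rw [← wint_const_mul]
    exact integral_mono
      (hh.integrable_weight_mul ((SmoothOff.const _).mul (hr.smooth_carre_zero hu1 hu1)))
      (hh.integrable_weight_mul (hh.smooth_carre_zero hu1 hu1)) fun θ =>
      mul_le_mul_of_nonneg_left (hmc u θ) (hh.weight_pos (sph_ne_zero θ)).le
  have h5 : 0 ≤ wint (fun y : E n => ‖y‖) fun y => v y ^ 2 := hr.wint_nonneg fun _ _ => sq_nonneg _
  rw [div_mul_eq_mul_div, div_le_iff₀ hb]
  calc m * a * wint h (fun y => u y ^ 2)
      ≤ m * a * (b * wint (fun y : E n => ‖y‖) fun y => v y ^ 2) :=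
        mul_le_mul_of_nonneg_left (h1.trans h2) (by positivity)
    _ ≤ m * a * (b * wint (fun y : E n => ‖y‖) (carre (fun y => ‖y‖) u u)) := by
        refine mul_le_mul_of_nonneg_left (mul_le_mul_of_nonneg_left ?_ hb.le) (by positivity)
        nlinarith
    _ = m * (a * wint (fun y : E n => ‖y‖) (carre (fun y => ‖y‖) u u)) * b := by ring
    _ ≤ m * wint h (carre (fun y => ‖y‖) u u) * b := by gcongr
    _ ≤ wint h (carre h u u) * b := by gcongr

include hh in
/-- The Poincaré inequality for odd functions, with the constant of the round sphere. -/
theorem IsPotential.odd_gap (hn : 3 ≤ n) (hu : SmoothOff 2 u) (hu0 : Hom 0 u)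
    (hodd : ∀ y, y ≠ 0 → u (-y) = -u y) :
    ((n : ℝ) - 1) * wint h (fun y => u y ^ 2) ≤ wint h (carre h u u) := by
  obtain ⟨kap, hkap, hgap⟩ := hh.exists_gap hn
  have hn' : (3 : ℝ) ≤ n := by exact_mod_cast hn
  have hum : wint h u = 0 := by
    have h1 := hh.wint_comp_neg (by omega) u
    have h2 : wint h (fun y => u (-y)) = -wint h u := by
      rw [← wint_neg]; exact wint_congr hodd
    linarith
  exact hh.gap_of_lap_sq (s := -1) (by omega) (by norm_num) (by linarith) hkap
    (fun v hv => hgap v hv.1.1.two hv.1.2 hv.2.2.2)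
    (fun v hv => hh.lichnerowicz hn hv.1.1 hv.1.2) hu hu0
    ⟨hu.of_le (by simp), fun y hy => by rw [hodd y hy]; ring, hum⟩

end Parity

/-! ### The spectral gap on even functions -/

section EvenGap

open Matrix
open scoped MatrixOrder Matrix.Norms.L2Operator

/-- A bound on the orthogonal complement of `y` is inherited by traces against matrices vanishing on
`y`. -/
theorem trace_mul_le_of_orthogonal {Q G M : Matrix (Fin n) (Fin n) ℝ} {B : ℝ} {y : Fin n → ℝ}
    (hQ : Q.PosSemidef) (hG : Gᵀ = G) (hGy : G *ᵥ y = 0)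
    (hM : ∀ u : Fin n → ℝ, u ⬝ᵥ y = 0 → M *ᵥ u ⬝ᵥ M *ᵥ u ≤ B * (u ⬝ᵥ Q *ᵥ u)) :
    (M * G * Q * (M * G)ᵀ).trace ≤ B * (Q * G * Q * G).trace := by
  obtain ⟨C, rfl⟩ := CStarAlgebra.nonneg_iff_eq_star_mul_self.1 hQ.nonneg
  simp only [star_eq_conjTranspose, conjTranspose_eq_transpose_of_trivial] at hM ⊢
  -- the columns of `S = G Cᵀ` are orthogonal to `y`
  set S := G * Cᵀ with hS
  have hcol : ∀ k, (fun i => S i k) ⬝ᵥ y = 0 := by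
    intro k
    have h1 : Sᵀ *ᵥ y = 0 := by
      rw [hS, transpose_mul, transpose_transpose, hG, ← mulVec_mulVec, hGy, mulVec_zero]
    exact congrFun h1 k
  have e1 : (M * G * (Cᵀ * C) * (M * G)ᵀ).trace =
      ∑ k, M *ᵥ (fun i => S i k) ⬝ᵥ M *ᵥ (fun i => S i k) := by
    have : M * G * (Cᵀ * C) * (M * G)ᵀ = (M * S) * (M * S)ᵀ := by
      simp only [hS, transpose_mul, transpose_transpose, mul_assoc]
    rw [this, trace_mul_comm]
    rfl
  have e2 : ((Cᵀ * C) * G * (Cᵀ * C) * G).trace =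
      ∑ k, (fun i => S i k) ⬝ᵥ (Cᵀ * C) *ᵥ (fun i => S i k) := by
    have h1 : ((Cᵀ * C) * G * (Cᵀ * C) * G).trace = (Sᵀ * ((Cᵀ * C) * S)).trace := by
      rw [trace_mul_comm]
      have : G * (Cᵀ * C * G * (Cᵀ * C)) = S * (C * G * (Cᵀ * C)) := by
        simp only [hS, mul_assoc]
      rw [this, trace_mul_comm]
      have e3 : C * G * (Cᵀ * C) * S = Sᵀ * (Cᵀ * C * S) := by
        simp only [hS, transpose_mul, transpose_transpose, hG, mul_assoc]
      rw [e3]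
    rw [h1]
    rfl
  rw [e1, e2, Finset.mul_sum]
  exact Finset.sum_le_sum fun k _ => hM _ (hcol k)

theorem trace_sub_le {Q X Y : Matrix (Fin n) (Fin n) ℝ} (hQ : Q.PosSemidef) :
    ((X - Y) * Q * (X - Y)ᵀ).trace ≤ 2 * (X * Q * Xᵀ).trace + 2 * (Y * Q * Yᵀ).trace := by
  have h1 := (hQ.mul_mul_conjTranspose_same (X + Y)).trace_nonneg
  rw [conjTranspose_eq_transpose_of_trivial] at h1
  simp only [transpose_add, transpose_sub, add_mul, mul_add, sub_mul, mul_sub, trace_add,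
    trace_sub] at h1 ⊢
  linarith

theorem trace_vecMulVec_conj {Q : Matrix (Fin n) (Fin n) ℝ} (a b : Fin n → ℝ) :
    (vecMulVec a b * Q * (vecMulVec a b)ᵀ).trace = (a ⬝ᵥ a) * (b ⬝ᵥ Q *ᵥ b) := by
  rw [transpose_vecMulVec, mul_assoc, mul_vecMulVec, vecMulVec_mul_vecMulVec, vecMulVec_smul,
    trace_smul, trace_vecMulVec, smul_eq_mul, mul_comm]

variable {h z u : E n → ℝ} (hh : IsPotential h) {y : E n}

include hh in
/-- The Dirichlet energy of the components of `h M ∇z`. Its derivative is `M G - M ∇h ⊗ ∇z` with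
`G = D²(z h) - z D²h`; the two parts are estimated separately, whence the factors `2`. -/
theorem IsPotential.sum_carre_le (M : Matrix (Fin n) (Fin n) ℝ) {B R : ℝ}
    (hB : ∀ u : Fin n → ℝ, u ⬝ᵥ (fun i => y i) = 0 →
      M *ᵥ u ⬝ᵥ M *ᵥ u ≤ B * (u ⬝ᵥ hessInv h y *ᵥ u))
    (hR : M *ᵥ (fun i => pd i h y) ⬝ᵥ M *ᵥ (fun i => pd i h y) ≤ R ^ 2)
    (hz : SmoothOff ∞ z) (hz0 : Hom 0 z) (hy : y ≠ 0) :
    ∑ i, carre h (fun y => h y * ∑ k, M i k * pd k z y) (fun y => h y * ∑ k, M i k * pd k z y) y ≤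
      2 * B * conjHessSq h z y + 2 * R ^ 2 * carre h z z y := by
  set a : Fin n → ℝ := fun i => pd i h y with ha
  set b : Fin n → ℝ := fun i => pd i z y with hb
  set G := conjHess h z y with hGdef
  set Q := hessInv h y with hQdef
  have hQ : Q.PosSemidef := (hh.hessInv_posDef hy).posSemidef
  set N := M * G - vecMulVec (M *ᵥ a) b with hN
  have hpd : ∀ i j, pd j (fun y => h y * ∑ k, M i k * pd k z y) y = N i j := by
    intro i j
    have hs : ∀ k, SmoothOff 1 fun y => M i k * pd k z y :=
      fun k => (SmoothOff.const _).mul (hz.pd_top k).one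
    rw [pd_mul j hh.smooth.one (SmoothOff.sum fun k _ => hs k) hy,
      pd_sum j (fun k _ => hs k) hy]
    simp only [pd_const_mul, hN, hGdef, conjHess, Matrix.sub_apply, Matrix.mul_apply,
      Matrix.add_apply, Matrix.smul_apply, vecMulVec_apply, mulVec, dotProduct, hess,
      Matrix.of_apply, smul_eq_mul, Finset.mul_sum, Finset.sum_mul]
    rw [← Finset.sum_add_distrib, ← Finset.sum_sub_distrib]
    refine Finset.sum_congr rfl fun k _ => ?_
    have hc : pd j (pd k z) y = pd k (pd j z) y := pd_comm hz.two _ _ hy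
    rw [hc]
    simp only [ha, hb]
    ring
  have e1 : ∑ i, carre h (fun y => h y * ∑ k, M i k * pd k z y)
      (fun y => h y * ∑ k, M i k * pd k z y) y = h y ^ 2 * (N * Q * Nᵀ).trace := by
    rw [trace, Finset.mul_sum]
    refine Finset.sum_congr rfl fun i _ => ?_
    simp only [carre, dualPd, hpd, ← hQdef, diag_apply, Matrix.mul_apply, transpose_apply]
    congr 1
    refine Finset.sum_congr rfl fun j _ => ?_
    congr 1
    refine Finset.sum_congr rfl fun k _ => ?_
    rw [hQdef, hh.hessInv_comm hy, mul_comm]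
  have h1 := trace_sub_le (X := M * G) (Y := vecMulVec (M *ᵥ a) b) hQ
  have h2 := trace_mul_le_of_orthogonal hQ (conjHess_transpose hz.two hy)
    (hh.conjHess_mulVec hz.two hz0 hy) hB
  rw [trace_vecMulVec_conj] at h1
  have h3 : 0 ≤ b ⬝ᵥ Q *ᵥ b := by simpa using hQ.dotProduct_mulVec_nonneg b
  have h4 := mul_le_mul_of_nonneg_right hR h3
  have h5 : (N * Q * Nᵀ).trace ≤ 2 * (B * (Q * G * Q * G).trace) +
      2 * (R ^ 2 * (b ⬝ᵥ Q *ᵥ b)) := by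
    refine h1.trans ?_
    linarith
  have h6 := mul_le_mul_of_nonneg_left h5 (sq_nonneg (h y))
  rw [e1, carre_eq_dotProduct, conjHessSq]
  refine h6.trans (le_of_eq ?_)
  ring

include hh in
/-- The main estimate: the odd Poincaré inequality is applied to the components of `h M ∇z`. -/
theorem IsPotential.lap_sq_ge (hn : 3 ≤ n) (M : Matrix (Fin n) (Fin n) ℝ) {A B R : ℝ} (hA : 0 < A)
    (hB : 0 < B)
    (hM : ∀ y : E n, y ≠ 0 → ∀ u : Fin n → ℝ, u ⬝ᵥ (fun i => y i) = 0 →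
      1 / B * (M *ᵥ u ⬝ᵥ M *ᵥ u) ≤ u ⬝ᵥ hessInv h y *ᵥ u ∧
      u ⬝ᵥ hessInv h y *ᵥ u ≤ 1 / A * (M *ᵥ u ⬝ᵥ M *ᵥ u))
    (hR : ∀ y : E n, y ≠ 0 →
      M *ᵥ (fun i => pd i h y) ⬝ᵥ M *ᵥ (fun i => pd i h y) ≤ R ^ 2)
    (hz : SmoothOff ∞ z) (hz0 : Hom 0 z) (hze : ∀ y, y ≠ 0 → z (-y) = z y) :
    ((n : ℝ) - 2 + (((n : ℝ) - 1) / 2 * A - R ^ 2) / B) * wint h (carre h z z) ≤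
      wint h (fun y => lap h z y ^ 2) := by
  have hn' : (3 : ℝ) ≤ n := by exact_mod_cast hn
  -- odd, since `h` is even and the gradient of an even function is odd
  let ξ : Fin n → E n → ℝ := fun i y => h y * ∑ k, M i k * pd k z y
  have hξs : ∀ i, SmoothOff ∞ (ξ i) := fun i =>
    hh.smooth.mul (SmoothOff.sum fun k _ => (SmoothOff.const _).mul (hz.pd_top k))
  have hξ0 : ∀ i, Hom 0 (ξ i) := fun i => by
    have h1 : Hom (0 - 1) fun y => ∑ k, M i k * pd k z y :=
      Hom.sum fun k _ => (hz0.pd k).const_mul _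
    simpa using hh.hom.mul h1
  have hξo : ∀ i y, y ≠ 0 → ξ i (-y) = -ξ i y := fun i y hy => by
    have h1 : ∀ k, pd k z (-y) = -pd k z y := fun k => by
      have h2 : pd k (fun y => z (-y)) y = pd k z y := pd_congr hze k hy
      rw [pd_comp_neg] at h2
      linarith
    simp only [ξ, h1, hh.even, mul_neg, Finset.sum_neg_distrib]
  have h1 : ∀ i, ((n : ℝ) - 1) * wint h (fun y => ξ i y ^ 2) ≤ wint h (carre h (ξ i) (ξ i)) :=
    fun i => hh.odd_gap hn (hξs i).two (hξ0 i) (hξo i)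
  have hsum : ∀ f : Fin n → E n → ℝ, (∀ i, SmoothOff 0 (f i)) →
      wint h (fun y => ∑ i, f i y) = ∑ i, wint h (f i) := fun f hf => by
    simp only [wint, Finset.mul_sum]
    exact integral_finsetSum _ fun i _ => hh.integrable_weight_mul (hf i)
  have hsq : ∀ i, SmoothOff 0 fun y => ξ i y ^ 2 := fun i => ((hξs i).of_le (by simp)).pow 2
  have hca : ∀ i, SmoothOff 0 (carre h (ξ i) (ξ i)) := fun i =>
    hh.smooth_carre_zero (hξs i).one (hξs i).one
  have hcz : SmoothOff 0 (carre h z z) := hh.smooth_carre_zero hz.one hz.one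
  have hcj : SmoothOff 0 (conjHessSq h z) := (hh.smooth_conjHessSq hz).of_le (by simp)
  have h2 : ((n : ℝ) - 1) * wint h (fun y => ∑ i, ξ i y ^ 2) ≤
      wint h (fun y => ∑ i, carre h (ξ i) (ξ i) y) := by
    rw [hsum _ hsq, hsum _ hca, Finset.mul_sum]
    exact Finset.sum_le_sum fun i _ => h1 i
  have h3 : wint h (fun y => ∑ i, carre h (ξ i) (ξ i) y) ≤
      2 * B * wint h (conjHessSq h z) + 2 * R ^ 2 * wint h (carre h z z) := by
    rw [← wint_const_mul, ← wint_const_mul, ← hh.wint_add ((SmoothOff.const _).mul hcj)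
      ((SmoothOff.const _).mul hcz)]
    refine hh.wint_mono (SmoothOff.sum fun i _ => hca i)
      (((SmoothOff.const _).mul hcj).add ((SmoothOff.const _).mul hcz)) fun y hy => ?_
    refine hh.sum_carre_le M (fun u hu => ?_) (hR y hy) hz hz0 hy
    have := (hM y hy u hu).1
    rw [one_div, inv_mul_le_iff₀ hB] at this
    exact this
  have h4 : A * wint h (carre h z z) ≤ wint h (fun y => ∑ i, ξ i y ^ 2) := by
    rw [← wint_const_mul]
    refine hh.wint_mono ((SmoothOff.const _).mul hcz) (SmoothOff.sum fun i _ => hsq i)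
      fun y hy => ?_
    have hb : (fun i => pd i z y) ⬝ᵥ (fun i => y i) = 0 := by
      rw [dotProduct_comm]
      have := hz0.sum_mul_pd hz.one hy
      simpa [dotProduct] using this
    have h5 := (hM y hy _ hb).2
    rw [one_div, le_inv_mul_iff₀ hA] at h5
    have h6 := mul_le_mul_of_nonneg_left h5 (sq_nonneg (h y))
    have e1 : ∑ i, ξ i y ^ 2 =
        h y ^ 2 * (M *ᵥ (fun i => pd i z y) ⬝ᵥ M *ᵥ fun i => pd i z y) := by
      simp only [ξ, dotProduct, mulVec, Finset.mul_sum (a := h y ^ 2)]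
      exact Finset.sum_congr rfl fun i _ => by ring
    rw [e1, carre_eq_dotProduct]
    linarith
  have h5 := hh.bochner hz hz0
  have h6 : (((n : ℝ) - 1) / 2 * A - R ^ 2) / B * wint h (carre h z z) ≤
      wint h (conjHessSq h z) := by
    rw [div_mul_eq_mul_div, div_le_iff₀ hB]
    nlinarith
  rw [h5]
  linarith

include hh in
/-- The spectral gap on even functions. -/
theorem IsPotential.even_gap (hn : 2 ≤ n) (M : Matrix (Fin n) (Fin n) ℝ) {A B R : ℝ} (hA : 0 < A)
    (hB : 0 < B)
    (hM : ∀ y : E n, y ≠ 0 → ∀ u : Fin n → ℝ, u ⬝ᵥ (fun i => y i) = 0 →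
      1 / B * (M *ᵥ u ⬝ᵥ M *ᵥ u) ≤ u ⬝ᵥ hessInv h y *ᵥ u ∧
      u ⬝ᵥ hessInv h y *ᵥ u ≤ 1 / A * (M *ᵥ u ⬝ᵥ M *ᵥ u))
    (hR : ∀ y : E n, y ≠ 0 →
      M *ᵥ (fun i => pd i h y) ⬝ᵥ M *ᵥ (fun i => pd i h y) ≤ R ^ 2) (hAR : A ≤ R ^ 2)
    (hu : SmoothOff 2 u) (hu0 : Hom 0 u) (hue : ∀ y, y ≠ 0 → u (-y) = u y)
    (hum : wint h u = 0) :
    ((n : ℝ) - 2 + (((n : ℝ) - 1) / 2 * A - R ^ 2) / B) * wint h (fun y => u y ^ 2) ≤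
      wint h (carre h u u) := by
  have h1 : 0 ≤ wint h fun y => u y ^ 2 := hh.wint_nonneg fun _ _ => sq_nonneg _
  have h2 : 0 ≤ wint h (carre h u u) := hh.wint_nonneg fun _ hy => hh.carre_self_nonneg hy
  rcases le_or_gt ((n : ℝ) - 2 + (((n : ℝ) - 1) / 2 * A - R ^ 2) / B) 0 with hl | hl
  · nlinarith
  -- in the plane the constant is never positive
  have hn3 : 3 ≤ n := by
    by_contra hlt
    obtain rfl : n = 2 := by omega
    refine absurd hl (not_lt.2 ?_)
    have : ((2 : ℕ) : ℝ) - 2 + ((((2 : ℕ) : ℝ) - 1) / 2 * A - R ^ 2) / B =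
      (A / 2 - R ^ 2) / B := by push_cast; ring
    rw [this]
    exact div_nonpos_of_nonpos_of_nonneg (by linarith) hB.le
  obtain ⟨kap, hkap, hgap⟩ := hh.exists_gap hn3
  exact hh.gap_of_lap_sq (s := 1) hn (by norm_num) hl.le hkap
    (fun v hv => hgap v hv.1.1.two hv.1.2 hv.2.2.2)
    (fun v hv => hh.lap_sq_ge hn3 M hA hB hM hR hv.1.1 hv.1.2
      fun y hy => by rw [hv.2.2.1 y hy, one_mul])
    hu hu0 ⟨hu.of_le (by simp), fun y hy => by rw [hue y hy, one_mul], hum⟩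

end EvenGap

/-! ### Gauge and support function of a smooth convex body -/

section Gradient

open Matrix

variable {f : E n → ℝ} {x y : E n}

theorem inner_eq_dotProduct (u v : E n) : ⟪u, v⟫ = (fun i => u i) ⬝ᵥ fun i => v i := by
  simp [PiLp.inner_apply, dotProduct, mul_comm]

theorem gradient_apply (f : E n → ℝ) (x : E n) (i : Fin n) : gradient f x i = pd i f x := by
  have h1 : ⟪gradient f x, EuclideanSpace.single i (1 : ℝ)⟫ = pd i f x := by
    rw [gradient, InnerProductSpace.toDual_symm_apply, pd]
  rw [← h1, EuclideanSpace.inner_single_right]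
  simp

theorem inner_gradient (f : E n → ℝ) (x v : E n) : ⟪gradient f x, v⟫ = fderiv ℝ f x v := by
  rw [gradient, InnerProductSpace.toDual_symm_apply]

theorem SmoothOff.contDiffAt_gradient {k l : WithTop ℕ∞} (hf : SmoothOff k f) (hl : l + 1 ≤ k)
    (hx : x ≠ 0) : ContDiffAt ℝ l (gradient f) x :=
  contDiffAt_euclidean.2 fun i => by
    simp only [gradient_apply]
    exact hf.pd hl i x hx

theorem SmoothOff.differentiableAt_gradient (hf : SmoothOff 2 f) (hx : x ≠ 0) :
    DifferentiableAt ℝ (gradient f) x :=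
  (hf.contDiffAt_gradient (l := 1) (by norm_num) hx).differentiableAt one_ne_zero

theorem fderiv_gradient_apply (hf : SmoothOff 2 f) (hx : x ≠ 0) (v : E n) (j : Fin n) :
    fderiv ℝ (gradient f) x v j = ∑ i, v i * pd i (pd j f) x := by
  have h1 := ((EuclideanSpace.proj j : E n →L[ℝ] ℝ).hasFDerivAt.comp x
    (hf.differentiableAt_gradient hx).hasFDerivAt).fderiv
  have h2 : (⇑(EuclideanSpace.proj j : E n →L[ℝ] ℝ) ∘ gradient f) =
      pd j f := funext fun x => gradient_apply f x j
  rw [h2] at h1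
  rw [← fderiv_eq_sum_pd, h1]
  rfl

theorem inner_fderiv_gradient (hf : SmoothOff 2 f) (hx : x ≠ 0) (u v : E n) :
    ⟪fderiv ℝ (gradient f) x u, v⟫ = (fun i => u i) ⬝ᵥ hess f x *ᵥ fun i => v i := by
  rw [inner_eq_dotProduct]
  simp only [fderiv_gradient_apply hf hx, dotProduct, mulVec, hess, of_apply, Finset.mul_sum,
    Finset.sum_mul]
  rw [Finset.sum_comm]
  exact Finset.sum_congr rfl fun i _ => Finset.sum_congr rfl fun j _ => by ring

theorem pd_half_sq (hf : SmoothOff 1 f) (hx : x ≠ 0) (i : Fin n) :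
    pd i (fun y => f y ^ 2 / 2) x = f x * pd i f x := by
  have e1 : (fun y => f y ^ 2 / 2) = fun y => 1 / 2 * (f y * f y) := funext fun y => by ring
  rw [e1, pd_const_mul, pd_mul i hf hf hx]
  ring

theorem hessSq_eq (hf : SmoothOff 2 f) (hx : x ≠ 0) :
    hessSq f x = vecMulVec (fun i => pd i f x) (fun i => pd i f x) + f x • hess f x := by
  have hf1 : SmoothOff 1 f := hf.of_le (by norm_num)
  ext i j
  have h1 : pd i (pd j fun y => f y ^ 2 / 2) x = pd i (fun y => f y * pd j f y) x :=
    pd_congr (fun z hz => pd_half_sq hf1 hz j) i hx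
  rw [pd_mul i hf1 (hf.pd_one j) hx] at h1
  simp only [hessSq, of_apply, h1, Matrix.add_apply, vecMulVec_apply, Matrix.smul_apply, hess,
    smul_eq_mul]

end Gradient

theorem secondForm_eq_boundaryMetric {K : Set (E n)} (hs : SmoothOff 2 (gauge K)) {x : E n}
    (hx : x ≠ 0) (hc : conormal K x ≠ 0) (u : E n) {v : E n} (hv : ⟪conormal K x, v⟫ = 0) :
    secondForm K x u v = ‖conormal K x‖⁻¹ * boundaryMetric K x u v := by
  have h1 : DifferentiableAt ℝ (conormal K) x := hs.differentiableAt_gradient hx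
  have h2 : DifferentiableAt ℝ (fun x => ‖conormal K x‖⁻¹) x :=
    (h1.norm ℝ hc).inv (norm_ne_zero_iff.2 hc)
  have h3 : fderiv ℝ (normal K) x = _ := (h2.hasFDerivAt.smul h1.hasFDerivAt).fderiv
  rw [secondForm, boundaryMetric, h3]
  simp only [_root_.add_apply, _root_.smul_apply, ContinuousLinearMap.smulRight_apply,
    inner_add_left, real_inner_smul_left, hv, mul_zero, add_zero]

namespace IsSmoothEvenBody

open Matrix

variable {K : Set (E n)} (hK : IsSmoothEvenBody K) {x y : E n}
include hK

theorem mem_nhds : K ∈ nhds (0 : E n) := mem_interior_iff_mem_nhds.1 hK.zero_mem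

theorem gauge_pos (hx : x ≠ 0) : 0 < gauge K x :=
  (_root_.gauge_pos (absorbent_nhds_zero hK.mem_nhds)
    (NormedSpace.isVonNBounded_of_isBounded ℝ hK.compact.isBounded)).2 hx

theorem gauge_le_one : gauge K x ≤ 1 ↔ x ∈ K := by
  rw [gauge_le_one_iff_mem_closure hK.convex hK.mem_nhds, hK.compact.isClosed.closure_eq]

theorem gauge_eq_one : gauge K x = 1 ↔ x ∈ frontier K :=
  gauge_eq_one_iff_mem_frontier hK.convex hK.mem_nhds

theorem ne_zero_of_frontier (hx : x ∈ frontier K) : x ≠ 0 := by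
  rintro rfl
  have := hK.gauge_eq_one.2 hx
  simp at this

theorem smoothOff_gauge : SmoothOff ∞ (gauge K) := .of_contDiffOn hK.smooth

omit hK in
theorem hom_gauge : Hom 1 (gauge K) := fun t ht y _ => by
  rw [gauge_smul_of_nonneg ht.le, zpow_one, smul_eq_mul]

theorem inner_conormal (hx : x ≠ 0) : ⟪conormal K x, x⟫ = gauge K x := by
  rw [conormal, inner_gradient, fderiv_eq_sum_pd]
  simpa using (hom_gauge (K := K)).euler hK.smoothOff_gauge.one hx

theorem conormal_ne_zero (hx : x ≠ 0) : conormal K x ≠ 0 := fun h0 => by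
  have := hK.inner_conormal hx
  rw [h0, inner_zero_left] at this
  exact (hK.gauge_pos hx).ne this

theorem mem_tangent (hx : x ≠ 0) {u : E n} : u ∈ tangent K x ↔ ⟪conormal K x, u⟫ = 0 := by
  rw [tangent, Submodule.mem_orthogonal_singleton_iff_inner_right, normal, real_inner_smul_left,
    mul_eq_zero, inv_eq_zero, norm_eq_zero]
  simp [hK.conormal_ne_zero hx]

theorem boundaryMetric_eq (hx : x ≠ 0) (u v : E n) :
    boundaryMetric K x u v = (fun i => u i) ⬝ᵥ hess (gauge K) x *ᵥ fun i => v i :=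
  inner_fderiv_gradient hK.smoothOff_gauge.two hx u v

theorem secondForm_eq (hx : x ≠ 0) (u : E n) {v : E n} (hv : v ∈ tangent K x) :
    secondForm K x u v = ‖conormal K x‖⁻¹ * boundaryMetric K x u v :=
  secondForm_eq_boundaryMetric hK.smoothOff_gauge.two hx (hK.conormal_ne_zero hx) u
    ((hK.mem_tangent hx).1 hv)

theorem hess_mulVec (hx : x ≠ 0) : hess (gauge K) x *ᵥ (fun i => x i) = 0 := by
  funext l
  have := ((hom_gauge (K := K)).pd l).euler (hK.smoothOff_gauge.pd_top l).one hx
  simp only [sub_self, Int.cast_zero, zero_mul] at this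
  simp only [mulVec, dotProduct, hess, of_apply, Pi.zero_apply, ← this]
  exact Finset.sum_congr rfl fun j _ => by
    rw [mul_comm, pd_comm hK.smoothOff_gauge.two l j hx]

theorem normalize_mem_frontier (hx : x ≠ 0) : (gauge K x)⁻¹ • x ∈ frontier K := by
  have := hK.gauge_pos hx
  rw [← hK.gauge_eq_one, gauge_smul_of_nonneg (inv_nonneg.2 this.le), smul_eq_mul,
    inv_mul_cancel₀ this.ne']

/-- The gauge is the support function of the polar body. -/
theorem isPotential_gauge : IsPotential (gauge K) where
  smooth := hK.smoothOff_gauge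
  hom := hom_gauge
  pos _ hx := hK.gauge_pos hx
  even x := gauge_neg hK.symm x
  posDef x hx := by
    have hs2 : SmoothOff 2 (fun y => gauge K y ^ 2 / 2) :=
      ((hK.smoothOff_gauge.pow 2).div_const 2).two
    have hhom : Hom 2 fun y => gauge K y ^ 2 / 2 := by
      intro t ht y hy
      simp only [hom_gauge t ht y hy, zpow_ofNat]; ring
    set x₀ := (gauge K x)⁻¹ • x with hx₀
    have hfr := hK.normalize_mem_frontier hx
    have hx₀0 : x₀ ≠ 0 := hK.ne_zero_of_frontier hfr
    have e0 : hessSq (gauge K) x = hessSq (gauge K) x₀ := by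
      ext i j
      have := ((hhom.pd j).pd i) _ (inv_pos.2 (hK.gauge_pos hx)) x hx
      simp only [sub_self, zpow_zero, one_mul, Int.reduceSub] at this
      exact this.symm
    have hone : gauge K x₀ = 1 := hK.gauge_eq_one.2 hfr
    rw [e0]
    refine Matrix.PosDef.of_dotProduct_mulVec_pos ?_ fun v hv => ?_
    · ext i j
      rw [conjTranspose_apply, star_trivial]
      exact pd_comm hs2 j i hx₀0
    set a : Fin n → ℝ := fun i => pd i (gauge K) x₀ with ha
    set H := hess (gauge K) x₀ with hH
    have hHx : H *ᵥ (fun i => x₀ i) = 0 := hK.hess_mulVec hx₀0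
    have hHt : Hᵀ = H := hess_transpose hK.smoothOff_gauge.two hx₀0
    have hxH : (fun i => x₀ i) ᵥ* H = 0 := by rw [← mulVec_transpose, hHt, hHx]
    set α := a ⬝ᵥ v with hα
    let u : E n := WithLp.toLp 2 (v - α • fun i => x₀ i)
    have hu : (fun i => u i) = v - α • fun i => x₀ i := rfl
    have hcon : ∀ w : E n, ⟪conormal K x₀, w⟫ = a ⬝ᵥ fun i => w i := fun w => by
      rw [inner_eq_dotProduct]
      simp only [conormal, gradient_apply, ha]
    have hax : a ⬝ᵥ (fun i => x₀ i) = 1 := by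
      rw [← hcon, hK.inner_conormal hx₀0, hone]
    have hut : u ∈ tangent K x₀ := by
      rw [hK.mem_tangent hx₀0, hcon, hu, dotProduct_sub, dotProduct_smul, hax, ← hα]
      simp
    have e1 : v ⬝ᵥ H *ᵥ v = (fun i => u i) ⬝ᵥ H *ᵥ fun i => u i := by
      have : v = (fun i => u i) + α • fun i => x₀ i := by rw [hu]; simp
      conv_lhs => rw [this]
      rw [mulVec_add, mulVec_smul, hHx, smul_zero, add_zero, add_dotProduct, smul_dotProduct,
        dotProduct_mulVec (fun i => x₀ i), hxH, zero_dotProduct, smul_zero, add_zero]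
    rw [star_trivial, hessSq_eq hK.smoothOff_gauge.two hx₀0, hone, one_smul, add_mulVec,
      dotProduct_add, vecMulVec_mulVec, dotProduct_smul, e1]
    have e2 : MulOpposite.op (a ⬝ᵥ v) • (v ⬝ᵥ a) = α ^ 2 := by
      rw [dotProduct_comm v a, ← hα]
      simp [sq]
    rw [e2]
    have hpos := norm_pos_iff.2 (hK.conormal_ne_zero hx₀0)
    have hII : u ≠ 0 → 0 < (fun i => u i) ⬝ᵥ H *ᵥ fun i => u i := fun hu0 => by
      have := hK.curvature_pos _ hfr u hut hu0
      rw [hK.secondForm_eq hx₀0 u hut, hK.boundaryMetric_eq hx₀0] at this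
      exact (mul_pos_iff_of_pos_left (inv_pos.2 hpos)).1 this
    rcases eq_or_ne u 0 with hu0 | hu0
    · have hv' : v = α • fun i => x₀ i := by
        have h1 : (fun i => u i) = 0 := by rw [hu0]; rfl
        rw [hu] at h1
        exact sub_eq_zero.1 h1
      have hα0 : α ≠ 0 := fun h0 => hv (by rw [hv', h0, zero_smul])
      have h2 : (fun i => u i) = 0 := by rw [hu0]; rfl
      rw [h2, zero_dotProduct, add_zero]
      positivity
    · have := hII hu0
      nlinarith [sq_nonneg α]

theorem inner_le_supp {w : E n} (y : E n) (hw : w ∈ K) : ⟪y, w⟫ ≤ supp K y :=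
  le_csSup (hK.compact.image (by fun_prop)).bddAbove ⟨w, hw, rfl⟩

theorem zero_mem' : (0 : E n) ∈ K := interior_subset hK.zero_mem

theorem inner_le (y w : E n) : ⟪y, w⟫ ≤ supp K y * gauge K w := by
  rcases eq_or_ne w 0 with rfl | hw
  · simp
  have hp := hK.gauge_pos hw
  have h1 : (gauge K w)⁻¹ • w ∈ K := hK.gauge_le_one.1 (hK.gauge_eq_one.2
    (hK.normalize_mem_frontier hw)).le
  have h2 := hK.inner_le_supp y h1
  rw [real_inner_smul_right, inv_mul_le_iff₀ hp] at h2
  linarith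

theorem fderiv_gauge_le (hx : x ≠ 0) (w : E n) : fderiv ℝ (gauge K) x w ≤ gauge K w := by
  have h1 : HasDerivAt (fun t : ℝ => gauge K (x + t • w)) (fderiv ℝ (gauge K) x w) 0 := by
    have h2 : HasDerivAt (fun t : ℝ => x + t • w) w 0 := by
      simpa using ((hasDerivAt_id (0 : ℝ)).smul_const w).const_add x
    have h3 : HasFDerivAt (gauge K) (fderiv ℝ (gauge K) x) (x + (0 : ℝ) • w) := by
      simpa using (hK.smoothOff_gauge.one.differentiableAt one_ne_zero hx).hasFDerivAt
    exact h3.comp_hasDerivAt (0 : ℝ) h2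
  refine le_of_tendsto h1.tendsto_slope_zero_right ?_
  filter_upwards [self_mem_nhdsWithin] with t ht
  have ht' : (0 : ℝ) < t := ht
  have h2 := gauge_add_le hK.convex (absorbent_nhds_zero hK.mem_nhds) x (t • w)
  rw [gauge_smul_of_nonneg ht'.le, smul_eq_mul] at h2
  simp only [zero_add, zero_smul, add_zero, smul_eq_mul]
  rw [inv_mul_le_iff₀ ht']
  linarith

theorem inner_legendre (hx : x ≠ 0) (w : E n) :
    ⟪gradient (fun x => gauge K x ^ 2 / 2) x, w⟫ = gauge K x * fderiv ℝ (gauge K) x w := by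
  rw [inner_gradient, fderiv_eq_sum_pd, fderiv_eq_sum_pd, Finset.mul_sum]
  exact Finset.sum_congr rfl fun i _ => by rw [pd_half_sq hK.smoothOff_gauge.one hx]; ring

theorem inner_legendre_self (hx : x ≠ 0) :
    ⟪gradient (fun x => gauge K x ^ 2 / 2) x, x⟫ = gauge K x ^ 2 := by
  rw [hK.inner_legendre hx, ← inner_gradient, ← conormal, hK.inner_conormal hx, sq]

theorem supp_legendre (hx : x ≠ 0) :
    supp K (gradient (fun x => gauge K x ^ 2 / 2) x) = gauge K x := by
  have hp := hK.gauge_pos hx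
  apply le_antisymm
  · refine csSup_le ⟨_, ⟨0, hK.zero_mem', rfl⟩⟩ ?_
    rintro _ ⟨w, hw, rfl⟩
    simp only
    rw [hK.inner_legendre hx]
    have h1 := (hK.fderiv_gauge_le hx w).trans (hK.gauge_le_one.2 hw)
    nlinarith
  · have := hK.inner_le (gradient (fun x => gauge K x ^ 2 / 2) x) x
    rw [hK.inner_legendre_self hx, sq] at this
    exact le_of_mul_le_mul_right this hp

theorem legendre_ne_zero (hx : x ≠ 0) : gradient (fun x => gauge K x ^ 2 / 2) x ≠ 0 := fun h0 => by
  have h1 := hK.inner_legendre_self hx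
  rw [h0, inner_zero_left] at h1
  have := hK.gauge_pos hx
  nlinarith

theorem supp_pos (hy : y ≠ 0) : 0 < supp K y := by
  obtain ⟨ε, hε, hb⟩ := Metric.mem_nhds_iff.1 hK.mem_nhds
  have hyn := norm_pos_iff.2 hy
  have h1 : (ε / (2 * ‖y‖)) • y ∈ K := hb (by
    rw [mem_ball_zero_iff, norm_smul, Real.norm_of_nonneg (by positivity)]
    have : ε / (2 * ‖y‖) * ‖y‖ = ε / 2 := by field_simp
    rw [this]; linarith)
  refine lt_of_lt_of_le ?_ (hK.inner_le_supp y h1)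
  rw [real_inner_smul_right, real_inner_self_eq_norm_sq]
  positivity

/-- Every covector is a multiple of the conormal at a maximum point of the linear functional on
`K`. -/
theorem exists_legendre_eq (hy : y ≠ 0) :
    ∃ x : E n, x ≠ 0 ∧ gradient (fun x => gauge K x ^ 2 / 2) x = y := by
  obtain ⟨x₀, hx₀, hmax⟩ := hK.compact.exists_isMaxOn ⟨0, hK.zero_mem'⟩
    (f := fun x => ⟪y, x⟫) (by fun_prop)
  have hp := hK.supp_pos hy
  have h1 : supp K y = ⟪y, x₀⟫ := by
    refine le_antisymm (csSup_le ⟨_, ⟨0, hK.zero_mem', rfl⟩⟩ ?_) (hK.inner_le_supp y hx₀)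
    rintro _ ⟨w, hw, rfl⟩
    exact hmax hw
  have hx0 : x₀ ≠ 0 := by
    rintro rfl
    rw [inner_zero_right] at h1
    exact hp.ne' h1
  have h2 : gauge K x₀ = 1 := by
    refine le_antisymm (hK.gauge_le_one.2 hx₀) ?_
    have := hK.inner_le y x₀
    rw [← h1] at this
    nlinarith
  have hmin : IsLocalMin (fun w => supp K y * gauge K w - ⟪y, w⟫) x₀ := by
    refine Filter.Eventually.of_forall fun w => ?_
    have := hK.inner_le y w
    simp only [h2]
    linarith
  have hd : HasFDerivAt (fun w => supp K y * gauge K w - ⟪y, w⟫)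
      (supp K y • fderiv ℝ (gauge K) x₀ - innerSL ℝ y) x₀ :=
    ((hK.smoothOff_gauge.one.differentiableAt one_ne_zero hx0).hasFDerivAt.const_mul _).sub
      (innerSL ℝ y).hasFDerivAt
  have h3 := hmin.hasFDerivAt_eq_zero hd
  have h4 : ∀ i, supp K y * pd i (gauge K) x₀ = y i := fun i => by
    have h5 := DFunLike.congr_fun h3 (EuclideanSpace.single i (1 : ℝ))
    simp only [_root_.sub_apply, _root_.smul_apply, innerSL_apply_apply, smul_eq_mul,
      _root_.zero_apply, EuclideanSpace.inner_single_right] at h5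
    rw [pd]
    simp at h5
    linarith
  refine ⟨supp K y • x₀, smul_ne_zero hp.ne' hx0, ?_⟩
  ext i
  rw [gradient_apply, pd_half_sq hK.smoothOff_gauge.one (smul_ne_zero hp.ne' hx0),
    gauge_smul_of_nonneg hp.le, h2, smul_eq_mul, mul_one, ← h4]
  have := (hom_gauge (K := K)).pd i _ hp x₀ hx0
  simp only [sub_self, zpow_zero, one_mul] at this
  rw [this]

/-- By the inverse function theorem, `h_K` is locally the gauge composed with the inverse of
`D(‖·‖_K² / 2)`. -/
theorem smoothOff_supp : SmoothOff ∞ (supp K) := by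
  intro y hy
  obtain ⟨x, hx, rfl⟩ := hK.exists_legendre_eq hy
  set Ψ : E n → E n := gradient fun x => gauge K x ^ 2 / 2 with hΨ
  have hpot := hK.isPotential_gauge
  have hΨs : ContDiffAt ℝ ∞ Ψ x := hpot.smooth_sq.contDiffAt_gradient (by simp) hx
  have hd : DifferentiableAt ℝ Ψ x := hpot.smooth_sq.two.differentiableAt_gradient hx
  have hinj : Function.Injective (fderiv ℝ Ψ x) := by
    rw [injective_iff_map_eq_zero]
    intro v hv
    by_contra hv0
    have h1 := (hpot.posDef x hx).dotProduct_mulVec_pos (x := fun i => v i)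
      (fun h0 => hv0 (by ext i; exact congrFun h0 i))
    have h2 := inner_fderiv_gradient hpot.smooth_sq.two hx v v
    rw [← hΨ, hv, inner_zero_left] at h2
    rw [star_trivial] at h1
    exact h1.ne h2
  let e : E n ≃L[ℝ] E n :=
    (LinearEquiv.ofInjectiveEndo (fderiv ℝ Ψ x : E n →ₗ[ℝ] E n) hinj).toContinuousLinearEquiv
  have he : HasFDerivAt Ψ (e : E n →L[ℝ] E n) x := by
    have : (e : E n →L[ℝ] E n) = fderiv ℝ Ψ x := by ext1 v; rfl
    rw [this]; exact hd.hasFDerivAt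
  have hinf : (∞ : WithTop ℕ∞) ≠ 0 := by simp
  set L := hΨs.localInverse he hinf with hL
  have hLs : ContDiffAt ℝ ∞ L (Ψ x) := hΨs.to_localInverse he hinf
  have hLx : L (Ψ x) = x := hΨs.localInverse_apply_image he hinf
  have hev : ∀ᶠ y in nhds (Ψ x), Ψ (L y) = y :=
    (hΨs.hasStrictFDerivAt' he hinf).eventually_right_inverse
  have hne : ∀ᶠ y in nhds (Ψ x), L y ≠ 0 :=
    hLs.continuousAt.eventually_ne (by rw [hLx]; exact hx)
  have h1 : ContDiffAt ℝ ∞ (fun y => gauge K (L y)) (Ψ x) :=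
    ContDiffAt.comp (g := gauge K) (Ψ x) (by rw [hLx]; exact hK.smoothOff_gauge x hx) hLs
  refine h1.congr_of_eventuallyEq ?_
  filter_upwards [hev, hne] with y h2 h3
  rw [← hK.supp_legendre h3, ← hΨ, h2]

/-- The Legendre transforms of `h_K² / 2` and `‖·‖_K² / 2` are inverse to each other. -/
theorem pd_half_sq_supp_legendre (hx : x ≠ 0) (j : Fin n) :
    pd j (fun y => supp K y ^ 2 / 2) (gradient (fun x => gauge K x ^ 2 / 2) x) = x j := by
  set y := gradient (fun x => gauge K x ^ 2 / 2) x with hy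
  have hy0 : y ≠ 0 := hK.legendre_ne_zero hx
  have hmin : IsLocalMin (fun w => supp K w ^ 2 / 2 - ⟪x, w⟫) y := by
    refine Filter.Eventually.of_forall fun w => ?_
    have h1 := hK.inner_le w x
    have h2 := hK.inner_legendre_self hx
    rw [real_inner_comm] at h1
    simp only
    rw [← hy, real_inner_comm] at h2
    rw [h2, hy, hK.supp_legendre hx]
    nlinarith [sq_nonneg (supp K w - gauge K x)]
  have hs : SmoothOff 1 fun w => supp K w ^ 2 / 2 := ((hK.smoothOff_supp.pow 2).div_const 2).one
  have h3 := hmin.hasFDerivAt_eq_zero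
    ((hs.differentiableAt one_ne_zero hy0).hasFDerivAt.sub (innerSL ℝ x).hasFDerivAt)
  have h5 := DFunLike.congr_fun h3 (EuclideanSpace.single j (1 : ℝ))
  simp only [_root_.sub_apply, innerSL_apply_apply, _root_.zero_apply,
    EuclideanSpace.inner_single_right] at h5
  rw [pd]
  simp at h5
  linarith

/-- The Hessians of a function and of its Legendre transform are inverse to each other. -/
theorem hessSq_gauge_mul (hx : x ≠ 0) :
    hessSq (gauge K) x * hessSq (supp K) (gradient (fun x => gauge K x ^ 2 / 2) x) = 1 := by
  set Ψ : E n → E n := gradient fun x => gauge K x ^ 2 / 2 with hΨ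
  have hy0 : Ψ x ≠ 0 := hK.legendre_ne_zero hx
  have hs : SmoothOff ∞ fun w => supp K w ^ 2 / 2 := (hK.smoothOff_supp.pow 2).div_const 2
  have hpot := hK.isPotential_gauge
  ext i j
  have h1 : pd i (fun x => pd j (fun y => supp K y ^ 2 / 2) (Ψ x)) x = pd i (fun x => x j) x :=
    pd_congr (fun z hz => hK.pd_half_sq_supp_legendre hz j) i hx
  have h2 : pd i (fun x => pd j (fun y => supp K y ^ 2 / 2) (Ψ x)) x =
      ∑ l, fderiv ℝ Ψ x (EuclideanSpace.single i 1) l *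
        pd l (pd j fun y => supp K y ^ 2 / 2) (Ψ x) := by
    have h3 := (((hs.pd_top j).one.differentiableAt one_ne_zero hy0).hasFDerivAt.comp x
      (hpot.smooth_sq.two.differentiableAt_gradient hx).hasFDerivAt).fderiv
    rw [← fderiv_eq_sum_pd]
    exact DFunLike.congr_fun h3 (EuclideanSpace.single i (1 : ℝ))
  rw [h2, pd_coord] at h1
  rw [Matrix.mul_apply, Matrix.one_apply]
  convert h1 using 2 with l
  rw [hΨ, fderiv_gradient_apply hpot.smooth_sq.two hx]
  simp [hessSq, PiLp.single_apply]

theorem hessInv_supp (hx : x ≠ 0) :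
    hessInv (supp K) (gradient (fun x => gauge K x ^ 2 / 2) x) = hessSq (gauge K) x :=
  Matrix.inv_eq_left_inv (hK.hessSq_gauge_mul hx)

theorem hessSq_supp (hx : x ≠ 0) :
    hessSq (supp K) (gradient (fun x => gauge K x ^ 2 / 2) x) = hessInv (gauge K) x :=
  (Matrix.inv_eq_right_inv (hK.hessSq_gauge_mul hx)).symm

theorem isPotential_supp : IsPotential (supp K) where
  smooth := hK.smoothOff_supp
  hom t ht y _ := by
    open scoped Pointwise in
    have e1 : supp K (t • y) = sSup (t • ((fun x => ⟪y, x⟫) '' K)) := by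
      rw [← Set.image_smul, Set.image_image]
      simp only [real_inner_smul_left, smul_eq_mul, supp]
    rw [e1, Real.sSup_smul_of_nonneg ht.le, zpow_one, smul_eq_mul, supp]
  pos _ hy := hK.supp_pos hy
  even y := by
    have e1 : (fun x => ⟪-y, x⟫) '' K = (fun x => ⟪y, x⟫) '' K := by
      ext c
      constructor <;> rintro ⟨x, hx, rfl⟩ <;> exact ⟨-x, hK.symm x hx, by simp⟩
    rw [supp, e1, supp]
  posDef y hy := by
    obtain ⟨x, hx, rfl⟩ := hK.exists_legendre_eq hy
    rw [hK.hessSq_supp hx]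
    exact hK.isPotential_gauge.hessInv_posDef hx

end IsSmoothEvenBody

/-! ### Linear images, and consequences of curvature bounds -/

section Line

open Matrix

variable {f : E n → ℝ}

theorem hasDerivAt_line (hf : SmoothOff 1 f) {a b : E n} {t : ℝ} (h : a + t • b ≠ 0) :
    HasDerivAt (fun t : ℝ => f (a + t • b)) (∑ i, b i * pd i f (a + t • b)) t := by
  have h2 : HasDerivAt (fun t : ℝ => a + t • b) b t := by
    simpa using ((hasDerivAt_id t).smul_const b).const_add a
  rw [← fderiv_eq_sum_pd]
  exact (hf.differentiableAt one_ne_zero h).hasFDerivAt.comp_hasDerivAt t h2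

theorem hasDerivAt_line_two (hf : SmoothOff 2 f) {a b : E n} {t : ℝ} (h : a + t • b ≠ 0) :
    HasDerivAt (fun t : ℝ => ∑ i, b i * pd i f (a + t • b))
      ((fun i => b i) ⬝ᵥ hess f (a + t • b) *ᵥ fun i => b i) t := by
  have h1 : HasDerivAt (fun t : ℝ => ∑ j, b j * pd j f (a + t • b))
      (∑ j, b j * ∑ i, b i * pd i (pd j f) (a + t • b)) t :=
    HasDerivAt.fun_sum fun j _ => (hasDerivAt_line (hf.pd_one j) h).const_mul (b j)
  convert h1 using 1
  simp only [dotProduct, mulVec, hess, of_apply, Finset.mul_sum]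
  rw [Finset.sum_comm]
  exact Finset.sum_congr rfl fun i _ => Finset.sum_congr rfl fun j _ => by ring

theorem hess_nonneg_of_isLocalMin (hf : SmoothOff 2 f) {x : E n} (hx : x ≠ 0)
    (hmin : IsLocalMin f x) (v : E n) : 0 ≤ (fun i => v i) ⬝ᵥ hess f x *ᵥ fun i => v i := by
  have hf1 : SmoothOff 1 f := hf.of_le (by norm_num)
  by_contra! hneg
  set F : ℝ → ℝ := fun t => f (x + t • v) with hF
  have hx0 : x + (0 : ℝ) • v = x := by simp
  have hcont : ContinuousAt (fun t : ℝ => x + t • v) 0 := by fun_prop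
  have hev : ∀ᶠ t in nhds (0 : ℝ), x + t • v ≠ 0 := hcont.eventually_ne (by rwa [hx0])
  have hd : deriv F =ᶠ[nhds (0 : ℝ)] fun t => ∑ i, v i * pd i f (x + t • v) := by
    filter_upwards [hev] with t ht using (hasDerivAt_line hf1 ht).deriv
  have hmin' : IsLocalMin F 0 := by
    have h1 : Filter.Tendsto (fun t : ℝ => x + t • v) (nhds 0) (nhds x) := by
      have := hcont.tendsto
      rwa [hx0] at this
    have := h1.eventually hmin
    filter_upwards [this] with t ht
    simpa [hF] using ht
  have hd2 : deriv (deriv F) 0 = (fun i => v i) ⬝ᵥ hess f x *ᵥ fun i => v i := by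
    rw [hd.deriv_eq, (hasDerivAt_line_two hf (by rwa [hx0])).deriv, hx0]
  have hmax : IsLocalMax F 0 := isLocalMax_of_deriv_deriv_neg (by rwa [hd2]) hmin'.deriv_eq_zero
    (hasDerivAt_line hf1 (by rwa [hx0])).continuousAt
  -- a function with a local minimum and a local maximum at the same point is locally constant
  have hconst : F =ᶠ[nhds 0] fun _ => F 0 := by
    filter_upwards [hmin', hmax] with t h1 h2 using le_antisymm h2 h1
  have h3 : deriv (deriv F) 0 = 0 := by
    have : deriv F =ᶠ[nhds 0] fun _ => 0 := by
      filter_upwards [hconst.eventuallyEq_nhds] with t ht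
      rw [ht.deriv_eq, deriv_const]
    rw [this.deriv_eq, deriv_const]
  rw [hd2] at h3
  exact hneg.ne h3

theorem exists_orthogonal_ne_zero (hn : 2 ≤ n) (c : E n) : ∃ v : E n, v ≠ 0 ∧ ⟪c, v⟫ = 0 := by
  have h1 : LinearMap.ker (innerSL ℝ c : E n →ₗ[ℝ] ℝ) ≠ ⊥ :=
    LinearMap.ker_ne_bot_of_finrank_lt (by simpa using by omega)
  obtain ⟨v, hv, hv0⟩ := Submodule.exists_mem_ne_zero_of_ne_bot h1
  exact ⟨v, hv0, by simpa using hv⟩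

theorem hess_mulVec_self (hf : SmoothOff 2 f) (hf1 : Hom 1 f) {y : E n} (hy : y ≠ 0) :
    hess f y *ᵥ (fun i => y i) = 0 := by
  funext l
  have := (hf1.pd l).euler (hf.pd_one l) hy
  simp only [sub_self, Int.cast_zero, zero_mul] at this
  simp only [mulVec, dotProduct, hess, of_apply, Pi.zero_apply, ← this]
  exact Finset.sum_congr rfl fun j _ => by rw [mul_comm, pd_comm hf l j hy]

theorem hess_nonneg_of_orthogonal (hf : SmoothOff 2 f) (hf1 : Hom 1 f) {y : E n} (hy : y ≠ 0)
    (h : ∀ w : E n, ⟪y, w⟫ = 0 → 0 ≤ (fun i => w i) ⬝ᵥ hess f y *ᵥ fun i => w i) (v : E n) :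
    0 ≤ (fun i => v i) ⬝ᵥ hess f y *ᵥ fun i => v i := by
  have hyy : ⟪y, y⟫ ≠ 0 := inner_self_ne_zero.2 hy
  set α := ⟪y, v⟫ / ⟪y, y⟫
  set w : E n := v - α • y
  have hw : ⟪y, w⟫ = 0 := by
    simp only [w, α]
    rw [inner_sub_right, real_inner_smul_right, div_mul_cancel₀ _ hyy, sub_self]
  have h1 := h w hw
  have h2 : hess f y *ᵥ (fun i => y i) = 0 := hess_mulVec_self hf hf1 hy
  have h3 : (fun i => y i) ᵥ* hess f y = 0 := by
    rw [← mulVec_transpose, hess_transpose hf hy, h2]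
  have e : (fun i => w i) = (fun i => v i) - α • fun i => y i := rfl
  rw [e, mulVec_sub, mulVec_smul, h2, smul_zero, sub_zero, sub_dotProduct, smul_dotProduct,
    dotProduct_mulVec (fun i => y i), h3, zero_dotProduct, smul_zero, sub_zero] at h1
  exact h1

/-- An even `1`-homogeneous function with positive semidefinite Hessian is nonnegative. -/
theorem nonneg_of_hess_nonneg (hn : 2 ≤ n) (hf : SmoothOff 2 f) (hf1 : Hom 1 f)
    (heven : ∀ y, f (-y) = f y)
    (h : ∀ y w : E n, y ≠ 0 → ⟪y, w⟫ = 0 → 0 ≤ (fun i => w i) ⬝ᵥ hess f y *ᵥ fun i => w i)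
    {y : E n} (hy : y ≠ 0) : 0 ≤ f y := by
  have hf1' : SmoothOff 1 f := hf.of_le (by norm_num)
  obtain ⟨e, he, hye⟩ := exists_orthogonal_ne_zero hn y
  -- convexity along the line through `y` and `-y + ε e`, which avoids the origin
  have key : ∀ ε : ℝ, 0 < ε → ε * f e ≤ f y + f (-y + ε • e) := by
    intro ε hε
    set b : E n := (-2 : ℝ) • y + ε • e with hb
    have hne : ∀ t : ℝ, y + t • b ≠ 0 := by
      intro t h0
      have h1 : ⟪e, y + t • b⟫ = t * ε * ⟪e, e⟫ := by
        rw [hb, smul_add, smul_smul, smul_smul, inner_add_right, inner_add_right,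
          real_inner_smul_right, real_inner_smul_right, real_inner_comm, hye]
        ring
      have h2 : ⟪y, y + t • b⟫ = (1 - 2 * t) * ⟪y, y⟫ := by
        rw [hb, smul_add, smul_smul, smul_smul, inner_add_right, inner_add_right,
          real_inner_smul_right, real_inner_smul_right, hye]
        ring
      rw [h0, inner_zero_right] at h1 h2
      have h4 := inner_self_ne_zero (𝕜 := ℝ).2 hy
      have h5 : t = 0 := by simpa [hε.ne', he] using h1.symm
      rw [h5, mul_zero, sub_zero, one_mul] at h2
      exact h4 h2.symm
    set F : ℝ → ℝ := fun t => f (y + t • b)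
    have hd : deriv F = fun t => ∑ i, b i * pd i f (y + t • b) :=
      funext fun t => (hasDerivAt_line hf1' (hne t)).deriv
    have hconv : ConvexOn ℝ univ F := by
      refine convexOn_univ_of_deriv2_nonneg
        (fun t => (hasDerivAt_line hf1' (hne t)).differentiableAt) ?_ fun t => ?_
      · rw [hd]; exact fun t => (hasDerivAt_line_two hf (hne t)).differentiableAt
      · rw [Function.iterate_succ, Function.iterate_one, Function.comp_apply, hd,
          (hasDerivAt_line_two hf (hne t)).deriv]
        exact hess_nonneg_of_orthogonal hf hf1 (hne t) (fun w hw => h _ w (hne t) hw) b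
    have h1 := hconv.2 (mem_univ 0) (mem_univ 1) (by norm_num : (0 : ℝ) ≤ 1 / 2)
      (by norm_num : (0 : ℝ) ≤ 1 / 2) (by norm_num)
    simp only [smul_eq_mul, mul_zero, mul_one, zero_add, F, zero_smul, add_zero, one_smul] at h1
    have e1 : y + (1 / 2 : ℝ) • b = (ε / 2) • e := by
      rw [hb, smul_add, smul_smul, smul_smul]; module
    have e2 : y + b = -y + ε • e := by rw [hb]; module
    rw [e1, e2, hf1 (ε / 2) (by positivity) e he, zpow_one] at h1
    linarith
  have hlim : Filter.Tendsto (fun ε : ℝ => f y + f (-y + ε • e)) (nhdsWithin 0 (Ioi 0))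
      (nhds (f y + f (-y))) := by
    refine tendsto_const_nhds.add (tendsto_nhdsWithin_of_tendsto_nhds ?_)
    have h1 : ContinuousAt f (-y + (0 : ℝ) • e) := by
      rw [zero_smul, add_zero]; exact hf.continuousAt (neg_ne_zero.2 hy)
    have h2 : ContinuousAt (fun ε : ℝ => -y + ε • e) 0 := by fun_prop
    have h3 := ContinuousAt.comp (g := f) (f := fun ε : ℝ => -y + ε • e) (x := 0) h1 h2
    have h4 := h3.tendsto
    simpa [Function.comp_def] using h4
  have hlim2 : Filter.Tendsto (fun ε : ℝ => ε * f e) (nhdsWithin 0 (Ioi 0)) (nhds 0) := by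
    refine tendsto_nhdsWithin_of_tendsto_nhds ?_
    have : Continuous fun ε : ℝ => ε * f e := by fun_prop
    simpa using this.tendsto 0
  have h1 := le_of_tendsto_of_tendsto hlim2 hlim
    (by filter_upwards [self_mem_nhdsWithin] with ε hε using key ε hε)
  rw [heven] at h1
  linarith

theorem norm_mul_hess_norm {y w : E n} (hy : y ≠ 0) (hw : ⟪y, w⟫ = 0) :
    ‖y‖ * ((fun i => w i) ⬝ᵥ hess (fun y : E n => ‖y‖) y *ᵥ fun i => w i) = ‖w‖ ^ 2 := by
  have h1 := hessSq_eq (f := fun y : E n => ‖y‖) SmoothOff.norm hy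
  rw [hessSq_norm] at h1
  have h2 : ∀ i, ‖y‖ * pd i (fun y : E n => ‖y‖) y = y i := fun i => by
    rw [← pd_half_sq (f := fun y : E n => ‖y‖) SmoothOff.norm hy i]
    have : (fun y : E n => ‖y‖ ^ 2 / 2) = fun y => 1 / 2 * ‖y‖ ^ 2 := by funext y; ring
    rw [this, pd_const_mul, pd_normSq]; ring
  have h3 : (fun i => pd i (fun y : E n => ‖y‖) y) ⬝ᵥ (fun i => w i) = 0 := by
    have h4 : ‖y‖ * ((fun i => pd i (fun y : E n => ‖y‖) y) ⬝ᵥ fun i => w i) = 0 := by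
      rw [← hw, inner_eq_dotProduct, dotProduct, dotProduct, Finset.mul_sum]
      exact Finset.sum_congr rfl fun i _ => by rw [← mul_assoc, h2]
    exact (mul_eq_zero.1 h4).resolve_left (norm_ne_zero_iff.2 hy)
  have h5 := congrArg (fun A : Matrix (Fin n) (Fin n) ℝ =>
    (fun i => w i) ⬝ᵥ A *ᵥ fun i => w i) h1
  simp only [add_mulVec, vecMulVec_mulVec, h3, MulOpposite.op_zero, zero_smul, zero_add,
    smul_mulVec, dotProduct_smul, smul_eq_mul, one_mulVec] at h5
  rw [← h5, ← inner_eq_dotProduct, real_inner_self_eq_norm_sq]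

end Line

namespace IsSmoothEvenBody

open Matrix

variable {K : Set (E n)} (hK : IsSmoothEvenBody K) {x y : E n}

theorem _root_.CentroAffine.gauge_image (T : E n ≃L[ℝ] E n) (K : Set (E n)) :
    gauge (T '' K) = gauge K ∘ T.symm := by
  funext x
  simp only [Function.comp_apply, gauge_def']
  congr 1
  ext r
  simp only [mem_ofPred_eq, and_congr_right_iff]
  intro _
  rw [← map_smul]
  constructor
  · rintro ⟨k, hk, hkx⟩
    rwa [← hkx, T.symm_apply_apply]
  · exact fun h => ⟨_, h, T.apply_symm_apply _⟩

include hK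

theorem smoothOff_gauge_image (T : E n ≃L[ℝ] E n) : SmoothOff ∞ (gauge (T '' K)) := by
  intro x hx
  rw [gauge_image]
  exact ContDiffAt.comp (g := gauge K) (f := T.symm) x
    (hK.smoothOff_gauge _ (by simpa using hx)) T.symm.contDiff.contDiffAt

omit hK in
theorem _root_.CentroAffine.inner_conormal_image (T : E n ≃L[ℝ] E n) (K : Set (E n)) (x u : E n) :
    ⟪conormal (T '' K) x, u⟫ = ⟪conormal K (T.symm x), T.symm u⟫ := by
  rw [conormal, conormal, inner_gradient, inner_gradient, gauge_image, T.symm.comp_right_fderiv]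
  rfl

theorem boundaryMetric_image (T : E n ≃L[ℝ] E n) (hx : x ≠ 0) (u v : E n) :
    boundaryMetric (T '' K) (T x) (T u) (T v) = boundaryMetric K x u v := by
  have hx' : T x ≠ 0 := by simpa using hx
  have h1 : DifferentiableAt ℝ (conormal (T '' K)) (T x) :=
    (hK.smoothOff_gauge_image T).two.differentiableAt_gradient hx'
  have h2 : DifferentiableAt ℝ (conormal K) x :=
    hK.smoothOff_gauge.two.differentiableAt_gradient hx
  have h3 := fderiv_inner_apply ℝ h1 (differentiableAt_const (T v)) (T u)
  have h4 := fderiv_inner_apply ℝ h2 (differentiableAt_const v) u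
  simp only [fderiv_fun_const, Pi.zero_apply, _root_.zero_apply, inner_zero_right, zero_add]
    at h3 h4
  rw [boundaryMetric, boundaryMetric, ← h3, ← h4]
  have e1 : (fun t => ⟪conormal (T '' K) t, T v⟫) = (fun t => ⟪conormal K t, v⟫) ∘ T.symm := by
    funext t
    rw [inner_conormal_image, T.symm_apply_apply]
    rfl
  rw [e1, T.symm.comp_right_fderiv]
  simp

omit hK in
theorem _root_.CentroAffine.mem_tangent_image (T : E n ≃L[ℝ] E n) {u : E n}
    (hu : ⟪conormal K x, u⟫ = 0) : T u ∈ tangent (T '' K) (T x) := by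
  rw [tangent, Submodule.mem_orthogonal_singleton_iff_inner_right, normal, real_inner_smul_left,
    inner_conormal_image, T.symm_apply_apply, T.symm_apply_apply, hu, mul_zero]

omit hK in
theorem _root_.CentroAffine.frontier_image (T : E n ≃L[ℝ] E n) (K : Set (E n)) :
    frontier (T '' K) = T '' frontier K := (T.toHomeomorph.image_frontier K).symm

/-- Linear images of smooth bodies of positive curvature are of the same kind. -/
theorem image (T : E n ≃L[ℝ] E n) : IsSmoothEvenBody (T '' K) where
  convex := hK.convex.linear_image (T : E n →ₗ[ℝ] E n)
  compact := hK.compact.image T.continuous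
  zero_mem := by
    have : interior (T '' K) = T '' interior K := (T.toHomeomorph.image_interior K).symm
    rw [this]
    exact ⟨0, hK.zero_mem, map_zero T⟩
  symm := by
    rintro _ ⟨x, hx, rfl⟩
    exact ⟨-x, hK.symm x hx, by simp⟩
  smooth x hx := (hK.smoothOff_gauge_image T x hx).contDiffWithinAt
  curvature_pos := by
    rw [frontier_image]
    rintro _ ⟨x, hx, rfl⟩ u hu hu0
    have hx0 := hK.ne_zero_of_frontier hx
    obtain ⟨v, rfl⟩ := T.surjective u
    have hv0 : v ≠ 0 := by rintro rfl; simp at hu0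
    have hc : conormal (T '' K) (T x) ≠ 0 := fun h0 => by
      have h1 := inner_conormal_image T K (T x) (T x)
      rw [h0, inner_zero_left, T.symm_apply_apply, hK.inner_conormal hx0] at h1
      exact (hK.gauge_pos hx0).ne h1
    have hcv : ⟪conormal (T '' K) (T x), T v⟫ = 0 := by
      rw [tangent, Submodule.mem_orthogonal_singleton_iff_inner_right, normal,
        real_inner_smul_left, mul_eq_zero, inv_eq_zero, norm_eq_zero] at hu
      exact hu.resolve_left hc
    have hvt : v ∈ tangent K x := by
      rw [hK.mem_tangent hx0]
      rwa [inner_conormal_image, T.symm_apply_apply, T.symm_apply_apply] at hcv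
    rw [secondForm_eq_boundaryMetric (hK.smoothOff_gauge_image T).two (by simpa using hx0) hc _ hcv,
      hK.boundaryMetric_image T hx0]
    have h1 := hK.curvature_pos x hx v hvt hv0
    rw [hK.secondForm_eq hx0 v hvt] at h1
    exact mul_pos (inv_pos.2 (norm_pos_iff.2 hc)) ((mul_pos_iff_of_pos_left
      (inv_pos.2 (norm_pos_iff.2 (hK.conormal_ne_zero hx0)))).1 h1)

/-- The farthest point of the body from the origin bounds the metric from below. -/
theorem le_sq_of_metric_le (hn : 2 ≤ n) {A R : ℝ} (hA : 0 < A)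
    (hmet : ∀ x ∈ frontier K, ∀ u ∈ tangent K x, boundaryMetric K x u u ≤ 1 / A * ⟪u, u⟫)
    (hR : K ⊆ closedBall 0 R) : A ≤ R ^ 2 := by
  obtain ⟨x₀, hx₀, hmax⟩ := hK.compact.exists_isMaxOn ⟨0, hK.zero_mem'⟩
    (f := fun x => ‖x‖) (by fun_prop)
  have : Nontrivial (E n) := by
    have : Nonempty (Fin n) := ⟨⟨0, by omega⟩⟩
    infer_instance
  have hle : ∀ w, ‖w‖ ≤ ‖x₀‖ * gauge K w := fun w => by
    rcases eq_or_ne w 0 with rfl | hw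
    · simp
    have hp := hK.gauge_pos hw
    have h1 : (gauge K w)⁻¹ • w ∈ K := hK.gauge_le_one.1 (hK.gauge_eq_one.2
      (hK.normalize_mem_frontier hw)).le
    have h2 : ‖(gauge K w)⁻¹ • w‖ ≤ ‖x₀‖ := hmax h1
    rw [norm_smul, norm_inv, Real.norm_of_nonneg hp.le, inv_mul_le_iff₀ hp] at h2
    linarith
  have hx₀0 : x₀ ≠ 0 := by
    rintro rfl
    obtain ⟨w, hw⟩ := exists_ne (0 : E n)
    have := hle w
    rw [norm_zero, zero_mul] at this
    exact hw (norm_le_zero_iff.1 this)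
  have hρ := norm_pos_iff.2 hx₀0
  have hone : gauge K x₀ = 1 := by
    refine le_antisymm (hK.gauge_le_one.2 hx₀) ?_
    have := hle x₀
    nlinarith
  have hfr := hK.gauge_eq_one.1 hone
  -- at the farthest point `x₀` the ball of radius `‖x₀‖` touches `K` from outside
  set c : ℝ := 1 / ‖x₀‖ ^ 2 with hc
  have hs1 : SmoothOff 2 fun x => gauge K x ^ 2 / 2 :=
    ((hK.smoothOff_gauge.pow 2).div_const 2).two
  have hs2 : SmoothOff 2 fun x : E n => c / 2 * ‖x‖ ^ 2 :=
    (SmoothOff.const _).mul SmoothOff.normSq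
  have hmin : IsLocalMin (fun x => gauge K x ^ 2 / 2 - c / 2 * ‖x‖ ^ 2) x₀ := by
    refine Filter.Eventually.of_forall fun w => ?_
    have h1 := mul_self_le_mul_self (norm_nonneg w) (hle w)
    have h2 : c * ‖x₀‖ ^ 2 = 1 := by rw [hc]; field_simp
    have hc0 : 0 < c := by positivity
    simp only [hone]
    have h3 : c * ‖w‖ ^ 2 ≤ gauge K w ^ 2 := by
      calc c * ‖w‖ ^ 2 ≤ c * (‖x₀‖ * gauge K w * (‖x₀‖ * gauge K w)) := by
            rw [sq]; exact mul_le_mul_of_nonneg_left h1 hc0.le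
        _ = (c * ‖x₀‖ ^ 2) * gauge K w ^ 2 := by ring
        _ = gauge K w ^ 2 := by rw [h2, one_mul]
    linarith
  obtain ⟨v, hv0, hv⟩ := exists_orthogonal_ne_zero hn (conormal K x₀)
  have h1 := hess_nonneg_of_isLocalMin (hs1.sub hs2) hx₀0 hmin v
  have e1 : hess (fun x => gauge K x ^ 2 / 2 - c / 2 * ‖x‖ ^ 2) x₀ =
      hessSq (gauge K) x₀ - c • (1 : Matrix (Fin n) (Fin n) ℝ) := by
    ext i j
    have h2 : pd i (pd j fun x => gauge K x ^ 2 / 2 - c / 2 * ‖x‖ ^ 2) x₀ =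
        pd i (fun x => pd j (fun x => gauge K x ^ 2 / 2) x - c / 2 * pd j (fun x => ‖x‖ ^ 2) x) x₀ :=
      pd_congr (fun z hz => by
        rw [pd_sub j (hs1.of_le (by norm_num)) (hs2.of_le (by norm_num)) hz, pd_const_mul]) i hx₀0
    have hs3 : SmoothOff 1 (pd j fun x : E n => ‖x‖ ^ 2) := (SmoothOff.normSq (k := 2)).pd_one j
    rw [pd_sub i (hs1.pd_one j) ((SmoothOff.const _).mul hs3) hx₀0, pd_const_mul, normSq_hess] at h2
    simp only [hess, of_apply, h2, hessSq, Matrix.sub_apply, Matrix.smul_apply, smul_eq_mul]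
    ring
  have hvt : v ∈ tangent K x₀ := (hK.mem_tangent hx₀0).2 hv
  have h2 := hmet x₀ hfr v hvt
  have h3 : (fun i => pd i (gauge K) x₀) ⬝ᵥ (fun i => v i) = 0 := by
    rw [← hv, inner_eq_dotProduct]
    simp only [conormal, gradient_apply]
  rw [e1, sub_mulVec, hessSq_eq hK.smoothOff_gauge.two hx₀0, hone, one_smul, add_mulVec,
    vecMulVec_mulVec, h3, MulOpposite.op_zero, zero_smul, zero_add, dotProduct_sub,
    smul_mulVec, one_mulVec, dotProduct_smul, ← hK.boundaryMetric_eq hx₀0,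
    ← inner_eq_dotProduct, smul_eq_mul] at h1
  have hvv : 0 < ⟪v, v⟫ := real_inner_self_pos.2 hv0
  have h4 : c ≤ 1 / A := le_of_mul_le_mul_right (by linarith) hvv
  rw [hc, one_div_le_one_div (by positivity) hA] at h4
  have h5 : ‖x₀‖ ≤ R := by simpa using hR hx₀
  nlinarith

/-- The centro-affine metric on the boundary is the restriction of the inverse Hessian of `h_K² /
2`. -/
theorem boundaryMetric_eq_hessInv (hx : x ∈ frontier K) {u : E n} (hu : u ∈ tangent K x) :
    boundaryMetric K x u u = (fun i => u i) ⬝ᵥ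
      hessInv (supp K) (gradient (fun x => gauge K x ^ 2 / 2) x) *ᵥ fun i => u i := by
  have hx0 := hK.ne_zero_of_frontier hx
  have h3 : (fun i => pd i (gauge K) x) ⬝ᵥ (fun i => u i) = 0 := by
    rw [← (hK.mem_tangent hx0).1 hu, inner_eq_dotProduct]
    simp only [conormal, gradient_apply]
  rw [hK.hessInv_supp hx0, hessSq_eq hK.smoothOff_gauge.two hx0, hK.gauge_eq_one.2 hx, one_smul,
    add_mulVec, vecMulVec_mulVec, h3, MulOpposite.op_zero, zero_smul, zero_add,
    hK.boundaryMetric_eq hx0]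

omit hK in
theorem _root_.CentroAffine.legendre_eq_conormal (hK : IsSmoothEvenBody K)
    (hx : x ∈ frontier K) : gradient (fun x => gauge K x ^ 2 / 2) x = conormal K x := by
  ext i
  rw [conormal, gradient_apply, gradient_apply,
    pd_half_sq hK.smoothOff_gauge.one (hK.ne_zero_of_frontier hx), hK.gauge_eq_one.2 hx, one_mul]

/-- Up to scaling, every direction is the conormal of a boundary point. -/
theorem exists_conormal_eq (hy : y ≠ 0) :
    ∃ x ∈ frontier K, conormal K x = (supp K y)⁻¹ • y := by
  have hp := hK.supp_pos hy
  obtain ⟨x, hx, hxy⟩ := hK.exists_legendre_eq (smul_ne_zero (inv_ne_zero hp.ne') hy)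
  have h1 : gauge K x = 1 := by
    rw [← hK.supp_legendre hx, hxy, hK.isPotential_supp.hom _ (inv_pos.2 hp) y hy, zpow_one,
      inv_mul_cancel₀ hp.ne']
  have hfr := hK.gauge_eq_one.1 h1
  exact ⟨x, hfr, by rw [← legendre_eq_conormal hK hfr, hxy]⟩

/-- The metric bounds for a linear image of the body, in terms of the support function. -/
theorem hessInv_bounds (T : E n ≃L[ℝ] E n) {a b : ℝ} (hmet : MetricBetween (T '' K) a b)
    (hy : y ≠ 0) {u : E n} (hu : ⟪y, u⟫ = 0) :
    a * ⟪T u, T u⟫ ≤ (fun i => u i) ⬝ᵥ hessInv (supp K) y *ᵥ (fun i => u i) ∧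
    (fun i => u i) ⬝ᵥ hessInv (supp K) y *ᵥ (fun i => u i) ≤ b * ⟪T u, T u⟫ := by
  have hp := hK.supp_pos hy
  obtain ⟨x, hx, hxy⟩ := hK.exists_conormal_eq hy
  have hx0 := hK.ne_zero_of_frontier hx
  have hcu : ⟪conormal K x, u⟫ = 0 := by rw [hxy, real_inner_smul_left, hu, mul_zero]
  have h1 := hmet (T x) (by rw [frontier_image]; exact ⟨x, hx, rfl⟩) (T u)
    (mem_tangent_image T hcu)
  have e1 : hessInv (supp K) ((supp K y)⁻¹ • y) = hessInv (supp K) y := by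
    rw [hessInv, hK.isPotential_supp.hessSq_smul (inv_pos.2 hp) hy, hessInv]
  rwa [hK.boundaryMetric_image T hx0, hK.boundaryMetric_eq_hessInv hx ((hK.mem_tangent hx0).2 hcu),
    legendre_eq_conormal hK hx, hxy, e1] at h1

theorem norm_image_grad_supp_le (T : E n ≃L[ℝ] E n) {R : ℝ} (hR : T '' K ⊆ closedBall 0 R)
    (hy : y ≠ 0) : ‖T (gradient (supp K) y)‖ ≤ R := by
  have hp := hK.supp_pos hy
  obtain ⟨x, hx, hxy⟩ := hK.exists_conormal_eq hy
  have hx0 := hK.ne_zero_of_frontier hx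
  have hy' : (supp K y)⁻¹ • y ≠ 0 := smul_ne_zero (inv_ne_zero hp.ne') hy
  have h1 : gradient (supp K) y = x := by
    ext j
    have h2 := hK.pd_half_sq_supp_legendre hx0 j
    rw [legendre_eq_conormal hK hx, hxy, pd_half_sq hK.smoothOff_supp.one hy',
      hK.isPotential_supp.hom _ (inv_pos.2 hp) y hy, zpow_one, inv_mul_cancel₀ hp.ne',
      one_mul] at h2
    rw [gradient_apply, ← h2, (hK.isPotential_supp.hom.pd j) _ (inv_pos.2 hp) y hy]
    simp
  rw [h1]
  have : x ∈ K := hK.gauge_le_one.1 (hK.gauge_eq_one.2 hx).le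
  simpa using hR ⟨x, this, rfl⟩

/-- Bounds for the second fundamental form, in terms of the support function. -/
theorem hess_supp_bounds {r R : ℝ} (hr : 0 < r) (hR : 0 < R)
    (hII : SecondFormBetween K (1 / R) (1 / r)) {w : E n} (hy : y ≠ 0) (hw : ⟪y, w⟫ = 0) :
    r * ‖w‖ ^ 2 ≤ ‖y‖ * ((fun i => w i) ⬝ᵥ hess (supp K) y *ᵥ fun i => w i) ∧
    ‖y‖ * ((fun i => w i) ⬝ᵥ hess (supp K) y *ᵥ fun i => w i) ≤ R * ‖w‖ ^ 2 := by
  have hp := hK.supp_pos hy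
  have hpot := hK.isPotential_supp
  obtain ⟨x, hx, hxy⟩ := hK.exists_conormal_eq hy
  have hx0 := hK.ne_zero_of_frontier hx
  -- by homogeneity, it suffices to consider the conormal at a boundary point
  have hsupp : supp K (conormal K x) = 1 := by
    rw [← legendre_eq_conormal hK hx, hK.supp_legendre hx0, hK.gauge_eq_one.2 hx]
  set y' := conormal K x with hy'
  have hy'0 : y' ≠ 0 := hK.conormal_ne_zero hx0
  have hwy' : ⟪y', w⟫ = 0 := by rw [hxy, real_inner_smul_left, hw, mul_zero]
  have hH : hess (supp K) y = (supp K y)⁻¹ • hess (supp K) y' := by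
    ext i j
    have h1 := ((hpot.hom.pd j).pd i) _ (inv_pos.2 hp) y hy
    have h2 : (supp K y)⁻¹ ^ ((1 : ℤ) - 1 - 1) = supp K y := by simp
    rw [h2] at h1
    simp only [hess, Matrix.smul_apply, of_apply, smul_eq_mul]
    rw [hxy, h1]
    field_simp
  have hn : ‖y‖ * (supp K y)⁻¹ = ‖y'‖ := by
    rw [hxy, norm_smul, Real.norm_of_nonneg (inv_pos.2 hp).le, mul_comm]
  rw [hH, smul_mulVec, dotProduct_smul, smul_eq_mul, ← mul_assoc, hn]
  have hc := norm_pos_iff.2 hy'0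
  set P := hess (gauge K) x with hP
  set H := hess (supp K) y' with hHdef
  let u : E n := WithLp.toLp 2 (H *ᵥ fun i => w i)
  have hu : (fun i => u i) = H *ᵥ fun i => w i := rfl
  have hHt : Hᵀ = H := hess_transpose hpot.smooth.two hy'0
  have hPt : Pᵀ = P := hess_transpose hK.smoothOff_gauge.two hx0
  have huy : ⟪y', u⟫ = 0 := by
    rw [inner_eq_dotProduct, hu, dotProduct_mulVec, ← mulVec_transpose, hHt,
      hess_mulVec_self hpot.smooth.two hpot.hom hy'0, zero_dotProduct]
  have hgrad : (fun i => pd i (gauge K) x) = fun i => y' i := by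
    funext i; rw [hy', conormal, gradient_apply]
  -- `P u = w - c y'` for some constant `c`
  have hPu : ∃ c : ℝ, P *ᵥ (fun i => u i) = (fun i => w i) - c • fun i => y' i := by
    have h1 := congrArg (· *ᵥ fun i => w i) (hK.hessSq_gauge_mul hx0)
    simp only [one_mulVec, legendre_eq_conormal hK hx] at h1
    have hpdx : (fun i => pd i (supp K) y') = fun i => x i := by
      funext i
      have h2 := hK.pd_half_sq_supp_legendre hx0 i
      rw [legendre_eq_conormal hK hx, pd_half_sq hpot.smooth.one hy'0, hsupp, one_mul] at h2
      exact h2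
    rw [← hy', ← mulVec_mulVec, hessSq_eq hpot.smooth.two hy'0, hsupp, one_smul, add_mulVec,
      vecMulVec_mulVec, hpdx, hessSq_eq hK.smoothOff_gauge.two hx0, hK.gauge_eq_one.2 hx, one_smul,
      hgrad, ← hHdef, ← hu, ← hP, add_mulVec, mulVec_add, mulVec_add, vecMulVec_mulVec,
      vecMulVec_mulVec, mulVec_smul, hK.hess_mulVec hx0 |> fun h => (hP ▸ h : P *ᵥ _ = 0),
      ← inner_eq_dotProduct y' u, huy] at h1
    refine ⟨((fun i => y' i) ⬝ᵥ (MulOpposite.op ((fun i => x i) ⬝ᵥ fun i => w i) •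
      fun i => x i)), ?_⟩
    rw [eq_sub_iff_add_eq]
    refine Eq.trans ?_ h1
    simp only [MulOpposite.op_zero, zero_smul, smul_zero, add_zero, zero_add, op_smul_eq_smul]
    exact add_comm _ _
  obtain ⟨c, hPu⟩ := hPu
  have hform : ∀ v : E n, ⟪y', v⟫ = 0 → 1 / R * ‖v‖ ^ 2 ≤
      ‖y'‖⁻¹ * ((fun i => v i) ⬝ᵥ P *ᵥ fun i => v i) ∧
      ‖y'‖⁻¹ * ((fun i => v i) ⬝ᵥ P *ᵥ fun i => v i) ≤ 1 / r * ‖v‖ ^ 2 := fun v hv => by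
    have hvt : v ∈ tangent K x := (hK.mem_tangent hx0).2 hv
    have h1 := hII x hx v hvt
    rwa [hK.secondForm_eq hx0 v hvt, hK.boundaryMetric_eq hx0, real_inner_self_eq_norm_sq] at h1
  have ha : (fun i => u i) ⬝ᵥ P *ᵥ (fun i => u i) = (fun i => w i) ⬝ᵥ H *ᵥ fun i => w i := by
    rw [hPu, dotProduct_sub, dotProduct_smul, dotProduct_comm _ (fun i => y' i),
      ← inner_eq_dotProduct y' u, huy, smul_zero, sub_zero, dotProduct_comm, hu]
  have hb : (fun i => w i) ⬝ᵥ P *ᵥ (fun i => u i) = ‖w‖ ^ 2 := by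
    rw [hPu, dotProduct_sub, dotProduct_smul, dotProduct_comm _ (fun i => y' i),
      ← inner_eq_dotProduct y' w, hwy', smul_zero, sub_zero, ← inner_eq_dotProduct,
      real_inner_self_eq_norm_sq]
  have hb' : (fun i => u i) ⬝ᵥ P *ᵥ (fun i => w i) = ‖w‖ ^ 2 := by
    rw [← hb, dotProduct_mulVec, ← mulVec_transpose, hPt, dotProduct_comm]
  set a := (fun i => w i) ⬝ᵥ H *ᵥ fun i => w i with hadef
  constructor
  · -- positivity of the form at `u - t w`, with `t = r / ‖y'‖`
    set t := r / ‖y'‖ with ht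
    have h1 := (hform (u - t • w) (by
      rw [inner_sub_right, real_inner_smul_right, huy, hwy']; ring)).1
    have h2 : 0 ≤ (fun i => (u - t • w) i) ⬝ᵥ P *ᵥ fun i => (u - t • w) i := by
      have : 0 ≤ 1 / R * ‖u - t • w‖ ^ 2 := by positivity
      exact (mul_nonneg_iff_of_pos_left (inv_pos.2 hc)).1 (this.trans h1)
    have e : (fun i => (u - t • w) i) = (fun i => u i) - t • fun i => w i := rfl
    have h3 := (hform w hwy').2
    rw [inv_mul_le_iff₀ hc] at h3
    rw [e, mulVec_sub, mulVec_smul, sub_dotProduct, dotProduct_sub, dotProduct_sub, dotProduct_smul,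
      smul_dotProduct, smul_dotProduct, dotProduct_smul, ha, hb, hb'] at h2
    simp only [smul_eq_mul] at h2
    have h4 : t * (t * ((fun i => w i) ⬝ᵥ P *ᵥ fun i => w i)) ≤ t * ‖w‖ ^ 2 := by
      refine mul_le_mul_of_nonneg_left ?_ (by positivity)
      calc t * ((fun i => w i) ⬝ᵥ P *ᵥ fun i => w i) ≤ t * (‖y'‖ * (1 / r * ‖w‖ ^ 2)) :=
            mul_le_mul_of_nonneg_left h3 (by positivity)
        _ = ‖w‖ ^ 2 := by rw [ht]; field_simp
    have h5 : t * ‖w‖ ^ 2 ≤ a := by linarith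
    rw [ht, div_mul_eq_mul_div, div_le_iff₀ hc] at h5
    linarith
  · have h1 := (hform u huy).1
    rw [ha, le_inv_mul_iff₀ hc] at h1
    have h2 : ⟪w, u⟫ = a := by rw [inner_eq_dotProduct, hu]
    -- nonnegativity of `‖w - s u‖²`, with `s = ‖y'‖ / R`
    set s := ‖y'‖ / R with hs
    have h3 := sq_nonneg ‖w - s • u‖
    rw [norm_sub_sq_real, norm_smul, real_inner_smul_right, h2, mul_pow, Real.norm_eq_abs, sq_abs]
      at h3
    have h4 : s ^ 2 * ‖u‖ ^ 2 ≤ s * a := by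
      have : s * ‖u‖ ^ 2 ≤ a := by
        refine le_of_eq_of_le ?_ h1
        rw [hs]; ring
      have hs0 : 0 ≤ s := by positivity
      nlinarith
    have h5 : s * a ≤ ‖w‖ ^ 2 := by linarith
    rw [hs, div_mul_eq_mul_div, div_le_iff₀ hR] at h5
    linarith

/-- Blaschke's rolling theorem at the level of support functions: the body contains the ball of
radius `r` and is contained in the ball of radius `R`. -/
theorem supp_bounds (hn : 2 ≤ n) {r R : ℝ} (hr : 0 < r) (hR : 0 < R)
    (hII : SecondFormBetween K (1 / R) (1 / r)) (hy : y ≠ 0) :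
    r * ‖y‖ ≤ supp K y ∧ supp K y ≤ R * ‖y‖ := by
  have hpot := hK.isPotential_supp
  have hpn : IsPotential fun y : E n => ‖y‖ := isPotential_norm
  have hlin : ∀ c d : ℝ, ∀ z w : E n, z ≠ 0 →
      (fun i => w i) ⬝ᵥ hess (fun y => c * ‖y‖ + d * supp K y) z *ᵥ (fun i => w i) =
      c * ((fun i => w i) ⬝ᵥ hess (fun y : E n => ‖y‖) z *ᵥ fun i => w i) +
      d * ((fun i => w i) ⬝ᵥ hess (supp K) z *ᵥ fun i => w i) := fun c d z w hz => by
    have e : hess (fun y => c * ‖y‖ + d * supp K y) z =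
        c • hess (fun y : E n => ‖y‖) z + d • hess (supp K) z := by
      ext i j
      have h1 : pd i (pd j fun y => c * ‖y‖ + d * supp K y) z =
          pd i (fun y => c * pd j (fun y : E n => ‖y‖) y + d * pd j (supp K) y) z :=
        pd_congr (fun z hz => by
          rw [pd_add j ((SmoothOff.const _).mul hpn.smooth.one)
            ((SmoothOff.const _).mul hpot.smooth.one) hz, pd_const_mul, pd_const_mul]) i hz
      rw [pd_add i ((SmoothOff.const _).mul (hpn.smooth.pd_top j).one)
        ((SmoothOff.const _).mul (hpot.smooth.pd_top j).one) hz, pd_const_mul, pd_const_mul] at h1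
      exact h1
    rw [e, add_mulVec, smul_mulVec, smul_mulVec, dotProduct_add, dotProduct_smul, dotProduct_smul,
      smul_eq_mul, smul_eq_mul]
  have key : ∀ c d : ℝ, (∀ z w : E n, z ≠ 0 → ⟪z, w⟫ = 0 → 0 ≤ c * ‖w‖ ^ 2 +
      d * (‖z‖ * ((fun i => w i) ⬝ᵥ hess (supp K) z *ᵥ fun i => w i))) →
      0 ≤ c * ‖y‖ + d * supp K y := fun c d h => by
    refine nonneg_of_hess_nonneg (f := fun y => c * ‖y‖ + d * supp K y) hn
      (((SmoothOff.const _).mul hpn.smooth).add ((SmoothOff.const _).mul hpot.smooth)).two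
      ((hpn.hom.const_mul c).add (hpot.hom.const_mul d)) (fun y => ?_) (fun z w hz hzw => ?_) hy
    · rw [norm_neg, hpot.even]
    · have h1 := h z w hz hzw
      rw [hlin c d z w hz]
      rw [← norm_mul_hess_norm hz hzw] at h1
      refine (mul_nonneg_iff_of_pos_left (norm_pos_iff.2 hz)).1 (h1.trans (le_of_eq ?_))
      ring
  constructor
  · have := key (-r) 1 fun z w hz hzw => by
      have := (hK.hess_supp_bounds hr hR hII hz hzw).1; linarith
    linarith
  · have := key R (-1) fun z w hz hzw => by
      have := (hK.hess_supp_bounds hr hR hII hz hzw).2; linarith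
    linarith

theorem subset_closedBall_of_secondForm (hn : 2 ≤ n) {r R : ℝ} (hr : 0 < r) (hR : 0 < R)
    (hII : SecondFormBetween K (1 / R) (1 / r)) : K ⊆ closedBall 0 R := fun x hx => by
  rw [mem_closedBall_zero_iff]
  rcases eq_or_ne x 0 with rfl | hx0
  · simpa using hR.le
  have h1 := (hK.inner_le_supp x hx).trans (hK.supp_bounds hn hr hR hII hx0).2
  rw [real_inner_self_eq_norm_sq, sq] at h1
  exact le_of_mul_le_mul_right h1 (norm_pos_iff.2 hx0)

/-- The centro-affine metric is the second fundamental form multiplied by the length of the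
conormal, which lies between `1 / R` and `1 / r` by the bounds on the support function. -/
theorem metricBetween_of_secondForm (hn : 2 ≤ n) {r R : ℝ} (hr : 0 < r) (hR : 0 < R)
    (hII : SecondFormBetween K (1 / R) (1 / r)) : MetricBetween K (1 / R ^ 2) (1 / r ^ 2) := by
  intro x hx u hu
  have hx0 := hK.ne_zero_of_frontier hx
  have h1 := hII x hx u hu
  have h2 := hK.supp_bounds hn hr hR hII (hK.conormal_ne_zero hx0)
  have hc := norm_pos_iff.2 (hK.conormal_ne_zero hx0)
  have hsupp : supp K (conormal K x) = 1 := by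
    rw [← legendre_eq_conormal hK hx, hK.supp_legendre hx0, hK.gauge_eq_one.2 hx]
  rw [hsupp] at h2
  rw [hK.secondForm_eq hx0 u hu, le_inv_mul_iff₀ hc, inv_mul_le_iff₀ hc] at h1
  have huu : 0 ≤ ⟪u, u⟫ := real_inner_self_nonneg
  have h3 : ‖conormal K x‖ ≤ 1 / r := by rw [le_div_iff₀ hr]; linarith [h2.1]
  have h4 : 1 / R ≤ ‖conormal K x‖ := by rw [div_le_iff₀ hR]; linarith [h2.2]
  constructor
  · refine le_trans ?_ h1.1
    have := mul_le_mul_of_nonneg_right h4 (show 0 ≤ 1 / R * ⟪u, u⟫ by positivity)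
    refine le_trans (le_of_eq ?_) this
    rw [sq]; field_simp
  · refine h1.2.trans ?_
    have := mul_le_mul_of_nonneg_right h3 (show 0 ≤ 1 / r * ⟪u, u⟫ by positivity)
    refine this.trans (le_of_eq ?_)
    rw [sq]; field_simp

end IsSmoothEvenBody

/-! ### Tangential calculus on the sphere -/

section Tangential

open Matrix

variable {h f : E n → ℝ} {z : Sph n → ℝ} {θ : Sph n}

theorem norm_sph (θ : Sph n) : ‖(θ : E n)‖ = 1 := by simp

theorem coe_proj (θ : Sph n) (x : E n) :
    ((TS θ).orthogonalProjectionOnto x : E n) = x - ⟪(θ : E n), x⟫ • (θ : E n) := by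
  rw [Submodule.orthogonalProjectionOnto_orthogonal]
  simp only [Submodule.starProjection_unit_singleton ℝ (norm_sph θ)]

theorem mem_TS {u : E n} : u ∈ TS θ ↔ ⟪(θ : E n), u⟫ = 0 :=
  Submodule.mem_orthogonal_singleton_iff_inner_right

theorem proj_coe (u : TS θ) : (TS θ).orthogonalProjectionOnto (u : E n) = u :=
  Submodule.orthogonalProjectionOnto_mem_subspace_eq_self u

theorem fderiv_gradient_eq (hf : SmoothOff 2 f) {x : E n} (hx : x ≠ 0) (v : E n) :
    fderiv ℝ (gradient f) x v = toLpLin 2 2 (hess f x) v := by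
  ext j
  rw [fderiv_gradient_apply hf hx, toLpLin_apply]
  simp only [mulVec, dotProduct, hess, of_apply]
  exact Finset.sum_congr rfl fun i _ => by rw [mul_comm, pd_comm hf i j hx]

theorem D2_apply (hf : SmoothOff 2 f) (u : TS θ) :
    D2 f θ u = (TS θ).orthogonalProjectionOnto (toLpLin 2 2 (hess f θ) (u : E n)) := by
  rw [← fderiv_gradient_eq hf (sph_ne_zero θ)]
  rfl

theorem toLpLin_hess_sph (hf : SmoothOff 2 f) (hf1 : Hom 1 f) :
    toLpLin 2 2 (hess f θ) (θ : E n) = 0 := by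
  rw [toLpLin_apply]
  have := hess_mulVec_self hf hf1 (sph_ne_zero θ)
  ext i
  exact congrFun this i

theorem inner_toLpLin (A : Matrix (Fin n) (Fin n) ℝ) (u v : E n) :
    ⟪u, toLpLin 2 2 A v⟫ = (fun i => u i) ⬝ᵥ A *ᵥ fun i => v i := by
  rw [inner_eq_dotProduct]; rfl

theorem inner_toLpLin_symm {A : Matrix (Fin n) (Fin n) ℝ} (hA : Aᵀ = A) (u v : E n) :
    ⟪u, toLpLin 2 2 A v⟫ = ⟪toLpLin 2 2 A u, v⟫ := by
  rw [real_inner_comm v, inner_toLpLin, inner_toLpLin, dotProduct_mulVec, ← mulVec_transpose, hA,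
    dotProduct_comm]

variable (hh : IsPotential h)

/-- The compression of `h P⁻¹`, `P = D²(h² / 2)`, to the tangent space is the inverse of
`D² h`. -/
def D2Inv (h : E n → ℝ) (θ : Sph n) : Module.End ℝ (TS θ) :=
  h θ • ((TS θ).orthogonalProjectionOnto.toLinearMap ∘ₗ toLpLin 2 2 (hessInv h θ) ∘ₗ
    (TS θ).subtype)

include hh in
/-- On vectors orthogonal to `Dh`, which contain the image of the tangent space under `P⁻¹`, the
Hessian `P` reduces to `h D²h`. -/
theorem IsPotential.D2_mul_D2Inv : D2 h θ * D2Inv h θ = 1 := by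
  have hθ := sph_ne_zero θ
  have hs2 := hh.smooth.two
  refine LinearMap.ext fun u => ?_
  have hu : ⟪(θ : E n), (u : E n)⟫ = 0 := mem_TS.1 u.2
  set v : E n := toLpLin 2 2 (hessInv h θ) (u : E n) with hv
  set a : E n := gradient h θ with ha
  have ha' : (fun i => pd i h θ) = fun i => a i := funext fun i => (gradient_apply h θ i).symm
  have hav : (fun i => a i) ⬝ᵥ (fun i => v i) = 0 := by
    have h1 : (fun i => v i) = hessInv h θ *ᵥ fun i => (u : E n) i := rfl
    rw [h1, dotProduct_mulVec, ← mulVec_transpose, hh.hessInv_transpose hθ, ← ha',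
      hh.hessInv_mulVec_pd hθ, smul_dotProduct, ← inner_eq_dotProduct, hu, smul_zero]
  have h2 : h θ • toLpLin 2 2 (hess h θ) v = (u : E n) := by
    ext i
    have h3 : hessSq h θ *ᵥ (fun i => v i) = fun i => (u : E n) i := by
      have h1 : (fun i => v i) = hessInv h θ *ᵥ fun i => (u : E n) i := rfl
      rw [h1, mulVec_mulVec, hh.hessSq_mul_hessInv hθ, one_mulVec]
    rw [hessSq_eq hs2 hθ, add_mulVec, vecMulVec_mulVec, ha', hav, MulOpposite.op_zero, zero_smul,
      zero_add, smul_mulVec] at h3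
    exact congrFun h3 i
  rw [Module.End.mul_apply, Module.End.one_apply, D2Inv, LinearMap.smul_apply, map_smul]
  have e1 : D2 h θ ((TS θ).orthogonalProjectionOnto v) =
      (TS θ).orthogonalProjectionOnto (toLpLin 2 2 (hess h θ) v) := by
    rw [D2_apply hs2, coe_proj, map_sub, map_smul, toLpLin_hess_sph hs2 hh.hom, smul_zero,
      sub_zero]
  have e2 : (h θ) • D2 h θ ((TS θ).orthogonalProjectionOnto v) = u := by
    rw [e1, ← map_smul, h2, proj_coe]
  exact e2

include hh in
theorem IsPotential.inverse_D2 : Ring.inverse (D2 h θ) = D2Inv h θ := by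
  have h1 := hh.D2_mul_D2Inv (θ := θ)
  have h2 : D2Inv h θ * D2 h θ = 1 := mul_eq_one_comm.1 h1
  exact Ring.inverse_unit (⟨D2 h θ, D2Inv h θ, h1, h2⟩ : (Module.End ℝ (TS θ))ˣ)

include hh in
theorem IsPotential.inverse_smul_D2 : Ring.inverse ((h θ)⁻¹ • D2 h θ) = h θ • D2Inv h θ := by
  have h0 := hh.ne_zero _ (sph_ne_zero θ)
  have h1 := hh.D2_mul_D2Inv (θ := θ)
  have h3 : ((h θ)⁻¹ • D2 h θ) * (h θ • D2Inv h θ) = 1 := by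
    rw [smul_mul_smul_comm, inv_mul_cancel₀ h0, h1, one_smul]
  exact Ring.inverse_unit (⟨_, _, h3, mul_eq_one_comm.1 h3⟩ : (Module.End ℝ (TS θ))ˣ)

theorem finrank_TS (θ : Sph n) : Module.finrank ℝ (TS θ) + 1 = n := by
  have h1 := Submodule.finrank_add_finrank_orthogonal (Submodule.span ℝ {(θ : E n)})
  rw [finrank_span_singleton (sph_ne_zero θ), finrank_euclideanSpace, Fintype.card_fin] at h1
  exact (add_comm _ _).trans h1

/-- The decomposition of the Euclidean space into a radial and a tangential part. -/
def radialEquiv (θ : Sph n) : (ℝ × TS θ) ≃ₗ[ℝ] E n where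
  toFun p := p.1 • (θ : E n) + p.2
  invFun x := (⟪(θ : E n), x⟫, (TS θ).orthogonalProjectionOnto x)
  map_add' p q := by simp only [Prod.fst_add, Prod.snd_add, Submodule.coe_add]; module
  map_smul' c p := by
    simp only [Prod.smul_fst, Prod.smul_snd, Submodule.coe_smul, RingHom.id_apply, smul_eq_mul]
    module
  left_inv p := by
    have h1 : ⟪(θ : E n), (p.2 : E n)⟫ = 0 := mem_TS.1 p.2.2
    have h2 : ⟪(θ : E n), p.1 • (θ : E n) + p.2⟫ = p.1 := by
      rw [inner_add_right, real_inner_smul_right, h1, real_inner_self_eq_norm_sq, norm_sph]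
      ring
    refine Prod.ext h2 (Subtype.ext ?_)
    rw [coe_proj, h2, add_sub_cancel_left]
  right_inv x := by
    simp only [coe_proj]
    module

include hh in
/-- `det D²(h² / 2) = h^{n+1} det D²h` on the sphere: up to unipotent factors, `D²(h² / 2)` is
block diagonal with blocks `h²` and `h D²h`. -/
theorem IsPotential.det_hessSq_eq :
    (hessSq h θ).det = h θ ^ (n + 1) * LinearMap.det (D2 h θ) := by
  have hθ := sph_ne_zero θ
  have hs2 := hh.smooth.two
  have h0 := hh.ne_zero _ hθ
  set a : E n := gradient h θ with ha
  have ha' : (fun i => pd i h θ) = fun i => a i := funext fun i => (gradient_apply h θ i).symm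
  have haθ : ⟪(θ : E n), a⟫ = h θ := by
    rw [inner_eq_dotProduct, ← ha', dotProduct]; exact hh.sum_mul_pd hθ
  -- the tangential part of the gradient
  set τ : E n := a - h θ • (θ : E n) with hτ
  have hτθ : ⟪(θ : E n), τ⟫ = 0 := by
    rw [hτ, inner_sub_right, haθ, real_inner_smul_right, real_inner_self_eq_norm_sq, norm_sph]
    ring
  let B : E n →ₗ[ℝ] E n :=
    LinearMap.transvection ((h θ)⁻¹ • (innerSL ℝ τ).toLinearMap) (θ : E n)
  let B' : E n →ₗ[ℝ] E n :=
    LinearMap.transvection ((h θ)⁻¹ • (innerSL ℝ (θ : E n)).toLinearMap) τ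
  have hB : LinearMap.det B = 1 := by
    rw [LinearMap.transvection.det]
    simp [real_inner_comm, hτθ]
  have hB' : LinearMap.det B' = 1 := by
    rw [LinearMap.transvection.det]
    simp [hτθ]
  let D : (ℝ × TS θ) →ₗ[ℝ] (ℝ × TS θ) :=
    LinearMap.prodMap (h θ ^ 2 • (1 : Module.End ℝ ℝ)) (h θ • D2 h θ)
  let e := radialEquiv θ
  have hfac : toLpLin 2 2 (hessSq h θ) =
      B' ∘ₗ ((e : (ℝ × TS θ) →ₗ[ℝ] E n) ∘ₗ D ∘ₗ (e.symm : E n →ₗ[ℝ] (ℝ × TS θ))) ∘ₗ B := by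
    refine LinearMap.ext fun x => ?_
    have hBx : B x = x + ((h θ)⁻¹ * ⟪τ, x⟫) • (θ : E n) := rfl
    have hB'x : ∀ y, B' y = y + ((h θ)⁻¹ * ⟪(θ : E n), y⟫) • τ := fun y => rfl
    have hD : ∀ y, e (D (e.symm y)) = (h θ ^ 2 * ⟪(θ : E n), y⟫) • (θ : E n) +
        h θ • toLpLin 2 2 (hess h θ) y := by
      intro y
      have e1 : e (D (e.symm y)) = (h θ ^ 2 * ⟪(θ : E n), y⟫) • (θ : E n) +
        ((h θ • D2 h θ ((TS θ).orthogonalProjectionOnto y) : TS θ) : E n) := rfl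
      have e2 : ⟪(θ : E n), toLpLin 2 2 (hess h θ) y⟫ = 0 := by
        rw [inner_toLpLin_symm (hess_transpose hs2 hθ), toLpLin_hess_sph hs2 hh.hom,
          inner_zero_left]
      rw [e1, Submodule.coe_smul, D2_apply hs2, coe_proj θ y, map_sub, map_smul,
        toLpLin_hess_sph hs2 hh.hom, smul_zero, sub_zero, coe_proj, e2, zero_smul, sub_zero]
    have hPx : toLpLin 2 2 (hessSq h θ) x = ⟪a, x⟫ • a + h θ • toLpLin 2 2 (hess h θ) x := by
      ext i
      have h1 : hessSq h θ *ᵥ (fun i => x i) =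
          ⟪a, x⟫ • (fun i => a i) + h θ • hess h θ *ᵥ fun i => x i := by
        rw [hessSq_eq hs2 hθ, add_mulVec, vecMulVec_mulVec, ha', smul_mulVec, op_smul_eq_smul,
          ← inner_eq_dotProduct]
      exact congrFun h1 i
    have e2 : ⟪(θ : E n), toLpLin 2 2 (hess h θ) x⟫ = 0 := by
      rw [inner_toLpLin_symm (hess_transpose hs2 hθ), toLpLin_hess_sph hs2 hh.hom,
        inner_zero_left]
    have e3 : ⟪(θ : E n), (θ : E n)⟫ = 1 := by
      rw [real_inner_self_eq_norm_sq, norm_sph]; norm_num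
    have e4 : ⟪a, x⟫ = h θ * ⟪(θ : E n), x⟫ + ⟪τ, x⟫ := by
      rw [hτ, inner_sub_left, real_inner_smul_left]; ring
    have e5 : h θ • toLpLin 2 2 (hess h θ) (B x) = h θ • toLpLin 2 2 (hess h θ) x := by
      rw [hBx, map_add, map_smul, toLpLin_hess_sph hs2 hh.hom, smul_zero, add_zero]
    have e6 : ⟪(θ : E n), B x⟫ = ⟪(θ : E n), x⟫ + (h θ)⁻¹ * ⟪τ, x⟫ := by
      rw [hBx, inner_add_right, real_inner_smul_right, e3, mul_one]
    have e7 : h θ ^ 2 * ⟪(θ : E n), B x⟫ = h θ * ⟪a, x⟫ := by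
      rw [e6, e4]; field_simp
    have e8 : (⟪a, x⟫ : ℝ) • a = (h θ * ⟪a, x⟫) • (θ : E n) + ⟪a, x⟫ • τ := by
      rw [hτ]; module
    simp only [LinearMap.comp_apply, LinearEquiv.coe_coe]
    rw [hB'x, hD, e5, e7, hPx, inner_add_right, real_inner_smul_right, real_inner_smul_right, e2,
      e3, e8]
    have e9 : (h θ)⁻¹ * (h θ * ⟪a, x⟫ * 1 + h θ * 0) = ⟪a, x⟫ := by field_simp; ring
    rw [e9]
    abel
  have hdet : (hessSq h θ).det = LinearMap.det (toLpLin 2 2 (hessSq h θ)) :=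
    (LinearMap.det_toLin (PiLp.basisFun 2 ℝ (Fin n)) (hessSq h θ)).symm
  rw [hdet, hfac, LinearMap.det_comp, LinearMap.det_comp, hB, hB', LinearMap.det_conj,
    LinearMap.det_prodMap, LinearMap.det_smul, LinearMap.det_smul]
  have hfr := finrank_TS θ
  have h2 : h θ ^ (n + 1) = h θ ^ 2 * h θ ^ Module.finrank ℝ (TS θ) := by
    rw [← pow_add]; congr 1; omega
  rw [h2]
  simp
  ring

include hh in
theorem IsPotential.weight_eq : weight h θ = h θ * LinearMap.det (D2 h θ) := by
  have h0 := hh.ne_zero _ (sph_ne_zero θ)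
  rw [weight, hh.det_hessSq_eq, pow_succ, ← mul_assoc, ← mul_assoc, _root_.zpow_neg, zpow_natCast,
    inv_mul_cancel₀ (pow_ne_zero _ h0), one_mul]

theorem homExt_sph (z : Sph n → ℝ) (θ : Sph n) : homExt z θ = z θ := by
  rw [homExt, dif_neg (sph_ne_zero θ)]
  congr 1
  exact Subtype.ext (by simp)

theorem hom_homExt (z : Sph n → ℝ) : Hom 0 (homExt z) := by
  intro t ht y hy
  have hty : t • y ≠ 0 := smul_ne_zero ht.ne' hy
  rw [zpow_zero, one_mul, homExt, homExt, dif_neg hty, dif_neg hy]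
  congr 1
  refine Subtype.ext ?_
  simp only [norm_smul, Real.norm_of_nonneg ht.le, smul_smul]
  congr 1
  field_simp

theorem homExt_eq_of_hom (hf : Hom 0 f) {y : E n} (hy : y ≠ 0) :
    homExt (fun θ : Sph n => f θ) y = f y := by
  rw [homExt, dif_neg hy]
  have := hf ‖y‖⁻¹ (inv_pos.2 (norm_pos_iff.2 hy)) y hy
  simpa using this

theorem homExt_neg (hz : ∀ θ, z (-θ) = z θ) {y : E n} (hy : y ≠ 0) :
    homExt z (-y) = homExt z y := by
  rw [homExt, homExt, dif_neg (neg_ne_zero.2 hy), dif_neg hy, ← hz]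
  congr 1
  exact Subtype.ext (by simp)

include hh in
/-- The carré du champ is the squared gradient with respect to `D²h / h`. -/
theorem IsPotential.inner_inverse_sphGrad (hz : SmoothOff 2 (homExt z)) :
    ⟪Ring.inverse ((h θ)⁻¹ • D2 h θ) (sphGrad z θ), sphGrad z θ⟫ =
      carre h (homExt z) (homExt z) θ := by
  have hθ := sph_ne_zero θ
  have hg : ⟪(θ : E n), gradient (homExt z) θ⟫ = 0 := by
    rw [inner_eq_dotProduct]
    simp only [gradient_apply, dotProduct]
    exact (hom_homExt z).sum_mul_pd (hz.of_le (by norm_num)) hθ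
  have e1 : (sphGrad z θ : E n) = gradient (homExt z) θ := by
    rw [sphGrad, coe_proj, hg, zero_smul, sub_zero]
  rw [hh.inverse_smul_D2, D2Inv]
  simp only [LinearMap.smul_apply, LinearMap.comp_apply, smul_smul, real_inner_smul_left,
    Submodule.subtype_apply, e1]
  have e2 : ⟪(TS θ).orthogonalProjectionOnto (toLpLin 2 2 (hessInv h θ) (gradient (homExt z) θ)),
      sphGrad z θ⟫ = ⟪toLpLin 2 2 (hessInv h θ) (gradient (homExt z) θ),
      gradient (homExt z) θ⟫ := by
    rw [Submodule.coe_inner, coe_proj, e1, inner_sub_left, real_inner_smul_left, hg, mul_zero,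
      sub_zero]
  erw [e2]
  rw [real_inner_comm, inner_toLpLin, carre_eq_dotProduct]
  simp only [gradient_apply]
  ring

include hh in
/-- The Hilbert–Brunn–Minkowski operator in the two presentations. -/
theorem IsPotential.trace_inverse_D2_mul (hz : SmoothOff 2 (homExt z)) :
    LinearMap.trace ℝ (TS θ) (Ring.inverse (D2 h θ) * D2 (fun y => homExt z y * h y) θ) -
      ((n : ℝ) - 1) * z θ = lap h (homExt z) θ := by
  have hθ := sph_ne_zero θ
  have hs2 := hh.smooth.two
  have hz1 : SmoothOff 1 (homExt z) := hz.of_le (by norm_num)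
  have hz0 := hom_homExt z
  set F := homExt z with hF
  set G := conjHess h F θ with hG
  have hGθ : G *ᵥ (fun i => (θ : E n) i) = 0 := hh.conjHess_mulVec hz hz0 hθ
  have hGt : Gᵀ = G := conjHess_transpose hz hθ
  have hGθ' : toLpLin 2 2 G (θ : E n) = 0 := by
    rw [toLpLin_apply]; ext i; exact congrFun hGθ i
  have hprod : SmoothOff 2 fun y => F y * h y := hz.mul hs2
  have hhess : hess (fun y => F y * h y) θ = F θ • hess h θ + G := by
    ext i j
    have h1 : pd i (pd j fun y => F y * h y) θ =
        pd i (fun y => pd j F y * h y + F y * pd j h y) θ :=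
      pd_congr (fun y hy => pd_mul j hz1 hh.smooth.one hy) i hθ
    rw [pd_add i ((hz.pd_one j).mul hh.smooth.one) (hz1.mul (hs2.pd_one j)) hθ,
      pd_mul i (hz.pd_one j) hh.smooth.one hθ, pd_mul i hz1 (hs2.pd_one j) hθ] at h1
    simp only [hess, of_apply, h1, hG, conjHess, Matrix.add_apply, Matrix.smul_apply,
      vecMulVec_apply, smul_eq_mul]
    ring
  let π := (TS θ).orthogonalProjectionOnto.toLinearMap
  let ι := (TS θ).subtype
  have hD2 : D2 (fun y => F y * h y) θ = F θ • D2 h θ + π ∘ₗ toLpLin 2 2 G ∘ₗ ι := by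
    refine LinearMap.ext fun u => ?_
    rw [D2_apply hprod, hhess, map_add, map_smul, LinearMap.add_apply, LinearMap.smul_apply,
      map_add, map_smul, LinearMap.add_apply, LinearMap.smul_apply, D2_apply hs2]
    rfl
  have hιπ : ∀ x : E n, ι (π (toLpLin 2 2 G x)) = toLpLin 2 2 G x := fun x => by
    have h1 : ⟪(θ : E n), toLpLin 2 2 G x⟫ = 0 := by
      rw [inner_toLpLin_symm hGt, hGθ', inner_zero_left]
    change (((TS θ).orthogonalProjectionOnto (toLpLin 2 2 G x) : TS θ) : E n) = _
    rw [coe_proj, h1, zero_smul, sub_zero]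
  have h2 : D2Inv h θ * D2 h θ = 1 := mul_eq_one_comm.1 hh.D2_mul_D2Inv
  have h3 : D2Inv h θ * (π ∘ₗ toLpLin 2 2 G ∘ₗ ι) =
      h θ • (π ∘ₗ (toLpLin 2 2 (hessInv h θ * G) ∘ₗ ι)) := by
    refine LinearMap.ext fun u => ?_
    rw [D2Inv, Module.End.mul_apply, LinearMap.smul_apply, LinearMap.smul_apply]
    congr 1
    change π (toLpLin 2 2 (hessInv h θ) (ι (π (toLpLin 2 2 G (ι u))))) =
      π (toLpLin 2 2 (hessInv h θ * G) (ι u))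
    rw [hιπ]
    congr 1
    simp only [toLpLin_apply, mulVec_mulVec]
  have h4 : (toLpLin 2 2 (hessInv h θ * G) ∘ₗ ι) ∘ₗ π = toLpLin 2 2 (hessInv h θ * G) := by
    refine LinearMap.ext fun x => ?_
    change toLpLin 2 2 (hessInv h θ * G) (((TS θ).orthogonalProjectionOnto x : TS θ) : E n) = _
    have h5 : toLpLin 2 2 (hessInv h θ * G) (θ : E n) = 0 := by
      rw [toLpLin_apply]
      change WithLp.toLp 2 ((hessInv h θ * G) *ᵥ fun i => (θ : E n) i) = 0
      rw [← mulVec_mulVec, hGθ, mulVec_zero]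
      rfl
    rw [coe_proj, map_sub, map_smul, h5, smul_zero, sub_zero]
  have h6 : LinearMap.trace ℝ (E n) (toLpLin 2 2 (hessInv h θ * G)) = (hessInv h θ * G).trace := by
    rw [LinearMap.trace_eq_matrix_trace ℝ (PiLp.basisFun 2 ℝ (Fin n))]
    congr 1
    exact LinearMap.toMatrix_toLin _ _ _
  have hfr : ((Module.finrank ℝ (TS θ) : ℕ) : ℝ) = n - 1 := by
    have : ((Module.finrank ℝ (TS θ) : ℕ) : ℝ) + 1 = n := by exact_mod_cast finrank_TS θ
    linarith
  rw [hh.inverse_D2, hD2, mul_add, mul_smul_comm, h2, h3, map_add, map_smul, map_smul,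
    LinearMap.trace_one, LinearMap.trace_comp_comm', h4, h6, hfr, hG]
  have h7 := trace_mul_of_decomp (hh.hessInv_transpose hθ) (hh.hessInv_mulVec_pd hθ)
    (by rw [dotProduct_comm]; exact hz0.sum_mul_pd hz1 hθ)
    (smul_hess_eq (h := h) (z := F) (y := (θ : E n)))
  have h8 : F θ = z θ := homExt_sph z θ
  rw [h8, smul_eq_mul, smul_eq_mul, lap_eq_trace, ← h7]
  ring

end Tangential

/-! ### The measure and the operator of a convex body -/

theorem lap_congr {h f g : E n → ℝ} (hfg : ∀ y, y ≠ 0 → f y = g y) {y : E n} (hy : y ≠ 0) :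
    lap h f y = lap h g y := by
  simp only [lap, dualPd]
  congr 1
  exact Finset.sum_congr rfl fun j _ => Finset.sum_congr rfl fun i _ => by
    rw [pd_congr (fun z hz => pd_congr hfg j hz) i hy]

theorem smoothOff_homExt_of_continuous {g : Sph n → ℝ} (hg : Continuous g) :
    SmoothOff 0 (homExt g) := by
  intro y hy
  refine contDiffAt_zero.2 ⟨{0}ᶜ, isOpen_compl_singleton.mem_nhds hy, ?_⟩
  rw [continuousOn_iff_continuous_domRestrict]
  have e1 : ({0}ᶜ : Set (E n)).domRestrict (homExt g) = fun x : ({0}ᶜ : Set (E n)) =>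
      g ⟨‖(x : E n)‖⁻¹ • (x : E n), by simp [norm_smul, mem_compl_singleton_iff.1 x.2]⟩ :=
    funext fun x => by rw [domRestrict_apply, homExt,
      dif_neg (mem_compl_singleton_iff.1 x.2)]
  rw [e1]
  refine hg.comp (Continuous.subtype_mk ?_ _)
  exact (continuous_subtype_val.norm.inv₀ fun x => norm_ne_zero_iff.2 x.2).smul
    continuous_subtype_val

/-- The spectral gap inequality `lam ∫ u² ≤ ∫ |grad u|²` for even functions of mean zero. -/
def EvenGap (h : E n → ℝ) (lam : ℝ) : Prop :=
  ∀ u : E n → ℝ, SmoothOff 2 u → Hom 0 u → (∀ y, y ≠ 0 → u (-y) = u y) → wint h u = 0 →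
    lam * wint h (fun y => u y ^ 2) ≤ wint h (carre h u u)

theorem EvenGap.mono {h : E n → ℝ} (hh : IsPotential h) {a b : ℝ} (hb : EvenGap h b) (hab : a ≤ b) :
    EvenGap h a := fun u hu hu0 hue hum =>
  (mul_le_mul_of_nonneg_right hab (hh.wint_nonneg fun _ _ => sq_nonneg _)).trans
    (hb u hu hu0 hue hum)

theorem evenGap_zero {h : E n → ℝ} (hh : IsPotential h) : EvenGap h 0 := fun u hu hu0 _ _ => by
  rw [zero_mul]
  exact hh.wint_nonneg fun y hy => hh.carre_self_nonneg hy

theorem IsEvenC2.smoothOff {z : Sph n → ℝ} (hz : IsEvenC2 z) : SmoothOff 2 (homExt z) :=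
  .of_contDiffOn hz.1

theorem isEvenC2_of_hom {u : E n → ℝ} (hu : SmoothOff 2 u) (hu0 : Hom 0 u)
    (hue : ∀ y, y ≠ 0 → u (-y) = u y) : IsEvenC2 fun θ : Sph n => u θ :=
  ⟨fun _ hy => (hu.congr (fun _ hy => homExt_eq_of_hom hu0 hy) _ hy).contDiffWithinAt,
    fun θ => hue θ (sph_ne_zero θ)⟩

namespace IsSmoothEvenBody

variable {K : Set (E n)} (hK : IsSmoothEvenBody K)

include hK

theorem nu_eq : nu K = (sph n).withDensity fun θ => ENNReal.ofReal (weight (supp K) θ) := by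
  rw [nu]
  congr 1
  exact funext fun θ => by rw [hK.isPotential_supp.weight_eq]

theorem isFiniteMeasure_nu : IsFiniteMeasure (nu K) := by
  rw [hK.nu_eq]
  exact isFiniteMeasure_withDensity_ofReal hK.isPotential_supp.smooth_weight.integrable_sph.2

/-- Integrals with respect to `ν_K` of the restriction of `f` to the sphere. -/
theorem integral_nu {g : Sph n → ℝ} {f : E n → ℝ} (hf : ∀ θ : Sph n, g θ = f θ) :
    ∫ θ, g θ ∂(nu K) = wint (supp K) f := by
  have hw := hK.isPotential_supp.smooth_weight
  rw [hK.nu_eq, integral_withDensity_eq_integral_toReal_smul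
    hw.continuous_sph.measurable.ennreal_ofReal (by simp), wint]
  refine integral_congr_ae (.of_forall fun θ => ?_)
  simp only [smul_eq_mul, hf, ENNReal.toReal_ofReal
    (hK.isPotential_supp.weight_pos (sph_ne_zero θ)).le]

theorem integral_nu_neg (hn : n ≠ 0) (g : Sph n → ℝ) :
    ∫ θ, g (-θ) ∂(nu K) = ∫ θ, g θ ∂(nu K) := by
  have h1 : ∀ θ : Sph n, g (-θ) = homExt g (-(θ : E n)) := fun θ => (homExt_sph g (-θ)).symm
  rw [hK.integral_nu (f := fun y => homExt g (-y)) h1,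
    hK.integral_nu fun θ => (homExt_sph g θ).symm, hK.isPotential_supp.wint_comp_neg hn]

theorem gradSq_eq {z : Sph n → ℝ} (hz : SmoothOff 2 (homExt z)) (θ : Sph n) :
    gradSq K z θ = carre (supp K) (homExt z) (homExt z) θ :=
  hK.isPotential_supp.inner_inverse_sphGrad hz

theorem laplace_eq {z : Sph n → ℝ} (hz : SmoothOff 2 (homExt z)) (θ : Sph n) :
    laplace K z θ = lap (supp K) (homExt z) θ :=
  hK.isPotential_supp.trace_inverse_D2_mul hz

theorem localEvenLpBM {p : ℝ} (hgap : EvenGap (supp K) (n - p)) : LocalEvenLpBM K p := by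
  intro z hz hzm
  have hs := hz.smoothOff
  have hs1 : SmoothOff 1 (homExt z) := hs.of_le (by norm_num)
  have h0 := hom_homExt z
  have h1 : ∫ θ, gradSq K z θ ∂(nu K) = wint (supp K) (carre (supp K) (homExt z) (homExt z)) :=
    hK.integral_nu fun θ => hK.gradSq_eq hs θ
  have h2 : ∫ θ, -laplace K z θ * z θ ∂(nu K) =
      wint (supp K) (carre (supp K) (homExt z) (homExt z)) := by
    rw [hK.integral_nu (f := fun y => -(homExt z y * lap (supp K) (homExt z) y)) fun θ => by
      rw [hK.laplace_eq hs, homExt_sph]; ring, wint_neg,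
      hK.isPotential_supp.wint_mul_lap hs1 h0 hs h0, neg_neg]
  have h3 : ∫ θ, z θ ^ 2 ∂(nu K) = wint (supp K) (fun y => homExt z y ^ 2) :=
    hK.integral_nu fun θ => by rw [homExt_sph]
  have h4 : wint (supp K) (homExt z) = 0 :=
    (hK.integral_nu fun θ => (homExt_sph z θ).symm).symm.trans hzm
  rw [h1, h2, h3]
  exact ⟨rfl, hgap _ hs h0 (fun y hy => homExt_neg hz.2 hy) h4⟩

/-! ### The bottom of the spectrum -/

omit hK in
theorem sq_norm_eq (u : Lp ℝ 2 (nu K)) : ‖u‖ ^ 2 = ∫ θ, u θ ^ 2 ∂(nu K) := by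
  rw [← real_inner_self_eq_norm_sq, L2.inner_def]
  exact integral_congr_ae (.of_forall fun θ => by simp [sq])

theorem sq_norm_eq_wint {u : Lp ℝ 2 (nu K)} {f : E n → ℝ} (hu : ∀ᵐ θ ∂(nu K), u θ = f θ) :
    ‖u‖ ^ 2 = wint (supp K) (fun y => f y ^ 2) := by
  rw [sq_norm_eq, ← hK.integral_nu (g := fun θ => f θ ^ 2) fun _ => rfl]
  refine integral_congr_ae ?_
  filter_upwards [hu] with θ hθ
  rw [hθ]

theorem memLp_nu {g : Sph n → ℝ} (hg : Continuous g) : MemLp g 2 (nu K) := by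
  have := hK.isFiniteMeasure_nu
  exact hg.memLp_of_hasCompactSupport (HasCompactSupport.of_compactSpace _)

theorem continuous_laplace {z : Sph n → ℝ} (hz : SmoothOff 2 (homExt z)) :
    Continuous (laplace K z) := by
  rw [funext (hK.laplace_eq hz)]
  exact (hK.isPotential_supp.smooth_lap_zero hz).continuous_sph

omit hK in
theorem continuous_of_smoothOff {z : Sph n → ℝ} (hz : SmoothOff 2 (homExt z)) : Continuous z := by
  have := hz.continuous_sph
  simpa only [homExt_sph] using this

/-- The graph on `C²` functions is a subgroup, stated in the form needed for `AddSubgroup.ofSub`. -/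
theorem sub_mem_coreGraph {q r : Lp ℝ 2 (nu K) × Lp ℝ 2 (nu K)} (hq : q ∈ coreGraph K)
    (hr : r ∈ coreGraph K) : q + -r ∈ coreGraph K := by
  obtain ⟨z, hz, hzm, hq1, hq2⟩ := hq
  obtain ⟨w, hw, hwm, hr1, hr2⟩ := hr
  have hzs := hz.smoothOff
  have hws := hw.smoothOff
  have hext : ∀ y, homExt (fun θ => z θ - w θ) y = homExt z y + -1 * homExt w y := fun y => by
    by_cases hy : y = 0
    · simp [homExt, hy]
    · simp only [homExt, dif_neg hy]; ring
  have hs : SmoothOff 2 (homExt fun θ => z θ - w θ) :=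
    (hzs.add ((SmoothOff.const (-1)).mul hws)).congr fun y _ => hext y
  have hlap : ∀ θ, laplace K (fun θ => z θ - w θ) θ = laplace K z θ - laplace K w θ := fun θ => by
    rw [hK.laplace_eq hs, hK.laplace_eq hzs, hK.laplace_eq hws,
      lap_congr (fun y _ => hext y) (sph_ne_zero θ),
      lap_add hzs ((SmoothOff.const (-1)).mul hws) (sph_ne_zero θ), lap_const_mul]
    ring
  refine ⟨fun θ => z θ - w θ, ⟨fun y hy => (hs y hy).contDiffWithinAt, fun θ => ?_⟩, ?_, ?_, ?_⟩
  · simp only [hz.2 θ, hw.2 θ]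
  · have := hK.isFiniteMeasure_nu
    rw [integral_sub ((hK.memLp_nu (continuous_of_smoothOff hzs)).integrable (by norm_num))
      ((hK.memLp_nu (continuous_of_smoothOff hws)).integrable (by norm_num)), hzm, hwm, sub_zero]
  · rw [← sub_eq_add_neg]
    filter_upwards [Lp.coeFn_sub q.1 r.1, hq1, hr1] with θ h1 h2 h3
    rw [Prod.fst_sub, h1, Pi.sub_apply, h2, h3]
  · rw [← sub_eq_add_neg]
    filter_upwards [Lp.coeFn_sub q.2 r.2, hq2, hr2] with θ h1 h2 h3
    rw [Prod.snd_sub, h1, Pi.sub_apply, h2, h3, hlap]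
    ring

theorem mem_coreGraph_of_smooth {u : E n → ℝ} (hu : u ∈ hK.isPotential_supp.smoothMeanZero 1) :
    ∃ q ∈ coreGraph K, (∀ᵐ θ ∂(nu K), q.1 θ = u θ) ∧
      ∀ᵐ θ ∂(nu K), q.2 θ = -lap (supp K) u θ := by
  have hu2 : SmoothOff 2 u := SmoothOff.two hu.1.1
  have hu0 := hu.1.2
  have hext : ∀ y, y ≠ 0 → homExt (fun θ : Sph n => u θ) y = u y :=
    fun y hy => homExt_eq_of_hom hu0 hy
  have hs : SmoothOff 2 (homExt fun θ : Sph n => u θ) := hu2.congr hext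
  have hl : ∀ θ, laplace K (fun θ : Sph n => u θ) θ = lap (supp K) u θ := fun θ => by
    rw [hK.laplace_eq hs, lap_congr hext (sph_ne_zero θ)]
  have m1 := hK.memLp_nu hu2.continuous_sph
  have m2 : MemLp (fun θ => -laplace K (fun θ : Sph n => u θ) θ) 2 (nu K) :=
    hK.memLp_nu (hK.continuous_laplace hs).neg
  refine ⟨(m1.toLp, m2.toLp), ⟨fun θ : Sph n => u θ, isEvenC2_of_hom hu2 hu0 fun y hy => ?_, ?_,
    m1.coeFn_toLp, m2.coeFn_toLp⟩, m1.coeFn_toLp, ?_⟩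
  · rw [hu.2.2.1 y hy, one_mul]
  · exact (hK.integral_nu fun _ => rfl).trans hu.2.2.2
  · filter_upwards [m2.coeFn_toLp] with θ h1
    rw [h1, hl]

/-- The a priori bound for `-Δ_K - μ` below the gap. -/
theorem norm_le_of_mem_coreGraph {lam μ : ℝ} (hμ : μ < lam) (hgap : EvenGap (supp K) lam)
    {q : Lp ℝ 2 (nu K) × Lp ℝ 2 (nu K)} (hq : q ∈ coreGraph K) :
    (lam - μ) * ‖q.1‖ ≤ ‖q.2 - μ • q.1‖ := by
  obtain ⟨z, hz, hzm, hq1, hq2⟩ := hq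
  have hs := hz.smoothOff
  have h0 := hom_homExt z
  have hm : wint (supp K) (homExt z) = 0 :=
    (hK.integral_nu fun θ => (homExt_sph z θ).symm).symm.trans hzm
  have h1 := hK.isPotential_supp.sq_mul_wint_le hs h0 (lam := lam) (c := -μ) (by linarith)
    (hgap _ hs h0 (fun y hy => homExt_neg hz.2 hy) hm)
  rw [← hK.sq_norm_eq_wint (u := q.1) (by simpa only [homExt_sph] using hq1),
    ← hK.sq_norm_eq_wint (u := q.2 - μ • q.1) ?_, ← mul_pow] at h1
  · exact (sq_le_sq₀ (mul_nonneg (by linarith) (norm_nonneg _)) (norm_nonneg _)).1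
      (by rwa [← sub_eq_add_neg] at h1)
  · filter_upwards [Lp.coeFn_sub q.2 (μ • q.1), Lp.coeFn_smul μ q.1, hq1, hq2] with θ e1 e2 e3 e4
    rw [e1, Pi.sub_apply, e2, Pi.smul_apply, e3, e4, hK.laplace_eq hs, homExt_sph, smul_eq_mul]
    ring

theorem norm_le_of_mem_closure {lam μ : ℝ} (hμ : μ < lam) (hgap : EvenGap (supp K) lam)
    {q : Lp ℝ 2 (nu K) × Lp ℝ 2 (nu K)} (hq : q ∈ closure (coreGraph K)) :
    (lam - μ) * ‖q.1‖ ≤ ‖q.2 - μ • q.1‖ := by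
  have hc : IsClosed {q : Lp ℝ 2 (nu K) × Lp ℝ 2 (nu K) |
      (lam - μ) * ‖q.1‖ ≤ ‖q.2 - μ • q.1‖} :=
    isClosed_le (by fun_prop) (by fun_prop)
  exact closure_minimal (fun q hq => hK.norm_le_of_mem_coreGraph hμ hgap hq) hc hq

/-- Continuous even functions of mean zero are dense in the even `L²` functions of mean zero. -/
theorem exists_continuous_close (hn : 2 ≤ n) {w : Lp ℝ 2 (nu K)} (hw : w ∈ evenL2 K) {ε : ℝ}
    (hε : 0 < ε) : ∃ f ∈ hK.isPotential_supp.meanZero 1, ∃ v : Lp ℝ 2 (nu K),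
      (∀ᵐ θ ∂(nu K), v θ = f θ) ∧ ‖w - v‖ < ε := by
  have := hK.isFiniteMeasure_nu
  have hn0 : n ≠ 0 := by omega
  obtain ⟨g, hg⟩ := (ContinuousMap.toLp_denseRange ℝ (nu K) ℝ (p := 2) (by norm_num)).exists_dist_lt
    w hε
  rw [dist_eq_norm] at hg
  -- symmetrization and centering do not increase the distance to `w`
  let s : Sph n → ℝ := fun θ => (g θ + g (-θ)) / 2
  have hsc : Continuous s := by
    have : Continuous fun θ : Sph n => g (-θ) := g.continuous.comp continuous_neg
    exact (g.continuous.add this).div_const 2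
  have hV : 0 < (nu K).real univ := by
    have h1 := hK.isPotential_supp.wint_one_pos hn
    rw [← hK.integral_nu (g := fun _ => 1) fun _ => rfl] at h1
    simpa using h1
  set V := (nu K).real univ
  set m : ℝ := (∫ θ, s θ ∂(nu K)) / V with hm
  let f : Sph n → ℝ := fun θ => s θ - m
  have hfc : Continuous f := hsc.sub continuous_const
  have hfm := hK.memLp_nu hfc
  have hsm := hK.memLp_nu hsc
  have hwm := Lp.memLp w
  have hgm := hK.memLp_nu g.continuous
  have hint : ∀ {r : Sph n → ℝ}, MemLp r 2 (nu K) → Integrable r (nu K) :=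
    fun hr => hr.integrable (by norm_num)
  have hfe : ∀ θ, f (-θ) = f θ := fun θ => by simp only [f, s, neg_neg]; ring
  have hf0 : ∫ θ, f θ ∂(nu K) = 0 := by
    rw [integral_sub (hint hsm) (integrable_const m), integral_const, smul_eq_mul, hm]
    field_simp
    ring
  refine ⟨homExt f, ⟨smoothOff_homExt_of_continuous hfc, fun y hy => ?_, ?_⟩, hfm.toLp, ?_, ?_⟩
  · rw [one_mul, homExt_neg hfe hy]
  · exact (hK.integral_nu fun θ => (homExt_sph f θ).symm).symm.trans hf0
  · filter_upwards [hfm.coeFn_toLp] with θ e1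
    rw [e1, homExt_sph]
  have hgn : ∫ θ, (w θ - g θ) ^ 2 ∂(nu K) < ε ^ 2 := by
    have h1 : ‖w - ContinuousMap.toLp 2 (nu K) ℝ g‖ ^ 2 < ε ^ 2 :=
      (sq_lt_sq₀ (norm_nonneg _) hε.le).2 hg
    rw [sq_norm_eq] at h1
    refine lt_of_eq_of_lt (integral_congr_ae ?_) h1
    filter_upwards [Lp.coeFn_sub w (ContinuousMap.toLp 2 (nu K) ℝ g),
      ContinuousMap.coeFn_toLp (p := 2) (𝕜 := ℝ) (nu K) g] with θ e1 e2
    rw [e1, Pi.sub_apply, e2]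
  have hgc : Continuous fun θ : Sph n => g (-θ) := g.continuous.comp continuous_neg
  have hgn' : ∫ θ, (w θ - g (-θ)) ^ 2 ∂(nu K) = ∫ θ, (w θ - g θ) ^ 2 ∂(nu K) := by
    rw [← hK.integral_nu_neg hn0 fun θ => (w θ - g θ) ^ 2]
    refine integral_congr_ae ?_
    filter_upwards [hw.1] with θ e1
    rw [e1]
  have i1 : Integrable (fun θ => (w θ - g θ) ^ 2) (nu K) := (hwm.sub hgm).integrable_sq
  have i2 : Integrable (fun θ => (w θ - g (-θ)) ^ 2) (nu K) :=
    (hwm.sub (hK.memLp_nu hgc)).integrable_sq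
  have i3 : Integrable (fun θ => (w θ - s θ) ^ 2) (nu K) := (hwm.sub hsm).integrable_sq
  have i4 : Integrable (fun θ => w θ - s θ) (nu K) := hint (hwm.sub hsm)
  have hs2 : ∫ θ, (w θ - s θ) ^ 2 ∂(nu K) ≤ ∫ θ, (w θ - g θ) ^ 2 ∂(nu K) := by
    calc _ ≤ ∫ θ, (1 / 2 * (w θ - g θ) ^ 2 + 1 / 2 * (w θ - g (-θ)) ^ 2) ∂(nu K) := by
          refine integral_mono i3 ((i1.const_mul _).add (i2.const_mul _)) fun θ => ?_
          simp only [s]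
          nlinarith [sq_nonneg (g θ - g (-θ))]
      _ = ∫ θ, (w θ - g θ) ^ 2 ∂(nu K) := by
          rw [integral_add (i1.const_mul _) (i2.const_mul _), integral_const_mul,
            integral_const_mul, hgn']
          ring
  have hf2 : ∫ θ, (w θ - f θ) ^ 2 ∂(nu K) = ∫ θ, (w θ - s θ) ^ 2 ∂(nu K) - m ^ 2 * V := by
    have e1 : ∀ θ, (w θ - f θ) ^ 2 = (w θ - s θ) ^ 2 + 2 * m * (w θ - s θ) + m ^ 2 := fun θ => by
      simp only [f]; ring
    have e2 : ∫ θ, s θ ∂(nu K) = m * V := by rw [hm]; field_simp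
    simp only [e1]
    have i5 : Integrable (fun θ => (w θ - s θ) ^ 2 + 2 * m * (w θ - s θ)) (nu K) :=
      i3.add (i4.const_mul _)
    rw [integral_add i5 (integrable_const _), integral_add i3 (i4.const_mul _), integral_const_mul,
      integral_sub (hint hwm) (hint hsm),
      hw.2, e2, integral_const, smul_eq_mul]
    ring
  have h1 : ‖w - hfm.toLp‖ ^ 2 = ∫ θ, (w θ - f θ) ^ 2 ∂(nu K) := by
    rw [sq_norm_eq]
    refine integral_congr_ae ?_
    filter_upwards [Lp.coeFn_sub w hfm.toLp, hfm.coeFn_toLp] with θ e1 e2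
    rw [e1, Pi.sub_apply, e2]
  refine (sq_lt_sq₀ (norm_nonneg _) hε.le).1 ?_
  rw [h1, hf2]
  have := mul_nonneg (sq_nonneg m) hV.le
  linarith

/-- Below the gap, `-Δ_K - μ` has dense range in the even functions of mean zero. -/
theorem exists_mem_coreGraph_close (hn : 2 ≤ n) {lam μ : ℝ} (hμ : μ < lam)
    (hgap : EvenGap (supp K) lam) {w : Lp ℝ 2 (nu K)} (hw : w ∈ evenL2 K) {ε : ℝ} (hε : 0 < ε) :
    ∃ q ∈ coreGraph K, ‖w - (q.2 - μ • q.1)‖ < ε := by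
  have hh := hK.isPotential_supp
  obtain ⟨f, hf, v, hv, hwv⟩ := hK.exists_continuous_close hn hw (half_pos hε)
  have hgap' : ∀ u ∈ hh.smoothMeanZero 1,
      max lam 0 * wint (supp K) (fun y => u y ^ 2) ≤ wint (supp K) (carre (supp K) u u) := by
    intro u hu
    have hue : ∀ y, y ≠ 0 → u (-y) = u y := fun y hy => by rw [hu.2.2.1 y hy, one_mul]
    rcases le_total lam 0 with h | h
    · rw [max_eq_right h]
      exact evenGap_zero hh u (SmoothOff.two hu.1.1) hu.1.2 hue hu.2.2.2
    · rw [max_eq_left h]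
      exact hgap u (SmoothOff.two hu.1.1) hu.1.2 hue hu.2.2.2
  obtain ⟨u, hu, hlt⟩ := hh.dense_of_gap hn (one_mul 1) (le_max_right _ _)
    (hμ.trans_le (le_max_left _ _)) hgap' hf (pow_pos (half_pos hε) 2)
  obtain ⟨q, hq, hq1, hq2⟩ := hK.mem_coreGraph_of_smooth hu
  refine ⟨q, hq, ?_⟩
  have h1 : ‖v - (q.2 - μ • q.1)‖ < ε / 2 := by
    refine (sq_lt_sq₀ (norm_nonneg _) (half_pos hε).le).1 (lt_of_eq_of_lt ?_ hlt)
    refine hK.sq_norm_eq_wint (f := fun y => f y - (-lap (supp K) u y - μ * u y)) ?_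
    filter_upwards [Lp.coeFn_sub v (q.2 - μ • q.1), Lp.coeFn_sub q.2 (μ • q.1),
      Lp.coeFn_smul μ q.1, hv, hq1, hq2] with θ e1 e2 e3 e4 e5 e6
    rw [e1, Pi.sub_apply, e2, Pi.sub_apply, e3, Pi.smul_apply, e4, e5, e6, smul_eq_mul]
  calc _ = ‖(w - v) + (v - (q.2 - μ • q.1))‖ := by congr 1; abel
    _ ≤ _ := norm_add_le _ _
    _ < ε := by linarith

/-- Below the gap, `-Δ_K - μ` is invertible: it is bounded below on the closure of the core graph,
and its range is dense. -/
theorem existsUnique_of_lt (hn : 2 ≤ n) {lam μ : ℝ} (hμ : μ < lam) (hgap : EvenGap (supp K) lam)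
    {w : Lp ℝ 2 (nu K)} (hw : w ∈ evenL2 K) :
    ∃! u : Lp ℝ 2 (nu K), (u, w + μ • u) ∈ closure (coreGraph K) := by
  obtain ⟨q₀, hq₀, -⟩ := hK.exists_mem_coreGraph_close hn hμ hgap hw one_pos
  have hc : 0 < lam - μ := sub_pos.2 hμ
  let G : AddSubgroup (Lp ℝ 2 (nu K) × Lp ℝ 2 (nu K)) :=
    (AddSubgroup.ofSub (coreGraph K) ⟨q₀, hq₀⟩
      fun _ hq _ hr => hK.sub_mem_coreGraph hq hr).topologicalClosure
  have hG : (G : Set (Lp ℝ 2 (nu K) × Lp ℝ 2 (nu K))) = closure (coreGraph K) := rfl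
  have hGc : IsClosed (G : Set (Lp ℝ 2 (nu K) × Lp ℝ 2 (nu K))) := isClosed_closure
  have : CompleteSpace G := hGc.completeSpace_coe
  let L : Lp ℝ 2 (nu K) × Lp ℝ 2 (nu K) →L[ℝ] Lp ℝ 2 (nu K) :=
    ContinuousLinearMap.snd ℝ _ _ - μ • ContinuousLinearMap.fst ℝ _ _
  have hL : ∀ q, L q = q.2 - μ • q.1 := fun _ => rfl
  let Φ : G →+ Lp ℝ 2 (nu K) := L.toLinearMap.toAddMonoidHom.comp G.subtype
  have hΦ : ∀ q : G, Φ q = q.1.2 - μ • q.1.1 := fun _ => rfl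
  have hbd : ∀ q ∈ G, (lam - μ) * ‖q.1‖ ≤ ‖q.2 - μ • q.1‖ := fun q hq =>
    hK.norm_le_of_mem_closure hμ hgap hq
  have hanti : AntilipschitzWith (Real.toNNReal (1 / (lam - μ) + 1 + |μ| / (lam - μ))) Φ := by
    refine AddMonoidHomClass.antilipschitz_of_bound Φ fun q => ?_
    have h1 := hbd q q.2
    rw [← hΦ] at h1
    have h2 : ‖q.1.1‖ ≤ 1 / (lam - μ) * ‖Φ q‖ := by
      rw [one_div, inv_mul_eq_div, le_div_iff₀ hc, mul_comm]; exact h1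
    have h3 : ‖q.1.2‖ ≤ ‖Φ q‖ + |μ| * ‖q.1.1‖ := by
      calc _ = ‖Φ q + μ • q.1.1‖ := by rw [hΦ, sub_add_cancel]
        _ ≤ _ := (norm_add_le _ _).trans (by rw [norm_smul, Real.norm_eq_abs])
    rw [Real.coe_toNNReal _ (by positivity)]
    have h4 : |μ| * ‖q.1.1‖ ≤ |μ| / (lam - μ) * ‖Φ q‖ :=
      (mul_le_mul_of_nonneg_left h2 (abs_nonneg μ)).trans (le_of_eq (by ring))
    have h5 : 0 ≤ ‖Φ q‖ := norm_nonneg _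
    have h6 : 0 ≤ 1 / (lam - μ) * ‖Φ q‖ := by positivity
    have h7 : 0 ≤ |μ| / (lam - μ) * ‖Φ q‖ := by positivity
    rw [AddSubgroup.coe_norm, Prod.norm_def]
    exact max_le (by linarith) (by linarith)
  have hcl : IsClosed (range Φ) :=
    hanti.isClosed_range (L.uniformContinuous.comp uniformContinuous_subtype_val)
  have hmem : w ∈ range Φ := by
    rw [← hcl.closure_eq, Metric.mem_closure_iff]
    intro ε hε
    obtain ⟨q, hq, hlt⟩ := hK.exists_mem_coreGraph_close hn hμ hgap hw hε
    exact ⟨_, ⟨⟨q, subset_closure hq⟩, rfl⟩, by rw [dist_eq_norm, hΦ]; exact hlt⟩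
  obtain ⟨q, hq⟩ := hmem
  have hq' : q.1.2 = w + μ • q.1.1 := by rw [← hq, hΦ, sub_add_cancel]
  refine ⟨q.1.1, ?_, fun u hu => ?_⟩
  · change (q.1.1, w + μ • q.1.1) ∈ closure (coreGraph K)
    rw [← hq', ← hG]
    exact q.2
  · have h1 : Φ ⟨(u, w + μ • u), hu⟩ = Φ q := by
      rw [hq, hΦ, add_sub_cancel_right]
    have h2 := hanti.injective h1
    rw [← h2]

theorem le_lambdaOneEven (hn : 2 ≤ n) {lam : ℝ} (hgap : EvenGap (supp K) lam) :
    (lam : EReal) ≤ lambdaOneEven K := by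
  refine le_sInf ?_
  rintro _ ⟨μ, hμ, rfl⟩
  rw [EReal.coe_le_coe_iff]
  by_contra! hlt
  exact hμ fun w hw => hK.existsUnique_of_lt hn hlt hgap hw

end IsSmoothEvenBody

/-! ### Curvature pinching and the spectral gap -/

namespace IsSmoothEvenBody

open Matrix

variable {K : Set (E n)} (hK : IsSmoothEvenBody K)

include hK

/-- The spectral gap under the bounds on the centro-affine metric of a linear image of `K`. -/
theorem evenGap (hn : 2 ≤ n) (T : E n ≃L[ℝ] E n) {A B R : ℝ} (hA : 0 < A) (hB : 0 < B)
    (hmet : MetricBetween (T '' K) (1 / B) (1 / A)) (hR : T '' K ⊆ closedBall 0 R) :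
    EvenGap (supp K) ((n : ℝ) - (2 - (((n : ℝ) - 1) / 2 * A - R ^ 2) / B)) := by
  intro u hu hu0 hue hum
  let M : Matrix (Fin n) (Fin n) ℝ := (toLpLin 2 2).symm (T : E n →ₗ[ℝ] E n)
  have hM : ∀ v : E n, M *ᵥ (fun i => v i) = fun i => T v i := fun v => by
    have h1 : toLpLin 2 2 M = (T : E n →ₗ[ℝ] E n) := (toLpLin 2 2).apply_symm_apply _
    have h2 : toLpLin 2 2 M v = T v := by rw [h1]; rfl
    rw [← h2]
    rfl
  have hAR : A ≤ R ^ 2 :=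
    (hK.image T).le_sq_of_metric_le hn hA (fun x hx v hv => (hmet x hx v hv).2) hR
  have hdot : ∀ v : E n, M *ᵥ (fun i => v i) ⬝ᵥ M *ᵥ (fun i => v i) = ⟪T v, T v⟫ := fun v => by
    rw [hM, inner_eq_dotProduct]
  have key := hK.isPotential_supp.even_gap hn M hA hB (fun y hy v hv => ?_) (R := R)
    (fun y hy => ?_) hAR hu hu0 hue hum
  · convert! key using 2
    ring
  · have h1 := hdot (WithLp.toLp 2 v)
    have h2 := hK.hessInv_bounds T hmet hy (u := WithLp.toLp 2 v) (by
      rw [inner_eq_dotProduct, dotProduct_comm]; exact hv)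
    rw [← h1] at h2
    exact h2
  · have h1 := hdot (gradient (supp K) y)
    have h2 : (fun i => gradient (supp K) y i) = fun i => pd i (supp K) y :=
      funext fun i => gradient_apply _ _ _
    have h3 := hK.norm_image_grad_supp_le T hR hy
    rw [← h2, h1, real_inner_self_eq_norm_sq]
    exact pow_le_pow_left₀ (norm_nonneg _) h3 2

/-- Bounds on the second fundamental form give a ball containing the body, and bounds on the
centro-affine metric. -/
theorem evenGap_of_secondForm (hn : 2 ≤ n) (T : E n ≃L[ℝ] E n) {r R : ℝ} (hr : 0 < r) (hR : 0 < R)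
    (hII : SecondFormBetween (T '' K) (1 / R) (1 / r)) :
    EvenGap (supp K) ((n : ℝ) - (3 - ((n : ℝ) - 1) / 2 * (r ^ 2 / R ^ 2))) := by
  have h1 := hK.evenGap hn T (pow_pos hr 2) (pow_pos hR 2)
    ((hK.image T).metricBetween_of_secondForm hn hr hR hII)
    ((hK.image T).subset_closedBall_of_secondForm hn hr hR hII)
  convert! h1 using 2
  field_simp
  ring

end IsSmoothEvenBody

end CentroAffine

end

theorem theorem6p3 (n : ℕ) (hn : 2 ≤ n) (K : Set (CentroAffine.E n))
    (hK : CentroAffine.IsSmoothEvenBody K) :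
    (∀ (T : CentroAffine.E n ≃ₗ[ℝ] CentroAffine.E n) (A B R : ℝ), 0 < A → 0 < B → 0 < R →
      CentroAffine.MetricBetween (T '' K) (1 / B) (1 / A) →
      T '' K ⊆ Metric.closedBall 0 R →
      ∀ p : ℝ, p = 2 - (((n : ℝ) - 1) / 2 * A - R ^ 2) / B →
        (((n : ℝ) - p : ℝ) : EReal) ≤ CentroAffine.lambdaOneEven K ∧
        CentroAffine.LocalEvenLpBM K p) ∧
    (∀ (T : CentroAffine.E n ≃ₗ[ℝ] CentroAffine.E n) (r R : ℝ), 0 < r → 0 < R →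
      CentroAffine.SecondFormBetween (T '' K) (1 / R) (1 / r) →
      (∀ p : ℝ, p = 3 - ((n : ℝ) - 1) / 2 * (r ^ 2 / R ^ 2) →
        (((n : ℝ) - p : ℝ) : EReal) ≤ CentroAffine.lambdaOneEven K ∧
        CentroAffine.LocalEvenLpBM K p) ∧
      ((R / r) ^ 2 ≤ ((n : ℝ) - 1) / 6 →
        ((n : ℝ) : EReal) ≤ CentroAffine.lambdaOneEven K ∧
        CentroAffine.LocalEvenLpBM K 0)) := by
  refine ⟨fun T A B R hA hB _ hmet hsub p hp => ?_, fun T r R hr hR hII => ?_⟩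
  · have hgap := hK.evenGap hn T.toContinuousLinearEquiv hA hB hmet hsub
    rw [← hp] at hgap
    exact ⟨hK.le_lambdaOneEven hn hgap, hK.localEvenLpBM hgap⟩
  have hgap := hK.evenGap_of_secondForm hn T.toContinuousLinearEquiv hr hR hII
  refine ⟨fun p hp => ?_, fun hpinch => ?_⟩
  · rw [← hp] at hgap
    exact ⟨hK.le_lambdaOneEven hn hgap, hK.localEvenLpBM hgap⟩
  · have h1 : (3 : ℝ) ≤ ((n : ℝ) - 1) / 2 * (r ^ 2 / R ^ 2) := by
      rw [div_pow, div_le_iff₀ (by positivity)] at hpinch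
      rw [← mul_div_assoc, le_div_iff₀ (by positivity)]
      linarith
    have hgap' : CentroAffine.EvenGap (CentroAffine.supp K) ((n : ℝ) - 0) :=
      hgap.mono hK.isPotential_supp (by linarith)
    refine ⟨?_, hK.localEvenLpBM hgap'⟩
    rw [sub_zero] at hgap'
    exact hK.le_lambdaOneEven hn hgap'
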